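/- Let $R$ be the localization of $\mathbb C[x,y]/(xy)$ at the maximal ideal $(x,y)$, and let $m\ge 1$. For an ideal $I$ of $R$, the colength of $I$ is $\dim_{\mathbb C}R/I$. For $a\in\mathbb C$, $a\ne 0$, put $$I^m_i(a)=(y^i+a\,x^{m-i})\quad(1\le i\le m-1),\qquad Q^m_i=(x^{m-i+1},\,y^i)\quad(1\le i\le m).$$ The punctual Hilbert scheme $\mathrm{Hilb}^0_m(R)$ is the $\mathbb C$-scheme that represents the following functor of commutative $\mathbb C$-algebras $A$. The value at $A$ is the set of ideals $I$ of $A\otimes_{\mathbb C}R$ such that, Zariski-locally on $\operatorname{Spec}A$, the $A$-module $(A\otimes R)/I$ is free of rank $m$ and every $r$ in the maximal ideal of $R$ acts on it with characteristic polynomial $T^m$. (This is the scheme-theoretic fibre of the cycle map from the Hilbert scheme to the $m$-th symmetric product over $m$ times the node.) (i) The ideals of $R$ of colength $m$ are exactly the $I^m_i(a)$ with $1\le i\le m-1$, $a\neq 0$, and the $Q^m_i$ with $1\le i\le m$. Let now $m\ge 2$. Then $\mathrm{Hilb}^0_m(R)$ exists, its $\mathbb C$-points correspond bijectively to the ideals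 of $R$ of colength $m$, and the following hold. (ii) For $1\le i\le m-1$ let $C^m_i$ be the closure in $\mathrm{Hilb}^0_m(R)$ of the set $\{I^m_i(a): a\ne 0\}$. With its reduced structure $C^m_i$ is isomorphic to $\mathbb P^1_{\mathbb C}$, and its $\mathbb C$-points are exactly the $I^m_i(a)$ with $a\neq 0$, $Q^m_i$ and $Q^m_{i+1}$. Moreover $$\lim_{a\to 0}I^m_i(a)=Q^m_i,\qquad \lim_{a\to\infty}I^m_i(a)=Q^m_{i+1},$$ in the sense that $a\mapsto I^m_i(a)$, respectively $a\mapsto I^m_i(1/a)$, extends to a morphism $\mathbb A^1\to\mathrm{Hilb}^0_m(R)$ with the indicated value at $0$. (iii) The scheme $\mathrm{Hilb}^0_m(R)$ is reduced and is the chain $$C^m_1\cup_{Q^m_2}C^m_2\cup\cdots\cup_{Q^m_{m-1}} C^m_{m-1};$$ that is, it is the union of the $C^m_i$, $C^m_i\cap C^m_{i+1}=\{Q^m_{i+1}\}$ for $1\le i\le m-2$, and $C^m_i\cap C^m_j=\emptyset$ for $|i-j|\ge 2$. At each of $Q^m_2,\dots,Q^m_{m-1}$ it has a node, i.e. its completed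 local ring is isomorphic to $\mathbb C[[u,v]]/(uv)$ as a $\mathbb C$-algebra; at every other point it is smooth over $\mathbb C$ of relative dimension $1$. (iv) For $1\le i\le m-1$ and $a\neq 0$, the only ideal of colength $m-1$ containing $I^m_i(a)$ is $Q^{m-1}_i$. For $1\le i\le m$, the ideals of colength $m-1$ containing $Q^m_i$ are exactly: the $I^{m-1}_{i-1}(a)$ with $a\ne 0$ (if $2\le i\le m-1$), $Q^{m-1}_i$ (if $i\le m-1$), and $Q^{m-1}_{i-1}$ (if $i\ge 2$). -/

import Mathlib

open CategoryTheory AlgebraicGeometry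
open scoped TensorProduct

noncomputable section

namespace NodeHilb

/-! ### The local ring of the node -/

/-- The coordinate ring `ℂ[x, y] / (xy)`. -/
abbrev NodeCoord : Type :=
  MvPolynomial (Fin 2) ℂ ⧸
    Ideal.span {(MvPolynomial.X 0 * MvPolynomial.X 1 : MvPolynomial (Fin 2) ℂ)}

/-- The class of `x` in `ℂ[x, y] / (xy)`. -/
def coordX : NodeCoord := Ideal.Quotient.mk _ (MvPolynomial.X 0)

/-- The class of `y` in `ℂ[x, y] / (xy)`. -/
def coordY : NodeCoord := Ideal.Quotient.mk _ (MvPolynomial.X 1)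

/-- The ideal `(x, y)` of `ℂ[x, y] / (xy)`. -/
def originIdeal : Ideal NodeCoord := Ideal.span {coordX, coordY}

/-- Evaluation at the origin. -/
def evalOrigin : NodeCoord →+* ℂ :=
  Ideal.Quotient.lift _ (MvPolynomial.constantCoeff (R := ℂ) (σ := Fin 2)) (by
    intro p hp
    have h : Ideal.span {(MvPolynomial.X 0 * MvPolynomial.X 1 : MvPolynomial (Fin 2) ℂ)} ≤
        RingHom.ker (MvPolynomial.constantCoeff (R := ℂ) (σ := Fin 2)) := by
      rw [Ideal.span_singleton_le_iff_mem, RingHom.mem_ker]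
      simp
    exact h hp)

theorem originIdeal_eq_ker : originIdeal = RingHom.ker evalOrigin := by
  apply le_antisymm
  · rw [originIdeal, Ideal.span_le]
    rintro z (rfl | rfl)
    · exact MvPolynomial.constantCoeff_X ℂ 0
    · exact MvPolynomial.constantCoeff_X ℂ 1
  · intro z hz
    obtain ⟨p, rfl⟩ := Ideal.Quotient.mk_surjective z
    have hp : MvPolynomial.constantCoeff p = 0 := hz
    have hmem : p ∈ Ideal.span (MvPolynomial.X '' (Set.univ : Set (Fin 2)) :
        Set (MvPolynomial (Fin 2) ℂ)) := by
      rw [MvPolynomial.mem_ideal_span_X_image]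
      intro d hd
      by_contra hcon
      have hd0 : d = 0 := by
        ext i
        by_contra hi
        exact hcon ⟨i, Set.mem_univ _, hi⟩
      subst hd0
      exact (MvPolynomial.mem_support_iff.mp hd) hp
    have hle : Ideal.span (MvPolynomial.X '' (Set.univ : Set (Fin 2)) :
        Set (MvPolynomial (Fin 2) ℂ)) ≤ originIdeal.comap (Ideal.Quotient.mk _) := by
      rw [Ideal.span_le]
      rintro _ ⟨i, -, rfl⟩
      fin_cases i
      · exact Ideal.subset_span (Or.inl rfl)
      · exact Ideal.subset_span (Or.inr rfl)
    exact hle hmem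

instance originIdeal_isPrime : originIdeal.IsPrime := by
  rw [originIdeal_eq_ker]
  exact RingHom.ker_isPrime _

/-- The local ring `R` of the node: the localization of `ℂ[x, y] / (xy)` at `(x, y)`. -/
def NodeRing : Type := Localization.AtPrime originIdeal

instance : CommRing NodeRing := inferInstanceAs (CommRing (Localization.AtPrime originIdeal))

instance : Algebra NodeCoord NodeRing :=
  inferInstanceAs (Algebra NodeCoord (Localization.AtPrime originIdeal))

instance : IsLocalization.AtPrime NodeRing originIdeal :=
  inferInstanceAs (IsLocalization.AtPrime (Localization.AtPrime originIdeal) originIdeal)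

instance : IsLocalRing NodeRing := IsLocalization.AtPrime.isLocalRing NodeRing originIdeal

instance : Algebra ℂ NodeRing := Algebra.compHom NodeRing (algebraMap ℂ NodeCoord)

instance : IsScalarTower ℂ NodeCoord NodeRing :=
  IsScalarTower.of_algebraMap_eq (R := ℂ) (S := NodeCoord) (A := NodeRing) fun _ => rfl

/-- The element `x` of `R`. -/
def nx : NodeRing := algebraMap NodeCoord NodeRing coordX

/-- The element `y` of `R`. -/
def ny : NodeRing := algebraMap NodeCoord NodeRing coordY

/-- The ideal `I` of `R` has colength `m`, i.e. `dim_ℂ R / I = m`. -/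
def HasColength (I : Ideal NodeRing) (m : ℕ) : Prop :=
  Module.Finite ℂ (NodeRing ⧸ I) ∧ Module.finrank ℂ (NodeRing ⧸ I) = m

/-- The ideal `I^m_i(a) = (y^i + a x^(m-i))`, used for `1 ≤ i ≤ m - 1` and `a ≠ 0`. -/
def idealI (m i : ℕ) (a : ℂ) : Ideal NodeRing :=
  Ideal.span {ny ^ i + algebraMap ℂ NodeRing a * nx ^ (m - i)}

/-- The ideal `Q^m_i = (x^(m-i+1), y^i)`, used for `1 ≤ i ≤ m`. -/
def idealQ (m i : ℕ) : Ideal NodeRing :=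
  Ideal.span {nx ^ (m - i + 1), ny ^ i}

/-! ### The punctual Hilbert scheme -/

section Family

variable (A : Type) [CommRing A] [Algebra ℂ A]

/-- Multiplication by `1 ⊗ r` on the quotient `(A ⊗ R) / I`, as an `A`-linear map. -/
def mulQuot (I : Ideal (A ⊗[ℂ] NodeRing)) (r : NodeRing) :
    ((A ⊗[ℂ] NodeRing) ⧸ I) →ₗ[A] ((A ⊗[ℂ] NodeRing) ⧸ I) :=
  LinearMap.mulLeft A (Ideal.Quotient.mk I (1 ⊗ₜ[ℂ] r))

/-- `I` is a family over `Spec A` of ideals of colength `m` supported at the node, i.e. an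
`A`-point of the fibre over `m · [origin]` of the cycle map from the Hilbert scheme of length-`m`
subschemes of `Spec R` to the `m`-th symmetric product. In detail: Zariski-locally on `Spec A`
the quotient `(A ⊗ R) / I` is free of rank `m`, and every `r` in the maximal ideal of `R` acts
on it with characteristic polynomial `T ^ m`. -/
def IsPunctualFamily (m : ℕ) (I : Ideal (A ⊗[ℂ] NodeRing)) : Prop :=
  ∀ p : PrimeSpectrum A, ∃ f : A, f ∉ p.asIdeal ∧
    ∃ b : Module.Basis (Fin m) (Localization.Away f)
        (Localization.Away f ⊗[A] ((A ⊗[ℂ] NodeRing) ⧸ I)),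
      ∀ r ∈ IsLocalRing.maximalIdeal NodeRing,
        (LinearMap.toMatrix b b
          ((mulQuot A I r).baseChange (Localization.Away f))).charpoly = Polynomial.X ^ m

end Family

/-- For a `ℂ`-scheme `π : X ⟶ Spec ℂ` and a `ℂ`-algebra `A`, the set `X(A)` of morphisms
`Spec A ⟶ X` over `Spec ℂ`. -/
def Points {X : Scheme.{0}} (π : X ⟶ Spec (.of ℂ)) (A : Type) [CommRing A] [Algebra ℂ A] : Type :=
  {g : Spec (.of A) ⟶ X // g ≫ π = Spec.map (CommRingCat.ofHom (algebraMap ℂ A))}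

/-- The map `X(A) → X(B)` induced by a homomorphism `A → B` of `ℂ`-algebras. -/
def Points.map {X : Scheme.{0}} {π : X ⟶ Spec (.of ℂ)} {A B : Type} [CommRing A] [Algebra ℂ A]
    [CommRing B] [Algebra ℂ B] (φ : A →ₐ[ℂ] B) (g : Points π A) : Points π B :=
  ⟨Spec.map (CommRingCat.ofHom (φ : A →+* B)) ≫ g.1, by
    rw [Category.assoc, g.2, ← Spec.map_comp, ← CommRingCat.ofHom_comp]
    congr 2
    exact φ.comp_algebraMap⟩

/-- A punctual Hilbert scheme of the node: a scheme over `ℂ` representing the functor that takes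
a `ℂ`-algebra `A` to the set of families over `Spec A` of colength-`m` ideals supported at the
node, where a homomorphism `A → B` acts by extension of ideals along `A ⊗ R → B ⊗ R`.
Since a scheme is determined by its points in affine schemes, this determines the
`ℂ`-scheme up to unique isomorphism. -/
structure PunctualHilb (m : ℕ) where
  /-- the scheme -/
  X : Scheme.{0}
  /-- its structure morphism -/
  π : X ⟶ Spec (.of ℂ)
  /-- the identification of the functor of points -/
  family : ∀ (A : Type) [CommRing A] [Algebra ℂ A],
    Points π A ≃ {I : Ideal (A ⊗[ℂ] NodeRing) // IsPunctualFamily A m I}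
  natural : ∀ (A B : Type) [CommRing A] [Algebra ℂ A] [CommRing B] [Algebra ℂ B]
    (φ : A →ₐ[ℂ] B) (g : Points π A),
    (family B (g.map φ)).1 =
      (family A g).1.map (Algebra.TensorProduct.map φ (AlgHom.id ℂ NodeRing))

namespace PunctualHilb

variable {m : ℕ} (H : PunctualHilb m)

/-- The ideal of `R` that corresponds to a `ℂ`-valued point of the punctual Hilbert scheme
(its preimage under the isomorphism `R → ℂ ⊗ R`). -/
def idealOf (g : Points H.π ℂ) : Ideal NodeRing :=
  (H.family ℂ g).1.comap
    (Algebra.TensorProduct.includeRight : NodeRing →ₐ[ℂ] ℂ ⊗[ℂ] NodeRing)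

/-- The point of the underlying space of the scheme given by a `ℂ`-valued point. -/
def pt (g : Points H.π ℂ) : H.X := g.1 (IsLocalRing.closedPoint ℂ)

/-- The closure `C^m_i` of the set of ideals `I^m_i(a)`, `a ≠ 0`. -/
def curveC (i : ℕ) : Set H.X :=
  closure {z | ∃ g : Points H.π ℂ, H.pt g = z ∧ ∃ a : ℂ, a ≠ 0 ∧ H.idealOf g = idealI m i a}

/-- The set with the one element `Q^m_i`. -/
def pointQ (i : ℕ) : Set H.X :=
  {z | ∃ g : Points H.π ℂ, H.pt g = z ∧ H.idealOf g = idealQ m i}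

/-- `lim_{a → 0} F(a) = J` in the punctual Hilbert scheme: there is a morphism from the affine
line that takes each `a ≠ 0` to `F(a)`, and `0` to `J`. -/
def HasLimitAtZero (F : ℂ → Ideal NodeRing) (J : Ideal NodeRing) : Prop :=
  ∃ h : Points H.π (Polynomial ℂ),
    (∀ a : ℂ, a ≠ 0 → H.idealOf (h.map (Polynomial.aeval a)) = F a) ∧
    H.idealOf (h.map (Polynomial.aeval (0 : ℂ))) = J

/-- `lim_{a → ∞} F(a) = J`, i.e. `lim_{a → 0} F(1/a) = J`. -/
def HasLimitAtInfinity (F : ℂ → Ideal NodeRing) (J : Ideal NodeRing) : Prop :=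
  H.HasLimitAtZero (fun a => F a⁻¹) J

end PunctualHilb

/-! ### Projective line, nodes and smooth points -/

attribute [local instance] MvPolynomial.gradedAlgebra

/-- The projective line over `ℂ`, as `Proj ℂ[u, v]`. -/
def projLine : Scheme.{0} := Proj (MvPolynomial.homogeneousSubmodule (Fin 2) ℂ)

/-- The structure morphism of the projective line. -/
def projLineHom : projLine ⟶ Spec (.of ℂ) :=
  Proj.toSpecZero (MvPolynomial.homogeneousSubmodule (Fin 2) ℂ) ≫
    Spec.map (CommRingCat.ofHom
      (algebraMap ℂ (MvPolynomial.homogeneousSubmodule (Fin 2) ℂ 0)))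

/-- `Z` is the image of a closed embedding over `ℂ` of the projective line, i.e. the closed set `Z`
with its reduced structure is isomorphic to the projective line. -/
def IsProjLineIn {X : Scheme.{0}} (π : X ⟶ Spec (.of ℂ)) (Z : Set X) : Prop :=
  ∃ j : projLine ⟶ X, IsClosedImmersion j ∧ j ≫ π = projLineHom ∧ Set.range j = Z

/-- The scalars in the local ring of a `ℂ`-scheme at a point. -/
def stalkScalars {X : Scheme.{0}} (π : X ⟶ Spec (.of ℂ)) (z : X) : ℂ →+* X.presheaf.stalk z :=
  ((Scheme.ΓSpecIso (.of ℂ)).inv ≫ π.appTop ≫ X.presheaf.germ ⊤ z trivial).hom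

/-- The point `z` of a `ℂ`-scheme is a node (1-dimensional ordinary double point): the completed
local ring is isomorphic to `ℂ[[u, v]] / (uv)` as a `ℂ`-algebra. -/
def IsNodeAt {X : Scheme.{0}} (π : X ⟶ Spec (.of ℂ)) (z : X) : Prop :=
  ∃ e : AdicCompletion (IsLocalRing.maximalIdeal (X.presheaf.stalk z)) (X.presheaf.stalk z) ≃+*
      (MvPowerSeries (Fin 2) ℂ ⧸
        Ideal.span {(MvPowerSeries.X 0 * MvPowerSeries.X 1 : MvPowerSeries (Fin 2) ℂ)}),
    ∀ c : ℂ, e (algebraMap (X.presheaf.stalk z) _ (stalkScalars π z c)) = algebraMap ℂ _ c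

/-- The `ℂ`-scheme is a smooth curve near the point `z`. -/
def IsSmoothCurveAt {X : Scheme.{0}} (π : X ⟶ Spec (.of ℂ)) (z : X) : Prop :=
  ∃ U : X.Opens, z ∈ U ∧ SmoothOfRelativeDimension 1 (U.ι ≫ π)

end NodeHilb

end

/-! Because `xy = 0`, a function on the node is governed by its Taylor coefficients along the two
branches, which share only the constant term. Consider a punctual family and a point of its base.
The fibre of the quotient there has a basis `1, x, …, x^p, y, …, y^q` with `p + q + 1 = m`
(`exists_basis_branchMonomials`), and a determinant shows that these monomials remain a basis near
the point (`HasPunctualBasis.exists_chart`). The condition on characteristic polynomials then forces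
`y^(q+1) = -c x^p` and `x^(p+1) = -d y^q` with `dc = 0`, where `d = 0` if `q = 0` and `c = 0` if `p
= 0` (`exists_chart_equations`). Conversely, such `d, c` define an ideal cut out by linear equations
in Taylor coefficients (`IsChart.mem_iff`), so the quotient is free on the same monomials. Its
characteristic polynomials are `T^m`, because this holds over the reduced universal base `ℂ[d,
c]/(dc)` (`charpoly_chartBasis`).

The charts are glued by homogeneous coordinates `z_1, …, z_m` with `z_j z_k = 0` for `|j - k| ≥ 2`;
the ideal of `z` is generated by the `z_k y^k + z_(k+1) x^(m-k)`. Where some `z_i = 1`, this is a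
chart ideal with `q = i - 1`, `d = z_(i-1)`, `c = z_(i+1)`. Equality of ideals and equality of
points of `Proj` are both proportionality of coordinates (`IsCoordinate.eq_iff`). Hence ideals and
points determine each other locally, both glue, and the `Proj` of the coordinate ring represents the
functor (`punctualHilb`).

The rest is read off from coordinates. The ideal `Q_i` has only `z_i` nonzero, and `I_i(a)` has `z_i
= 1`, `z_(i+1) = a`. The curve `C_i` is the locus where all coordinates other than `z_i, z_(i+1)`
vanish, a line embedded by a surjection of graded rings. The charts are a node in the middle and
affine lines at the two ends. The completed local ring of the node is the ring of pairs of power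
series with equal constant terms (`exists_completion_equiv`). Containments between consecutive
colengths become equations in the coordinates (`IsChain.chainIdeal_succ_le_iff`). -/

noncomputable section

namespace NodeHilb

/-! ### The universal property of the coordinate ring of the node -/

section NodeCoordLift

variable {D : Type*} [CommRing D] [Algebra ℂ D]

/-- The homomorphism `ℂ[x, y] / (xy) → D` given by two elements with product zero. -/
def coordLift (u v : D) (h : u * v = 0) : NodeCoord →ₐ[ℂ] D :=
  Ideal.Quotient.liftₐ _ (MvPolynomial.aeval ![u, v]) (by
    intro a ha
    have hle : Ideal.span {(MvPolynomial.X 0 * MvPolynomial.X 1 : MvPolynomial (Fin 2) ℂ)} ≤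
        RingHom.ker (MvPolynomial.aeval (R := ℂ) ![u, v]) := by
      rw [Ideal.span_singleton_le_iff_mem, RingHom.mem_ker]
      simp [h]
    exact hle ha)

@[simp] theorem coordLift_coordX (u v : D) (h : u * v = 0) : coordLift u v h coordX = u := by
  change MvPolynomial.aeval ![u, v] (MvPolynomial.X 0) = u
  simp

@[simp] theorem coordLift_coordY (u v : D) (h : u * v = 0) : coordLift u v h coordY = v := by
  change MvPolynomial.aeval ![u, v] (MvPolynomial.X 1) = v
  simp

theorem coord_algHom_ext {f g : NodeCoord →ₐ[ℂ] D} (hx : f coordX = g coordX)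
    (hy : f coordY = g coordY) : f = g := by
  apply Ideal.Quotient.algHom_ext
  apply MvPolynomial.algHom_ext
  intro i
  fin_cases i
  · exact hx
  · exact hy

end NodeCoordLift

theorem coordX_mul_coordY : coordX * coordY = 0 := by
  rw [coordX, coordY, ← map_mul, Ideal.Quotient.eq_zero_iff_mem]
  exact Ideal.subset_span rfl

theorem nx_mul_ny : nx * ny = 0 := by
  rw [nx, ny, ← map_mul, coordX_mul_coordY, map_zero]

/-- Mixed monomials vanish because `xy = 0`, so the pure powers of `x` and of `y` span the ring. -/
theorem coord_induction {motive : NodeCoord → Prop} (add : ∀ a b, motive a → motive b →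
    motive (a + b)) (hX : ∀ (c : ℂ) n, motive (algebraMap ℂ _ c * coordX ^ n))
    (hY : ∀ (c : ℂ) n, motive (algebraMap ℂ _ c * coordY ^ n)) (a : NodeCoord) : motive a := by
  obtain ⟨p, rfl⟩ := Ideal.Quotient.mk_surjective a
  induction p using MvPolynomial.induction_on' with
  | monomial u c =>
    have : Ideal.Quotient.mk (Ideal.span {(MvPolynomial.X 0 * MvPolynomial.X 1 :
        MvPolynomial (Fin 2) ℂ)}) (MvPolynomial.monomial u c) =
        algebraMap ℂ NodeCoord c * coordX ^ (u 0) * coordY ^ (u 1) := by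
      rw [MvPolynomial.monomial_eq, Finsupp.prod_fintype _ _ (by simp)]
      simp only [Fin.prod_univ_two, map_mul, map_pow, mul_assoc]
      rfl
    rw [this]
    rcases Nat.eq_zero_or_pos (u 1) with h1 | h1
    · rw [h1, pow_zero, mul_one]; exact hX _ _
    rcases Nat.eq_zero_or_pos (u 0) with h0 | h0
    · rw [h0, pow_zero, mul_one]; exact hY _ _
    have h3 : coordX ^ (u 0) * coordY ^ (u 1) = 0 := by
      obtain ⟨a, ha⟩ := Nat.exists_eq_succ_of_ne_zero h0.ne'
      obtain ⟨b, hb⟩ := Nat.exists_eq_succ_of_ne_zero h1.ne'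
      rw [ha, hb, pow_succ, pow_succ, mul_mul_mul_comm, coordX_mul_coordY, mul_zero]
    rw [mul_assoc, h3, mul_zero]
    -- A mixed monomial is zero, which is an instance of `hX` with scalar `0`.
    simpa using hX 0 0
  | add p q hp hq => rw [map_add]; exact add _ _ hp hq

theorem evalOrigin_algebraMap (c : ℂ) : evalOrigin (algebraMap ℂ NodeCoord c) = c :=
  MvPolynomial.constantCoeff_C _ c

theorem evalOrigin_coordX : evalOrigin coordX = 0 := MvPolynomial.constantCoeff_X ℂ 0

theorem evalOrigin_coordY : evalOrigin coordY = 0 := MvPolynomial.constantCoeff_X ℂ 1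

theorem mem_originIdeal {a : NodeCoord} : a ∈ originIdeal ↔ evalOrigin a = 0 := by
  rw [originIdeal_eq_ker, RingHom.mem_ker]

/-! ### Expansions along the two branches -/

section Expansion

open PowerSeries

/-- Taking constant terms after substituting series without constant term is evaluation at the
origin. Hence denominators become units and the expansions extend to the localization. -/
theorem constantCoeff_coordLift (u v : ℂ⟦X⟧) (h : u * v = 0) (hu : constantCoeff u = 0)
    (hv : constantCoeff v = 0) (a : NodeCoord) :
    constantCoeff (coordLift u v h a) = evalOrigin a := by
  induction a using coord_induction with
  | add a b ha hb => rw [map_add, map_add, map_add, ha, hb]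
  | hX c n =>
    rw [map_mul, map_mul, map_mul, map_pow, map_pow, map_pow, coordLift_coordX, hu,
      evalOrigin_algebraMap, evalOrigin_coordX, AlgHom.commutes]
    rfl
  | hY c n =>
    rw [map_mul, map_mul, map_mul, map_pow, map_pow, map_pow, coordLift_coordY, hv,
      evalOrigin_algebraMap, evalOrigin_coordY, AlgHom.commutes]
    rfl

theorem isUnit_coordLift (u v : ℂ⟦X⟧) (h : u * v = 0) (hu : constantCoeff u = 0)
    (hv : constantCoeff v = 0) (s : originIdeal.primeCompl) : IsUnit (coordLift u v h s) := by
  rw [isUnit_iff_constantCoeff, constantCoeff_coordLift u v h hu hv, isUnit_iff_ne_zero]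
  exact fun h0 => s.2 (mem_originIdeal.mpr h0)

/-- The expansion of a function on the node along the branch `y = 0`. -/
def expandX : NodeRing →ₐ[ℂ] ℂ⟦X⟧ :=
  IsLocalization.liftAlgHom (M := originIdeal.primeCompl) (f := coordLift X 0 (mul_zero _))
    (isUnit_coordLift _ _ _ (by simp) (by simp))

/-- The expansion of a function on the node along the branch `x = 0`. -/
def expandY : NodeRing →ₐ[ℂ] ℂ⟦X⟧ :=
  IsLocalization.liftAlgHom (M := originIdeal.primeCompl) (f := coordLift 0 X (zero_mul _))
    (isUnit_coordLift _ _ _ (by simp) (by simp))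

theorem expandX_algebraMap (a : NodeCoord) :
    expandX (algebraMap _ _ a) = coordLift X 0 (mul_zero _) a := by
  simp [expandX]

theorem expandY_algebraMap (a : NodeCoord) :
    expandY (algebraMap _ _ a) = coordLift 0 X (zero_mul _) a := by
  simp [expandY]

@[simp] theorem expandX_nx : expandX nx = X := by simp [nx, expandX_algebraMap]
@[simp] theorem expandX_ny : expandX ny = 0 := by simp [ny, expandX_algebraMap]
@[simp] theorem expandY_nx : expandY nx = 0 := by simp [nx, expandY_algebraMap]
@[simp] theorem expandY_ny : expandY ny = X := by simp [ny, expandY_algebraMap]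

/-- The coefficient of `x ^ j` of a function on the node. -/
def coeffX (j : ℕ) : NodeRing →ₗ[ℂ] ℂ := (PowerSeries.coeff j).comp expandX.toLinearMap

/-- The coefficient of `y ^ k` of a function on the node. -/
def coeffY (k : ℕ) : NodeRing →ₗ[ℂ] ℂ := (PowerSeries.coeff k).comp expandY.toLinearMap

theorem coeffX_apply (j : ℕ) (r : NodeRing) : coeffX j r = PowerSeries.coeff j (expandX r) := rfl
theorem coeffY_apply (j : ℕ) (r : NodeRing) : coeffY j r = PowerSeries.coeff j (expandY r) := rfl

theorem coeffX_mul_nx_pow (j a : ℕ) (r : NodeRing) :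
    coeffX j (r * nx ^ a) = if a ≤ j then coeffX (j - a) r else 0 := by
  simp only [coeffX_apply, map_mul, map_pow, expandX_nx, coeff_mul_X_pow']

theorem coeffY_mul_ny_pow (j a : ℕ) (r : NodeRing) :
    coeffY j (r * ny ^ a) = if a ≤ j then coeffY (j - a) r else 0 := by
  simp only [coeffY_apply, map_mul, map_pow, expandY_ny, coeff_mul_X_pow']

theorem coeffX_mul_ny_pow (j a : ℕ) (r : NodeRing) :
    coeffX j (r * ny ^ a) = if a = 0 then coeffX j r else 0 := by
  split_ifs with h
  · simp [h]
  · simp [coeffX_apply, h]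

theorem coeffY_mul_nx_pow (j a : ℕ) (r : NodeRing) :
    coeffY j (r * nx ^ a) = if a = 0 then coeffY j r else 0 := by
  split_ifs with h
  · simp [h]
  · simp [coeffY_apply, h]

/-- The two branches meet at the origin: after clearing a denominator, both constant terms are
values at the origin. -/
theorem constantCoeff_expandX_eq (r : NodeRing) :
    constantCoeff (expandX r) = constantCoeff (expandY r) := by
  obtain ⟨⟨a, s⟩, hr⟩ := IsLocalization.surj originIdeal.primeCompl r
  have hx := congrArg (fun t => constantCoeff (expandX t)) hr
  have hy := congrArg (fun t => constantCoeff (expandY t)) hr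
  simp only [map_mul, expandX_algebraMap, expandY_algebraMap] at hx hy
  rw [constantCoeff_coordLift _ _ _ (by simp) (by simp),
    constantCoeff_coordLift _ _ _ (by simp) (by simp)] at hx hy
  have hs : evalOrigin s ≠ 0 := fun h0 => s.2 (mem_originIdeal.mpr h0)
  exact mul_right_cancel₀ hs (hx.trans hy.symm)

theorem coeffX_zero_eq (r : NodeRing) : coeffX 0 r = coeffY 0 r := by
  rw [coeffX_apply, coeffY_apply, coeff_zero_eq_constantCoeff_apply,
    coeff_zero_eq_constantCoeff_apply, constantCoeff_expandX_eq]

end Expansion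

/-! ### Taylor expansion modulo high powers -/

theorem nx_pow_mul_ny_pow {a b : ℕ} (ha : a ≠ 0) (hb : b ≠ 0) : nx ^ a * ny ^ b = 0 := by
  obtain ⟨a, rfl⟩ := Nat.exists_eq_succ_of_ne_zero ha
  obtain ⟨b, rfl⟩ := Nat.exists_eq_succ_of_ne_zero hb
  rw [pow_succ, pow_succ, mul_mul_mul_comm, nx_mul_ny, mul_zero]

/-- Modulo `(x^M, y^N)` the element `s` is a nonzero constant plus a nilpotent, hence invertible. So
fractions are congruent to polynomials. -/
theorem exists_coord_mul_sub_one_mem (M N : ℕ) (s : originIdeal.primeCompl) :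
    ∃ t : NodeCoord, s * t - 1 ∈ Ideal.span {coordX ^ M, coordY ^ N} := by
  set J : Ideal NodeCoord := Ideal.span {coordX ^ M, coordY ^ N}
  have hx : coordX ∈ (Ideal.radical J) := ⟨M, Ideal.subset_span (Or.inl rfl)⟩
  have hy : coordY ∈ (Ideal.radical J) := ⟨N, Ideal.subset_span (Or.inr rfl)⟩
  have hle : originIdeal ≤ J.radical := by
    rw [originIdeal, Ideal.span_le]
    rintro z (rfl | rfl)
    exacts [hx, hy]
  set c := evalOrigin s
  have hc : c ≠ 0 := fun h0 => s.2 (mem_originIdeal.mpr h0)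
  have hn : (s : NodeCoord) - algebraMap ℂ _ c ∈ originIdeal := by
    rw [mem_originIdeal, map_sub, evalOrigin_algebraMap, sub_self]
  obtain ⟨n, hn⟩ := hle hn
  have hnil : IsNilpotent (Ideal.Quotient.mk J ((s : NodeCoord) - algebraMap ℂ _ c)) :=
    ⟨n, by rw [← map_pow]; exact Ideal.Quotient.eq_zero_iff_mem.mpr hn⟩
  have hu : IsUnit (Ideal.Quotient.mk J (algebraMap ℂ _ c)) :=
    ((isUnit_iff_ne_zero.mpr hc).map (algebraMap ℂ NodeCoord)).map (Ideal.Quotient.mk J)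
  have hs : IsUnit (Ideal.Quotient.mk J (s : NodeCoord)) := by
    have := hnil.isUnit_add_left_of_commute hu (Commute.all (S := NodeCoord ⧸ J) _ _)
    rwa [← map_add, add_sub_cancel] at this
  obtain ⟨t, ht⟩ := hs.exists_right_inv
  obtain ⟨t, rfl⟩ := Ideal.Quotient.mk_surjective t
  refine ⟨t, ?_⟩
  rw [← Ideal.Quotient.eq_zero_iff_mem, map_sub, map_mul, ht, map_one, sub_self]

theorem exists_coord_sub_mem (M N : ℕ) (r : NodeRing) :
    ∃ a : NodeCoord, r - algebraMap _ _ a ∈ Ideal.span {nx ^ M, ny ^ N} := by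
  obtain ⟨⟨a, s⟩, hr⟩ := IsLocalization.surj originIdeal.primeCompl r
  obtain ⟨t, ht⟩ := exists_coord_mul_sub_one_mem M N s
  refine ⟨a * t, ?_⟩
  have h1 := Ideal.mem_map_of_mem (algebraMap NodeCoord NodeRing) ht
  rw [Ideal.map_span, Set.image_pair, map_pow, map_pow] at h1
  have : r - algebraMap _ _ (a * t) = (-r) * algebraMap _ NodeRing (s * t - 1) := by
    rw [map_mul, ← hr, map_sub, map_mul, map_one]; ring
  rw [this]
  exact Ideal.mul_mem_left _ _ h1

/-- The truncated Taylor expansion. -/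
def taylor (M N : ℕ) (r : NodeRing) : NodeRing :=
  ∑ j ∈ Finset.range M, coeffX j r • nx ^ j +
    ∑ k ∈ Finset.range N, coeffY (k + 1) r • ny ^ (k + 1)

theorem taylor_add (M N : ℕ) (r s : NodeRing) :
    taylor M N (r + s) = taylor M N r + taylor M N s := by
  simp only [taylor, map_add, add_smul, Finset.sum_add_distrib]
  abel

theorem taylor_smul (M N : ℕ) (c : ℂ) (r : NodeRing) : taylor M N (c • r) = c • taylor M N r := by
  simp only [taylor, map_smul, smul_assoc, Finset.smul_sum, smul_add]

/-- The constant term is counted in the `x`-sum only, so `taylor (M + 1) N` involves `1, …, x^M` and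
`y, …, y^N`. This is why the second exponent of the ideal is `N + 1`. -/
theorem taylor_eq_zero_of_mem {M N : ℕ} {r : NodeRing}
    (hr : r ∈ Ideal.span {nx ^ (M + 1), ny ^ (N + 1)}) : taylor (M + 1) N r = 0 := by
  obtain ⟨a, b, rfl⟩ := Ideal.mem_span_pair.mp hr
  rw [taylor, Finset.sum_eq_zero, Finset.sum_eq_zero, add_zero]
  · intro k hk
    rw [Finset.mem_range] at hk
    rw [map_add, coeffY_mul_nx_pow, coeffY_mul_ny_pow, if_neg (by omega), if_neg (by omega),
      add_zero, zero_smul]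
  · intro k hk
    rw [Finset.mem_range] at hk
    rw [map_add, coeffX_mul_nx_pow, coeffX_mul_ny_pow, if_neg (by omega), if_neg (by omega),
      add_zero, zero_smul]

theorem coeffX_one (j : ℕ) : coeffX j 1 = if j = 0 then 1 else 0 := by
  simp [coeffX_apply, PowerSeries.coeff_one]

theorem coeffY_one (j : ℕ) : coeffY j 1 = if j = 0 then 1 else 0 := by
  simp [coeffY_apply, PowerSeries.coeff_one]

theorem coeffX_nx_pow (j a : ℕ) : coeffX j (nx ^ a) = if j = a then 1 else 0 := by
  simp [coeffX_apply, PowerSeries.coeff_X_pow]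

theorem coeffY_ny_pow (j a : ℕ) : coeffY j (ny ^ a) = if j = a then 1 else 0 := by
  simp [coeffY_apply, PowerSeries.coeff_X_pow]

theorem coeffX_ny_pow (j a : ℕ) : coeffX j (ny ^ a) = if j = 0 ∧ a = 0 then 1 else 0 := by
  rcases eq_or_ne a 0 with rfl | h
  · simp [coeffX_one]
  · simp [coeffX_apply, h]

theorem coeffY_nx_pow (j a : ℕ) : coeffY j (nx ^ a) = if j = 0 ∧ a = 0 then 1 else 0 := by
  rcases eq_or_ne a 0 with rfl | h
  · simp [coeffY_one]
  · simp [coeffY_apply, h]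

/-- The truncation depends only on the class of `r` modulo the ideal, so `r` may be replaced by a
polynomial; by linearity it is enough to treat pure powers. -/
theorem sub_taylor_mem (M N : ℕ) (r : NodeRing) :
    r - taylor (M + 1) N r ∈ Ideal.span {nx ^ (M + 1), ny ^ (N + 1)} := by
  set J : Ideal NodeRing := Ideal.span {nx ^ (M + 1), ny ^ (N + 1)}
  obtain ⟨a, ha⟩ := exists_coord_sub_mem (M + 1) (N + 1) r
  have h1 : taylor (M + 1) N r = taylor (M + 1) N (algebraMap _ _ a) := by
    have := taylor_eq_zero_of_mem ha
    rw [← sub_add_cancel r (algebraMap _ _ a), taylor_add, this, zero_add]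
  have h2 : algebraMap _ NodeRing a - taylor (M + 1) N (algebraMap _ _ a) ∈ J := by
    clear h1 ha
    induction a using coord_induction with
    | add a b ha hb =>
      rw [map_add, taylor_add, add_sub_add_comm]
      exact add_mem ha hb
    | hX c n =>
      have : algebraMap NodeCoord NodeRing (algebraMap ℂ NodeCoord c * coordX ^ n) =
        c • nx ^ n := by
        rw [map_mul, map_pow, Algebra.smul_def, ← IsScalarTower.algebraMap_apply]; rfl
      rw [this, taylor_smul, ← smul_sub]
      refine Submodule.smul_of_tower_mem J c ?_
      by_cases hn : n < M + 1
      · have : taylor (M + 1) N (nx ^ n) = nx ^ n := by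
          rw [taylor, Finset.sum_eq_single n, Finset.sum_eq_zero]
          · simp [coeffX_nx_pow]
          · intro k _; simp [coeffY_nx_pow]
          · intro k _ hk; simp [coeffX_nx_pow, hk]
          · intro h; exact absurd (Finset.mem_range.mpr hn) h
        rw [this, sub_self]; exact zero_mem _
      · have h1 : nx ^ n ∈ J :=
          Ideal.mem_of_dvd J (pow_dvd_pow nx (not_lt.mp hn)) (Ideal.subset_span (Or.inl rfl))
        rw [taylor_eq_zero_of_mem h1, sub_zero]; exact h1
    | hY c n =>
      have : algebraMap NodeCoord NodeRing (algebraMap ℂ NodeCoord c * coordY ^ n) =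
        c • ny ^ n := by
        rw [map_mul, map_pow, Algebra.smul_def, ← IsScalarTower.algebraMap_apply]; rfl
      rw [this, taylor_smul, ← smul_sub]
      refine Submodule.smul_of_tower_mem J c ?_
      by_cases hn : n < N + 1
      · have : taylor (M + 1) N (ny ^ n) = ny ^ n := by
          -- The power `y^0 = 1` is recorded in the `x`-sum.
          rcases Nat.eq_zero_or_pos n with rfl | hpos
          · rw [taylor, Finset.sum_eq_single 0, Finset.sum_eq_zero]
            · simp [coeffX_one]
            · intro k _; simp [coeffY_one]
            · intro k _ hk; simp [coeffX_one, hk]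
            · intro h; exact absurd (Finset.mem_range.mpr (by omega)) h
          · obtain ⟨n, rfl⟩ := Nat.exists_eq_succ_of_ne_zero hpos.ne'
            rw [taylor, Finset.sum_eq_zero, Finset.sum_eq_single n]
            · simp [coeffY_ny_pow]
            · intro k _ hk; simp [coeffY_ny_pow, hk]
            · intro h; exact absurd (Finset.mem_range.mpr (by omega)) h
            · intro k _; simp [coeffX_ny_pow]
        rw [this, sub_self]; exact zero_mem _
      · have h1 : ny ^ n ∈ J :=
          Ideal.mem_of_dvd J (pow_dvd_pow ny (not_lt.mp hn)) (Ideal.subset_span (Or.inr rfl))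
        rw [taylor_eq_zero_of_mem h1, sub_zero]; exact h1
  rw [h1, ← sub_add_sub_cancel _ (algebraMap _ _ a)]
  exact add_mem ha h2

end NodeHilb

end

noncomputable section

namespace NodeHilb

/-! ### Families of coefficients -/

section Family

variable (A : Type) [CommRing A] [Algebra ℂ A]

/-- The element `x` of `A ⊗ R`. -/
def tx : A ⊗[ℂ] NodeRing := 1 ⊗ₜ nx

/-- The element `y` of `A ⊗ R`. -/
def ty : A ⊗[ℂ] NodeRing := 1 ⊗ₜ ny

theorem tx_pow (n : ℕ) : tx A ^ n = 1 ⊗ₜ (nx ^ n) := by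
  rw [tx, Algebra.TensorProduct.tmul_pow, one_pow]

theorem ty_pow (n : ℕ) : ty A ^ n = 1 ⊗ₜ (ny ^ n) := by
  rw [ty, Algebra.TensorProduct.tmul_pow, one_pow]

theorem tx_mul_ty : tx A * ty A = 0 := by
  rw [tx, ty, Algebra.TensorProduct.tmul_mul_tmul, nx_mul_ny, TensorProduct.tmul_zero]

/-- The `A`-linear extension of a linear form on `R` to `A ⊗ R`. -/
def extendForm (f : NodeRing →ₗ[ℂ] ℂ) : A ⊗[ℂ] NodeRing →ₗ[A] A :=
  (TensorProduct.AlgebraTensorModule.rid ℂ A A).toLinearMap ∘ₗ f.baseChange A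

theorem extendForm_tmul (f : NodeRing →ₗ[ℂ] ℂ) (a : A) (r : NodeRing) :
    extendForm A f (a ⊗ₜ r) = f r • a := by
  simp [extendForm]

/-- The coefficient of `x ^ j`. -/
def famX (j : ℕ) : A ⊗[ℂ] NodeRing →ₗ[A] A := extendForm A (coeffX j)

/-- The coefficient of `y ^ k`. -/
def famY (k : ℕ) : A ⊗[ℂ] NodeRing →ₗ[A] A := extendForm A (coeffY k)

variable {A}

theorem famX_mul_tx_pow (j a : ℕ) (t : A ⊗[ℂ] NodeRing) :
    famX A j (t * tx A ^ a) = if a ≤ j then famX A (j - a) t else 0 := by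
  induction t with
  | zero => simp
  | add t u ht hu => rw [add_mul, map_add, ht, hu]; split_ifs <;> simp
  | tmul b r =>
    rw [tx_pow, Algebra.TensorProduct.tmul_mul_tmul, mul_one, famX, famX, extendForm_tmul,
      extendForm_tmul, coeffX_mul_nx_pow]
    split_ifs <;> simp

theorem famY_mul_ty_pow (j a : ℕ) (t : A ⊗[ℂ] NodeRing) :
    famY A j (t * ty A ^ a) = if a ≤ j then famY A (j - a) t else 0 := by
  induction t with
  | zero => simp
  | add t u ht hu => rw [add_mul, map_add, ht, hu]; split_ifs <;> simp
  | tmul b r =>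
    rw [ty_pow, Algebra.TensorProduct.tmul_mul_tmul, mul_one, famY, famY, extendForm_tmul,
      extendForm_tmul, coeffY_mul_ny_pow]
    split_ifs <;> simp

theorem famX_mul_ty_pow (j a : ℕ) (t : A ⊗[ℂ] NodeRing) :
    famX A j (t * ty A ^ a) = if a = 0 then famX A j t else 0 := by
  induction t with
  | zero => simp
  | add t u ht hu => rw [add_mul, map_add, ht, hu]; split_ifs <;> simp
  | tmul b r =>
    rw [ty_pow, Algebra.TensorProduct.tmul_mul_tmul, mul_one, famX, extendForm_tmul,
      extendForm_tmul, coeffX_mul_ny_pow]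
    split_ifs <;> simp

theorem famY_mul_tx_pow (j a : ℕ) (t : A ⊗[ℂ] NodeRing) :
    famY A j (t * tx A ^ a) = if a = 0 then famY A j t else 0 := by
  induction t with
  | zero => simp
  | add t u ht hu => rw [add_mul, map_add, ht, hu]; split_ifs <;> simp
  | tmul b r =>
    rw [tx_pow, Algebra.TensorProduct.tmul_mul_tmul, mul_one, famY, extendForm_tmul,
      extendForm_tmul, coeffY_mul_nx_pow]
    split_ifs <;> simp

theorem famX_zero_eq (t : A ⊗[ℂ] NodeRing) : famX A 0 t = famY A 0 t := by
  induction t with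
  | zero => simp
  | add t u ht hu => rw [map_add, map_add, ht, hu]
  | tmul b r => rw [famX, famY, extendForm_tmul, extendForm_tmul, coeffX_zero_eq]

theorem famX_tx_pow (j a : ℕ) : famX A j (tx A ^ a) = if j = a then 1 else 0 := by
  rw [tx_pow, famX, extendForm_tmul, coeffX_nx_pow]; split_ifs <;> simp

theorem famY_ty_pow (j a : ℕ) : famY A j (ty A ^ a) = if j = a then 1 else 0 := by
  rw [ty_pow, famY, extendForm_tmul, coeffY_ny_pow]; split_ifs <;> simp

theorem famX_ty_pow (j a : ℕ) : famX A j (ty A ^ a) = if j = 0 ∧ a = 0 then 1 else 0 := by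
  rw [ty_pow, famX, extendForm_tmul, coeffX_ny_pow]; split_ifs <;> simp

theorem famY_tx_pow (j a : ℕ) : famY A j (tx A ^ a) = if j = 0 ∧ a = 0 then 1 else 0 := by
  rw [tx_pow, famY, extendForm_tmul, coeffY_nx_pow]; split_ifs <;> simp

/-- For a pure tensor this is the Taylor remainder over `ℂ` multiplied by the scalar from `A`; both
sides are additive. -/
theorem sub_famTaylor_mem (M N : ℕ) (t : A ⊗[ℂ] NodeRing) :
    t - (∑ j ∈ Finset.range (M + 1), famX A j t • tx A ^ j +
      ∑ k ∈ Finset.range N, famY A (k + 1) t • ty A ^ (k + 1)) ∈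
      Ideal.span {tx A ^ (M + 1), ty A ^ (N + 1)} := by
  induction t with
  | zero => simp
  | add t u ht hu =>
    convert! add_mem ht hu using 1
    simp only [map_add, add_smul, Finset.sum_add_distrib]
    abel
  | tmul b r =>
    have h := Ideal.mem_map_of_mem
      (Algebra.TensorProduct.includeRight : NodeRing →ₐ[ℂ] A ⊗[ℂ] NodeRing) (sub_taylor_mem M N r)
    rw [Ideal.map_span, Set.image_pair] at h
    have h2 := Ideal.mul_mem_left _ (b ⊗ₜ[ℂ] (1 : NodeRing)) h
    rw [tx_pow, ty_pow]
    convert! h2 using 1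
    simp only [taylor, map_sub, map_add, map_sum, map_smul, mul_sub, mul_add, Finset.mul_sum,
      tx_pow, ty_pow, famX, famY, extendForm_tmul, Algebra.TensorProduct.includeRight_apply,
      Algebra.TensorProduct.tmul_mul_tmul, one_mul, mul_one, TensorProduct.smul_tmul',
      smul_eq_mul, mul_smul_comm]

/-! ### The ideals of a chart -/

/-- The condition on the coordinates of a point of the chart around `(x ^ (p+1), y ^ (q+1))`. -/
structure IsChart (p q : ℕ) (d c : A) : Prop where
  mul_eq_zero : d * c = 0
  left : q = 0 → d = 0
  right : p = 0 → c = 0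

/-- The ideal `(y ^ (q+1) + c x ^ p, x ^ (p+1) + d y ^ q)`. -/
def chartIdeal (p q : ℕ) (d c : A) : Ideal (A ⊗[ℂ] NodeRing) :=
  Ideal.span {ty A ^ (q + 1) + c • tx A ^ p, tx A ^ (p + 1) + d • ty A ^ q}

variable {p q : ℕ} {d c : A}

theorem tx_pow_mul_ty_pow {a b : ℕ} (ha : a ≠ 0) (hb : b ≠ 0) : tx A ^ a * ty A ^ b = 0 := by
  rw [tx_pow, ty_pow, Algebra.TensorProduct.tmul_mul_tmul, nx_pow_mul_ny_pow ha hb,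
    TensorProduct.tmul_zero]

/-- Multiply the second generator by `x`: the term `d x y^q` vanishes because `xy = 0` if `q > 0`,
and because `d = 0` if `q = 0`. -/
theorem IsChart.tx_pow_mem (h : IsChart p q d c) : tx A ^ (p + 2) ∈ chartIdeal p q d c := by
  have h2 : tx A ^ (p + 1) + d • ty A ^ q ∈ chartIdeal p q d c :=
    Ideal.subset_span (Or.inr rfl)
  have := Ideal.mul_mem_left _ (tx A) h2
  rcases eq_or_ne q 0 with hq | hq
  · obtain rfl := h.left hq
    rwa [zero_smul, add_zero, ← pow_succ'] at this
  · have h0 := tx_pow_mul_ty_pow (A := A) one_ne_zero hq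
    rw [pow_one] at h0
    rwa [mul_add, mul_smul_comm, h0, smul_zero, add_zero, ← pow_succ'] at this

theorem IsChart.ty_pow_mem (h : IsChart p q d c) : ty A ^ (q + 2) ∈ chartIdeal p q d c := by
  have h2 : ty A ^ (q + 1) + c • tx A ^ p ∈ chartIdeal p q d c :=
    Ideal.subset_span (Or.inl rfl)
  have := Ideal.mul_mem_right (ty A) _ h2
  rcases eq_or_ne p 0 with hp | hp
  · obtain rfl := h.right hp
    rwa [zero_smul, add_zero, ← pow_succ] at this
  · have h0 := tx_pow_mul_ty_pow (A := A) hp one_ne_zero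
    rw [pow_one] at h0
    rwa [add_mul, smul_mul_assoc, h0, smul_zero, add_zero, ← pow_succ] at this

/-- The ideal contains `x^(p+2)` and `y^(q+2)`, so membership depends on finitely many Taylor
coefficients. In a combination of the generators `dc = 0` kills the cross terms; conversely, the
equations regroup the surviving Taylor terms into multiples of the two generators. -/
theorem IsChart.mem_iff (h : IsChart p q d c) (t : A ⊗[ℂ] NodeRing) :
    t ∈ chartIdeal p q d c ↔ (∀ j < p, famX A j t = 0) ∧ (∀ k < q, famY A k t = 0) ∧
      famX A p t = c * famY A (q + 1) t ∧ famY A q t = d * famX A (p + 1) t := by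
  have hdc := h.mul_eq_zero
  constructor
  · intro ht
    obtain ⟨a, b, rfl⟩ := Ideal.mem_span_pair.mp ht
    simp only [mul_add, mul_smul_comm, map_add, map_smul, famX_mul_tx_pow, famX_mul_ty_pow,
      famY_mul_tx_pow, famY_mul_ty_pow, smul_eq_mul]
    refine ⟨fun j hj => ?_, fun k hk => ?_, ?_, ?_⟩
    · rcases eq_or_ne q 0 with hq | hq
      · have hd := h.left hq
        simp [hd, show ¬ p ≤ j by omega, show ¬ p + 1 ≤ j by omega]
      · simp [hq, show ¬ p ≤ j by omega, show ¬ p + 1 ≤ j by omega]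
    · rcases eq_or_ne p 0 with hp | hp
      · have hc := h.right hp
        simp [hc, show ¬ q ≤ k by omega, show ¬ q + 1 ≤ k by omega]
      · simp [hp, show ¬ q ≤ k by omega, show ¬ q + 1 ≤ k by omega]
    · rcases eq_or_ne q 0 with hq | hq
      · have hd := h.left hq
        rcases eq_or_ne p 0 with hp | hp
        · have hc := h.right hp
          simp [hp, hc, hd]
        · simp [hd, hp, famX_zero_eq]
      · rcases eq_or_ne p 0 with hp | hp
        · have hc := h.right hp
          simp [hq, hc, hp]
        · simp only [Nat.add_eq_zero_iff, one_ne_zero, and_false, ↓reduceIte, le_refl,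
            tsub_self, zero_add, hq, hp, mul_zero, add_zero, Nat.le_succ,
            show ¬ p + 1 ≤ p by omega, famX_zero_eq]
          -- The only discrepancy between the two sides carries the factor `cd`.
          simp only [← mul_assoc, mul_comm c d, hdc, zero_mul, add_zero]
    · rcases eq_or_ne p 0 with hp | hp
      · have hc := h.right hp
        rcases eq_or_ne q 0 with hq | hq
        · have hd := h.left hq
          simp [hq, hc, hd]
        · simp [hc, hq, hp, famX_zero_eq]
      · rcases eq_or_ne q 0 with hq | hq
        · have hd := h.left hq
          simp [hp, hd, hq]
        · simp only [Nat.add_eq_zero_iff, one_ne_zero, and_false, ↓reduceIte, le_refl,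
            tsub_self, zero_add, hq, hp, mul_zero, add_zero, Nat.le_succ,
            show ¬ q + 1 ≤ q by omega, famX_zero_eq]
          simp only [← mul_assoc, hdc, zero_mul, zero_add]
  · rintro ⟨hX, hY, h1, h2⟩
    have hT := sub_famTaylor_mem (p + 1) (q + 1) t
    have hle : Ideal.span {tx A ^ (p + 1 + 1), ty A ^ (q + 1 + 1)} ≤ chartIdeal p q d c := by
      rw [Ideal.span_le]
      rintro z (rfl | rfl)
      exacts [h.tx_pow_mem, h.ty_pow_mem]
    refine (Submodule.sub_mem_iff_left _ ?_).mp (hle hT)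
    have hsX : ∑ j ∈ Finset.range (p + 1 + 1), famX A j t • tx A ^ j =
        famX A p t • tx A ^ p + famX A (p + 1) t • tx A ^ (p + 1) := by
      rw [Finset.sum_range_succ, Finset.sum_range_succ, Finset.sum_eq_zero, zero_add]
      intro j hj
      rw [hX j (Finset.mem_range.mp hj), zero_smul]
    -- For `q = 0` the term `y^q = 1` is absent from the `y`-sum, which starts at `y`; the
    -- correction subtracts it, and it vanishes since then `d = 0`.
    have hsY : ∑ k ∈ Finset.range (q + 1), famY A (k + 1) t • ty A ^ (k + 1) =
        famY A q t • ty A ^ q + famY A (q + 1) t • ty A ^ (q + 1) - 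
          (if q = 0 then famY A 0 t • 1 else 0) := by
      rw [Finset.sum_range_succ]
      rcases eq_or_ne q 0 with rfl | hq
      · simp
      · obtain ⟨q, rfl⟩ := Nat.exists_eq_succ_of_ne_zero hq
        rw [if_neg hq, sub_zero, Finset.sum_range_succ, Finset.sum_eq_zero, zero_add]
        intro k hk
        rw [hY (k + 1) (by have := Finset.mem_range.mp hk; omega), zero_smul]
    have hz : (if q = 0 then famY A 0 t • (1 : A ⊗[ℂ] NodeRing) else 0) = 0 := by
      split_ifs with hq
      · subst hq
        rw [h2, h.left rfl, zero_mul, zero_smul]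
      · rfl
    rw [hsX, hsY, hz, sub_zero, h1, h2]
    have e : (c * famY A (q + 1) t) • tx A ^ p + famX A (p + 1) t • tx A ^ (p + 1) +
        ((d * famX A (p + 1) t) • ty A ^ q + famY A (q + 1) t • ty A ^ (q + 1)) =
        famY A (q + 1) t • (ty A ^ (q + 1) + c • tx A ^ p) +
        famX A (p + 1) t • (tx A ^ (p + 1) + d • ty A ^ q) := by
      simp only [smul_add, smul_smul, mul_comm c, mul_comm d]
      abel
    rw [e]
    exact add_mem (Submodule.smul_of_tower_mem _ _ (Ideal.subset_span (Or.inl rfl)))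
      (Submodule.smul_of_tower_mem _ _ (Ideal.subset_span (Or.inr rfl)))

end Family

end NodeHilb

end

noncomputable section

namespace NodeHilb

/-! ### The quotient by the ideal of a chart is free -/

section Basis

variable {A : Type} [CommRing A] [Algebra ℂ A]

/-- The monomials `1, x, …, x ^ p, y, y ^ 2, …`. -/
def monomialSeq (p k : ℕ) : NodeRing := if k ≤ p then nx ^ k else ny ^ (k - p)

/-- The coordinate of index `k` modulo the ideal of a chart. -/
def chartCoordAt (p q : ℕ) (d c : A) (k : ℕ) : A ⊗[ℂ] NodeRing →ₗ[A] A :=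
  if k < p then famX A k else if k = p then famX A p - c • famY A (q + 1) else
    if k < p + q then famY A (k - p) else famY A q - d • famX A (p + 1)

/-- The coordinates modulo the ideal of a chart. -/
def chartCoord (m p q : ℕ) (d c : A) : A ⊗[ℂ] NodeRing →ₗ[A] (Fin m → A) :=
  LinearMap.pi fun k => chartCoordAt p q d c k

theorem chartCoord_apply (m p q : ℕ) (d c : A) (t : A ⊗[ℂ] NodeRing) (k : Fin m) :
    chartCoord m p q d c t k = chartCoordAt p q d c k t := rfl

theorem map_chartCoordAt {B : Type} [CommRing B] [Algebra ℂ B] (φ : A →ₐ[ℂ] B) (p q : ℕ) (d c : A)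
    (k : ℕ) (r : NodeRing) :
    φ (chartCoordAt p q d c k (1 ⊗ₜ r)) = chartCoordAt p q (φ d) (φ c) k (1 ⊗ₜ r) := by
  simp only [chartCoordAt]
  split_ifs <;> simp [famX, famY, extendForm_tmul]

variable {m p q : ℕ} {d c : A}

/-- The correction terms of the coordinates involve only the coefficients of `x^(p+1)` and
`y^(q+1)`, and neither monomial is on the list. So the list is dual to the coordinates. -/
theorem chartCoord_monomialSeq (hm : m = p + q + 1) (j : Fin m) :
    chartCoord m p q d c (1 ⊗ₜ monomialSeq p j) = Pi.single j 1 := by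
  ext k
  have hj := j.2
  have hk := k.2
  rw [chartCoord_apply, Pi.single_apply, monomialSeq, chartCoordAt]
  simp only [Fin.ext_iff]
  generalize (j : ℕ) = j at *
  generalize (k : ℕ) = k at *
  by_cases hjp : j ≤ p
  · rw [if_pos hjp, ← tx_pow]
    split_ifs with h1 h2 h3 h4 h5 h6 h7 <;>
      simp only [LinearMap.sub_apply, LinearMap.smul_apply, famX_tx_pow, famY_tx_pow, smul_eq_mul]
    all_goals first | rw [if_pos (by omega)] | rw [if_neg (by omega)]
    all_goals try first | rw [if_pos (by omega)] | rw [if_neg (by omega)]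
    all_goals first | simp; done | omega
  · rw [if_neg hjp, ← ty_pow]
    split_ifs with h1 h2 h3 h4 h5 h6 h7 <;>
      simp only [LinearMap.sub_apply, LinearMap.smul_apply, famX_ty_pow, famY_ty_pow, smul_eq_mul]
    all_goals first | rw [if_pos (by omega)] | rw [if_neg (by omega)]
    all_goals try first | rw [if_pos (by omega)] | rw [if_neg (by omega)]
    all_goals first | simp; done | omega

/-- The `m` coordinates record the constant term once, along `x`; the equation for the constant term
along `y` follows since the two agree. -/
theorem IsChart.mem_iff_chartCoord (h : IsChart p q d c) (hm : m = p + q + 1)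
    (t : A ⊗[ℂ] NodeRing) : t ∈ chartIdeal p q d c ↔ chartCoord m p q d c t = 0 := by
  rw [h.mem_iff]
  constructor
  · rintro ⟨hX, hY, h1, h2⟩
    ext k
    have hk := k.2
    rw [chartCoord_apply, chartCoordAt, Pi.zero_apply]
    split_ifs with h3 h4 h5
    · exact hX _ h3
    · simp [h1]
    · exact hY _ (by omega)
    · simp [h2]
  · intro h0
    have key : ∀ k < m, chartCoordAt p q d c k t = 0 := fun k hk => congrFun h0 ⟨k, hk⟩
    have hX : ∀ j < p, famX A j t = 0 := fun j hj => by
      have := key j (by omega)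
      rwa [chartCoordAt, if_pos hj] at this
    have hXp : famX A p t = c * famY A (q + 1) t := by
      have := key p (by omega)
      rw [chartCoordAt, if_neg (lt_irrefl _), if_pos rfl] at this
      simpa [sub_eq_zero] using this
    have hY0 : famY A 0 t = 0 := by
      rw [← famX_zero_eq]
      rcases Nat.eq_zero_or_pos p with hp | hp
      · have hc := h.right hp
        subst hp
        rw [hXp, hc, zero_mul]
      · exact hX 0 hp
    refine ⟨hX, fun k hk => ?_, hXp, ?_⟩
    · rcases Nat.eq_zero_or_pos k with rfl | hk0
      · exact hY0
      · have := key (p + k) (by omega)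
        rwa [chartCoordAt, if_neg (by omega), if_neg (by omega), if_pos (by omega),
          add_tsub_cancel_left] at this
    · rcases Nat.eq_zero_or_pos q with hq | hq
      · have hd := h.left hq
        subst hq
        rw [hY0, hd, zero_mul]
      · have := key (p + q) (by omega)
        rw [chartCoordAt, if_neg (by omega), if_neg (by omega), if_neg (by omega)] at this
        simpa [sub_eq_zero] using this

theorem chartCoord_surjective (hm : m = p + q + 1) :
    Function.Surjective (chartCoord m p q d c) := by
  intro f
  refine ⟨∑ j, f j • (1 ⊗ₜ monomialSeq p j), ?_⟩
  rw [map_sum]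
  simp only [map_smul, chartCoord_monomialSeq hm]
  ext k
  simp [Pi.single_apply]

/-- The quotient by the ideal of a chart is free. -/
def chartEquiv (h : IsChart p q d c) (hm : m = p + q + 1) :
    ((A ⊗[ℂ] NodeRing) ⧸ chartIdeal p q d c) ≃ₗ[A] (Fin m → A) :=
  (Submodule.Quotient.restrictScalarsEquiv A (chartIdeal p q d c)).symm ≪≫ₗ
    Submodule.quotEquivOfEq _ _ (by
      ext t
      rw [LinearMap.mem_ker, ← h.mem_iff_chartCoord hm]
      rfl) ≪≫ₗ
    (chartCoord m p q d c).quotKerEquivOfSurjective (chartCoord_surjective hm)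

theorem chartEquiv_mk (h : IsChart p q d c) (hm : m = p + q + 1) (t : A ⊗[ℂ] NodeRing) :
    chartEquiv h hm (Ideal.Quotient.mk _ t) = chartCoord m p q d c t := rfl

/-- The monomial basis of the quotient by the ideal of a chart. -/
def chartBasis (h : IsChart p q d c) (hm : m = p + q + 1) :
    Module.Basis (Fin m) A ((A ⊗[ℂ] NodeRing) ⧸ chartIdeal p q d c) :=
  Module.Basis.ofEquivFun (chartEquiv h hm)

theorem chartBasis_apply (h : IsChart p q d c) (hm : m = p + q + 1) (j : Fin m) :
    chartBasis h hm j = Ideal.Quotient.mk _ (1 ⊗ₜ monomialSeq p j) := by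
  apply (chartEquiv h hm).injective
  rw [chartEquiv_mk, chartCoord_monomialSeq hm, chartBasis, Module.Basis.coe_ofEquivFun,
    LinearEquiv.apply_symm_apply]

theorem toMatrix_chartBasis (h : IsChart p q d c) (hm : m = p + q + 1) (r : NodeRing)
    (i j : Fin m) :
    LinearMap.toMatrix (chartBasis h hm) (chartBasis h hm) (mulQuot A _ r) i j =
      chartCoordAt p q d c i (1 ⊗ₜ (r * monomialSeq p j)) := by
  rw [LinearMap.toMatrix_apply, chartBasis_apply, mulQuot, LinearMap.mulLeft_apply, ← map_mul,
    Algebra.TensorProduct.tmul_mul_tmul, one_mul, chartBasis, Module.Basis.ofEquivFun_repr_apply,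
    chartEquiv_mk, chartCoord_apply]

theorem maximalIdeal_eq : IsLocalRing.maximalIdeal NodeRing = Ideal.span {nx, ny} := by
  have := IsLocalization.AtPrime.map_eq_maximalIdeal originIdeal NodeRing
  rw [← this, originIdeal, Ideal.map_span, Set.image_pair]
  rfl

theorem isNilpotent_mk_of_mem {I : Ideal (A ⊗[ℂ] NodeRing)} {M N : ℕ} (hx : tx A ^ M ∈ I)
    (hy : ty A ^ N ∈ I) {r : NodeRing} (hr : r ∈ IsLocalRing.maximalIdeal NodeRing) :
    IsNilpotent (Ideal.Quotient.mk I (1 ⊗ₜ r)) := by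
  rw [maximalIdeal_eq] at hr
  obtain ⟨a, b, rfl⟩ := Ideal.mem_span_pair.mp hr
  have e : (1 : A) ⊗ₜ[ℂ] (a * nx + b * ny) = 1 ⊗ₜ a * tx A + 1 ⊗ₜ b * ty A := by
    rw [TensorProduct.tmul_add, tx, ty, Algebra.TensorProduct.tmul_mul_tmul,
      Algebra.TensorProduct.tmul_mul_tmul, one_mul]
  rw [e, map_add, map_mul, map_mul]
  have hx' : IsNilpotent (Ideal.Quotient.mk I (tx A)) :=
    ⟨M, by rw [← map_pow]; exact Ideal.Quotient.eq_zero_iff_mem.mpr hx⟩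
  have hy' : IsNilpotent (Ideal.Quotient.mk I (ty A)) :=
    ⟨N, by rw [← map_pow]; exact Ideal.Quotient.eq_zero_iff_mem.mpr hy⟩
  rw [← mem_nilradical] at *
  exact add_mem (Ideal.mul_mem_left _ _ hx') (Ideal.mul_mem_left _ _ hy')

/-- The polynomial `xy` is squarefree, being a product of two non-associated primes. -/
instance : _root_.IsReduced NodeCoord := by
  rw [← Ideal.isRadical_iff_quotient_reduced, ← isRadical_iff_span_singleton]
  have h0 : Prime (MvPolynomial.X 0 : MvPolynomial (Fin 2) ℂ) := MvPolynomial.X_prime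
  have h1 : Prime (MvPolynomial.X 1 : MvPolynomial (Fin 2) ℂ) := MvPolynomial.X_prime
  apply Squarefree.isRadical
  rw [squarefree_mul_iff]
  refine ⟨?_, h0.irreducible.squarefree, h1.irreducible.squarefree⟩
  refine (h0.irreducible.isRelPrime_iff_not_dvd).mpr ?_
  rw [MvPolynomial.X_dvd_X]
  simp

/-- Elements of the maximal ideal act nilpotently. The characteristic polynomial of a nilpotent
matrix differs from `T^m` by a polynomial with nilpotent coefficients, which is zero over a reduced
ring. -/
theorem charpoly_chartBasis_of_isReduced [_root_.IsReduced A] (h : IsChart p q d c)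
    (hm : m = p + q + 1) {r : NodeRing} (hr : r ∈ IsLocalRing.maximalIdeal NodeRing) :
    (LinearMap.toMatrix (chartBasis h hm) (chartBasis h hm) (mulQuot A _ r)).charpoly =
      Polynomial.X ^ m := by
  have : IsNilpotent (LinearMap.toMatrix (chartBasis h hm) (chartBasis h hm) (mulQuot A _ r)) := by
    have h1 : IsNilpotent (mulQuot A (chartIdeal p q d c) r) := by
      obtain ⟨n, hn⟩ := isNilpotent_mk_of_mem h.tx_pow_mem h.ty_pow_mem hr
      refine ⟨n, ?_⟩
      rw [mulQuot, LinearMap.pow_mulLeft, hn]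
      exact LinearMap.mulLeft_zero_eq_zero A _
    exact h1.map (LinearMap.toMatrixAlgEquiv (chartBasis h hm))
  have := Matrix.isNilpotent_charpoly_sub_pow_of_isNilpotent this
  rw [Polynomial.isNilpotent_iff] at this
  rw [← sub_eq_zero]
  ext n
  simpa using (this n).eq_zero

/-- Every chart ideal is pulled back from the universal one over `ℂ[x, y]/(xy)`, the coordinates `d,
c` being the images of `x, y`. That base is reduced, and the matrices are compatible with pullback.
-/
theorem charpoly_chartBasis (h : IsChart p q d c) (hm : m = p + q + 1) {r : NodeRing}
    (hr : r ∈ IsLocalRing.maximalIdeal NodeRing) :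
    (LinearMap.toMatrix (chartBasis h hm) (chartBasis h hm) (mulQuot A _ r)).charpoly =
      Polynomial.X ^ m := by
  -- At an end of the chain one coordinate must vanish, so the universal coordinate is replaced by
  -- `0` there.
  set d₀ : NodeCoord := if q = 0 then 0 else coordX
  set c₀ : NodeCoord := if p = 0 then 0 else coordY
  have h₀ : IsChart p q d₀ c₀ :=
    ⟨by simp only [d₀, c₀]; split_ifs <;> simp [coordX_mul_coordY],
      fun hq => if_pos hq, fun hp => if_pos hp⟩
  set φ : NodeCoord →ₐ[ℂ] A := coordLift d c h.mul_eq_zero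
  have hd : φ d₀ = d := by
    simp only [d₀]
    split_ifs with hq
    · rw [map_zero, h.left hq]
    · exact coordLift_coordX _ _ _
  have hc : φ c₀ = c := by
    simp only [c₀]
    split_ifs with hp
    · rw [map_zero, h.right hp]
    · exact coordLift_coordY _ _ _
  have hM : LinearMap.toMatrix (chartBasis h hm) (chartBasis h hm) (mulQuot A _ r) =
      (LinearMap.toMatrix (chartBasis h₀ hm) (chartBasis h₀ hm) (mulQuot NodeCoord _ r)).map
        (φ : NodeCoord →+* A) := by
    ext i j
    rw [Matrix.map_apply, toMatrix_chartBasis, toMatrix_chartBasis]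
    change _ = φ _
    rw [map_chartCoordAt, hd, hc]
  rw [hM, Matrix.charpoly_map, charpoly_chartBasis_of_isReduced h₀ hm hr, Polynomial.map_pow,
    Polynomial.map_X]

end Basis

end NodeHilb

end

noncomputable section

namespace NodeHilb

/-! ### Linear algebra -/

section LinearAlgebra

/-- If an endomorphism kills the second part of a basis and has characteristic polynomial `T ^ n`,
then its power with exponent the size of the first part takes values in the span of the second. -/
theorem repr_pow_apply_inl_eq_zero {B M ι κ : Type*} [CommRing B] [AddCommGroup M] [Module B M]
    [Fintype ι] [Fintype κ] [DecidableEq ι] [DecidableEq κ] (v : Module.Basis (ι ⊕ κ) B M)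
    (T : M →ₗ[B] M) (hT : ∀ k, T (v (Sum.inr k)) = 0)
    (hchar : (LinearMap.toMatrix v v T).charpoly =
      Polynomial.X ^ (Fintype.card ι + Fintype.card κ)) (w : M) (j : ι) :
    v.repr ((T ^ Fintype.card ι) w) (Sum.inl j) = 0 := by
  set N := LinearMap.toMatrix v v T
  have h12 : N.toBlocks₁₂ = 0 := by
    ext i k
    simp [N, Matrix.toBlocks₁₂, LinearMap.toMatrix_apply, hT]
  have h22 : N.toBlocks₂₂ = 0 := by
    ext i k
    simp [N, Matrix.toBlocks₂₂, LinearMap.toMatrix_apply, hT]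
  have hN : N = Matrix.fromBlocks N.toBlocks₁₁ 0 N.toBlocks₂₁ 0 := by
    conv_lhs => rw [← Matrix.fromBlocks_toBlocks N, h12, h22]
  -- The matrix has only its first block column, so its characteristic polynomial is that of the
  -- upper left block times a power of `T`. Cancelling this power leaves `T^|ι|` for the block, and
  -- Cayley–Hamilton applies.
  have h11 : N.toBlocks₁₁ ^ Fintype.card ι = 0 := by
    have h1 : N.toBlocks₁₁.charpoly = Polynomial.X ^ Fintype.card ι := by
      rw [hN, Matrix.charpoly_fromBlocks_zero₁₂, Matrix.charpoly_zero, pow_add] at hchar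
      exact (Polynomial.monic_X_pow _).isRegular.right hchar
    have := Matrix.aeval_self_charpoly N.toBlocks₁₁
    rwa [h1, Polynomial.aeval_X_pow] at this
  have hpow : ∀ n : ℕ, ∃ P Q, N ^ (n + 1) = Matrix.fromBlocks (N.toBlocks₁₁ ^ (n + 1)) 0 P Q := by
    intro n
    induction n with
    | zero => exact ⟨_, _, by simpa using hN⟩
    | succ n ih =>
      obtain ⟨P, Q, h⟩ := ih
      rw [pow_succ, h]
      conv => enter [1, P, 1, Q, 1, 2]; rw [hN]
      rw [Matrix.fromBlocks_multiply]
      simp only [Matrix.mul_zero, Matrix.zero_mul, add_zero, ← pow_succ]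
      exact ⟨_, _, rfl⟩
  have hcard : 0 < Fintype.card ι := Fintype.card_pos_iff.mpr ⟨j⟩
  obtain ⟨P, Q, h⟩ := hpow (Fintype.card ι - 1)
  rw [Nat.sub_add_cancel hcard, h11] at h
  have h2 : LinearMap.toMatrix v v (T ^ Fintype.card ι) = N ^ Fintype.card ι :=
    map_pow (LinearMap.toMatrixAlgEquiv v) T _
  have h3 := LinearMap.toMatrix_mulVec_repr v v (T ^ Fintype.card ι) w
  rw [← h3, h2, h]
  simp [Matrix.mulVec, dotProduct]

end LinearAlgebra

/-! ### The equations of a family with a monomial basis -/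

section Equations

variable {B M : Type*} [CommRing B] [CommRing M] [Algebra B M] {p q : ℕ} {x y : M}

/-- The monomials `1, x, …, x ^ p` and `y, …, y ^ q` in an arbitrary ring. -/
def branchMonomials (p q : ℕ) (x y : M) : Fin (p + 1) ⊕ Fin q → M :=
  Sum.elim (fun j => x ^ (j : ℕ)) (fun k => y ^ (k + 1 : ℕ))

/-- The monomials `1, y, …, y ^ q` and `x, …, x ^ p` are a reindexing of `branchMonomials`. -/
def branchSwap (p q : ℕ) : Fin (p + 1) ⊕ Fin q ≃ Fin (q + 1) ⊕ Fin p :=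
  (Equiv.sumCongr (finSuccEquiv p) (Equiv.refl _)).trans <|
    ((Equiv.sumCongr (Equiv.optionEquivSumPUnit.{0} (Fin p)) (Equiv.refl _)).trans
      (Equiv.sumAssoc _ _ _)).trans <| (Equiv.sumComm _ _).trans <|
        Equiv.sumCongr ((Equiv.sumComm _ _).trans <| (Equiv.optionEquivSumPUnit.{0} (Fin q)).symm.trans
          (finSuccEquiv q).symm) (Equiv.refl _)

/-- The reindexing moves the shared monomial `1` from the `x`-list to the `y`-list, so that results
about `x` can be applied to `y`. -/
theorem branchMonomials_branchSwap (x y : M) (s : Fin (p + 1) ⊕ Fin q) :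
    branchMonomials q p y x (branchSwap p q s) = branchMonomials p q x y s := by
  rcases s with j | k
  · cases j using Fin.cases with
    | zero => simp [branchSwap, branchMonomials]
    | succ j => simp [branchSwap, branchMonomials]
  · simp [branchSwap, branchMonomials]

/-- Multiplication by `x` kills `y, …, y^q`, so its power of exponent `p + 1` maps into their span;
apply it to `1`. This is how the characteristic polynomial enters over a base that need not be
reduced. -/
theorem pow_eq_sum_of_charpoly (v : Module.Basis (Fin (p + 1) ⊕ Fin q) B M)
    (hv : ∀ s, v s = branchMonomials p q x y s) (hxy : x * y = 0)
    (hx : (LinearMap.toMatrix v v (LinearMap.mulLeft B x)).charpoly =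
      Polynomial.X ^ (p + q + 1)) :
    x ^ (p + 1) = ∑ k : Fin q, v.repr (x ^ (p + 1)) (Sum.inr k) • y ^ (k + 1 : ℕ) := by
  have h := repr_pow_apply_inl_eq_zero v (LinearMap.mulLeft B x) (fun k => by
    rw [hv, branchMonomials, Sum.elim_inr, LinearMap.mulLeft_apply, pow_succ', ← mul_assoc, hxy,
      zero_mul]) (by simpa [add_right_comm] using hx) 1
  simp only [Fintype.card_fin, LinearMap.pow_mulLeft, LinearMap.mulLeft_apply, mul_one] at h
  conv_lhs => rw [← v.sum_repr (x ^ (p + 1)), Fintype.sum_sum_type]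
  simp only [h, zero_smul, Finset.sum_const_zero, zero_add, hv, branchMonomials, Sum.elim_inr]

theorem charpoly_toMatrix_reindex {ι κ : Type*} [Fintype ι] [Fintype κ] [DecidableEq ι]
    [DecidableEq κ] (v : Module.Basis ι B M) (e : ι ≃ κ) (T : M →ₗ[B] M) :
    (LinearMap.toMatrix (v.reindex e) (v.reindex e) T).charpoly =
      (LinearMap.toMatrix v v T).charpoly := by
  rw [← Matrix.charpoly_reindex e]
  congr 1
  ext i j
  simp [LinearMap.toMatrix_apply]

/-- Multiplying the first relation by `y` kills its left side. After `y^(q+1)` is rewritten by the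
second relation, independence kills every `δ` but the last, and the products of the last `δ` with
the `γ`. The final clause serves to compute the product of the two constants when the lemma is
applied on both sides. -/
theorem exists_eq_neg_smul_of_sums (v : Module.Basis (Fin (p + 1) ⊕ Fin q) B M)
    (hv : ∀ s, v s = branchMonomials p q x y s) (hxy : x * y = 0) {δ : Fin q → B} {γ : Fin p → B}
    (h1 : x ^ (p + 1) = ∑ k : Fin q, δ k • y ^ (k + 1 : ℕ))
    (h2 : y ^ (q + 1) = ∑ j : Fin p, γ j • x ^ (j + 1 : ℕ)) :
    ∃ d : B, (q = 0 → d = 0) ∧ x ^ (p + 1) + d • y ^ q = 0 ∧ (∀ j, d * γ j = 0) ∧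
      (d = 0 ∨ ∃ k, d = - δ k) := by
  cases q with
  | zero =>
    refine ⟨0, fun _ => rfl, ?_, fun j => zero_mul _, Or.inl rfl⟩
    rw [h1]; simp
  | succ q =>
    have h3 : ∑ k : Fin q, δ k.castSucc • y ^ (k + 2 : ℕ) +
        ∑ j : Fin p, (δ (Fin.last q) * γ j) • x ^ (j + 1 : ℕ) = 0 := by
      have h4 := congrArg (· * y) h1
      rw [pow_succ, mul_assoc, hxy, mul_zero, Fin.sum_univ_castSucc, add_mul,
        Finset.sum_mul] at h4
      simp only [smul_mul_assoc, ← pow_succ, Fin.val_last, Fin.val_castSucc] at h4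
      rw [h2, Finset.smul_sum] at h4
      simp only [smul_smul] at h4
      exact h4.symm
    have hli := Fintype.linearIndependent_iff.mp v.linearIndependent
      -- The coefficients of `1` and of `y` are zero: the products start at `y^2`, and the rewritten
      -- top term starts at `x`.
      (Sum.elim (Fin.cons 0 fun j => δ (Fin.last q) * γ j) (Fin.cons 0 fun k => δ k.castSucc)) (by
        rw [Fintype.sum_sum_type, Fin.sum_univ_succ, Fin.sum_univ_succ]
        simp only [hv, branchMonomials, Sum.elim_inl, Sum.elim_inr, Fin.cons_zero, Fin.cons_succ,
          zero_smul, zero_add, Fin.val_succ]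
        rw [add_comm]
        exact h3)
    refine ⟨- δ (Fin.last q), fun h => absurd h (Nat.succ_ne_zero q), ?_, fun j => ?_,
      Or.inr ⟨_, rfl⟩⟩
    · rw [h1, Fin.sum_univ_castSucc, Finset.sum_eq_zero]
      · simp
      · intro k _
        have := hli (Sum.inr k.succ)
        simp only [Sum.elim_inr, Fin.cons_succ] at this
        rw [this, zero_smul]
    · have := hli (Sum.inl j.succ)
      simp only [Sum.elim_inl, Fin.cons_succ] at this
      rw [neg_mul, this, neg_zero]

/-- The previous lemma is applied on both branches. Either `c = 0` or `c` is minus one of the `γ j`,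
all of which `d` annihilates, so `dc = 0`. -/
theorem exists_chart_equations (v : Module.Basis (Fin (p + 1) ⊕ Fin q) B M)
    (hv : ∀ s, v s = branchMonomials p q x y s) (hxy : x * y = 0)
    (hx : (LinearMap.toMatrix v v (LinearMap.mulLeft B x)).charpoly =
      Polynomial.X ^ (p + q + 1))
    (hy : (LinearMap.toMatrix v v (LinearMap.mulLeft B y)).charpoly =
      Polynomial.X ^ (p + q + 1)) :
    ∃ d c : B, d * c = 0 ∧ (q = 0 → d = 0) ∧ (p = 0 → c = 0) ∧
      y ^ (q + 1) + c • x ^ p = 0 ∧ x ^ (p + 1) + d • y ^ q = 0 := by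
  have h1 := pow_eq_sum_of_charpoly v hv hxy hx
  set w := v.reindex (branchSwap p q)
  have hw : ∀ s, w s = branchMonomials q p y x s := fun s => by
    rw [Module.Basis.reindex_apply, hv, ← branchMonomials_branchSwap, Equiv.apply_symm_apply]
  have h2 := pow_eq_sum_of_charpoly w hw (by rw [mul_comm, hxy])
    (by rw [charpoly_toMatrix_reindex, hy, add_comm p q])
  obtain ⟨d, hd0, hd, hdγ, -⟩ := exists_eq_neg_smul_of_sums v hv hxy h1 h2
  obtain ⟨c, hc0, hc, -, hcγ⟩ :=
    exists_eq_neg_smul_of_sums w hw (by rw [mul_comm, hxy]) h2 h1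
  refine ⟨d, c, ?_, hd0, hc0, hc, hd⟩
  rcases hcγ with rfl | ⟨j, rfl⟩
  · rw [mul_zero]
  · rw [mul_neg, hdγ, neg_zero]

end Equations

/-! ### Monomial bases over a field -/

section FieldBasis

variable {K M : Type*} [Field K] [CommRing M] [Algebra K M] {x y : M}

/-- In a relation whose coefficients below `i` are known to vanish, multiplication by `x^(n-i)`
leaves only the `i`-th term. -/
theorem linearIndependent_pow_of_nilpotent {n : ℕ} (hn : x ^ n ≠ 0) (hn1 : x ^ (n + 1) = 0) :
    LinearIndependent K fun j : Fin (n + 1) => x ^ (j : ℕ) := by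
  rw [Fintype.linearIndependent_iff]
  intro g hg i
  induction i using WellFoundedLT.induction with
  | ind i ih =>
    have h := congrArg (· * x ^ (n - i : ℕ)) hg
    rw [zero_mul, Finset.sum_mul, Finset.sum_eq_single i, smul_mul_assoc, ← pow_add,
      Nat.add_sub_cancel' (Nat.lt_succ_iff.mp i.2)] at h
    · exact (smul_eq_zero.mp h).resolve_right hn
    · intro j _ hj
      rcases lt_or_gt_of_ne hj with hlt | hgt
      · rw [ih j hlt, zero_smul, zero_mul]
      · rw [smul_mul_assoc, ← pow_add, pow_eq_zero_of_le _ hn1, smul_zero]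
        have : (i : ℕ) < j := hgt
        omega
    · intro h; exact absurd (Finset.mem_univ i) h

/-- Multiplication by `y` kills the positive powers of `x` and shifts the rest of a relation to `y,
…, y^(r+1)`, which are independent; a relation among powers of `x` remains. The top power `y^(r+1)`
itself must be left out, since it may be a multiple of `x^p`. -/
theorem linearIndependent_branchMonomials {p r : ℕ} (hxy : x * y = 0) (hxp : x ^ p ≠ 0)
    (hxp1 : x ^ (p + 1) = 0) (hyr : y ^ (r + 1) ≠ 0) (hyr1 : y ^ (r + 1 + 1) = 0) :
    LinearIndependent K (branchMonomials p r x y) := by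
  rw [Fintype.linearIndependent_iff]
  intro g hg
  rw [Fintype.sum_sum_type] at hg
  simp only [branchMonomials, Sum.elim_inl, Sum.elim_inr] at hg
  -- The coefficients of the relation multiplied by `y`: no constant term, then the old coefficient
  -- of `1`, then those of the powers of `y`.
  obtain ⟨f, hf0, hf1, hf2⟩ : ∃ f : Fin (r + 1 + 1) → K, f 0 = 0 ∧
      f (Fin.succ 0) = g (Sum.inl 0) ∧ ∀ k : Fin r, f k.succ.succ = g (Sum.inr k) :=
    ⟨Fin.cons (α := fun _ => K) 0 (Fin.cons (α := fun _ => K) (g (Sum.inl 0)) fun k =>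
      g (Sum.inr k)), rfl, rfl, fun _ => rfl⟩
  have hli : LinearIndependent K fun j : Fin (r + 1 + 1) => y ^ (j : ℕ) :=
    linearIndependent_pow_of_nilpotent hyr hyr1
  have hsum : ∑ j, f j • y ^ (j : ℕ) = 0 := by
    have h := congrArg (· * y) hg
    rw [Fin.sum_univ_succ, add_mul, add_mul, Finset.sum_mul, Finset.sum_eq_zero, add_zero,
      Finset.sum_mul, zero_mul] at h
    · rw [Fin.sum_univ_succ, Fin.sum_univ_succ]
      simp only [hf0, hf1, hf2, zero_smul, zero_add, Fin.val_succ, Fin.val_zero]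
      simpa only [Fin.val_zero, smul_mul_assoc, pow_zero, one_mul, pow_one, zero_add, pow_succ]
        using h
    · intro j _
      rw [Fin.val_succ, pow_succ, smul_mul_assoc, mul_assoc, hxy, mul_zero, smul_zero]
  have hY : ∀ j, f j = 0 := Fintype.linearIndependent_iff.mp hli f hsum
  have hr : ∀ k, g (Sum.inr k) = 0 := fun k => (hf2 k).symm.trans (hY _)
  simp only [hr, zero_smul, Finset.sum_const_zero, add_zero] at hg
  have hliX : LinearIndependent K fun j : Fin (p + 1) => x ^ (j : ℕ) :=
    linearIndependent_pow_of_nilpotent hxp hxp1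
  have hX := Fintype.linearIndependent_iff.mp hliX (fun j => g (Sum.inl j)) hg
  rintro (j | k)
  exacts [hX j, hr k]

theorem exists_pow_ne_zero_of_isNilpotent [Nontrivial M] (hx : IsNilpotent x) :
    ∃ n : ℕ, x ^ n ≠ 0 ∧ x ^ (n + 1) = 0 := by
  classical
  have h0 : Nat.find hx ≠ 0 := fun h => by
    have := Nat.find_spec hx
    rw [h, pow_zero] at this
    exact one_ne_zero this
  refine ⟨Nat.find hx - 1, Nat.find_min hx (by omega), ?_⟩
  rw [Nat.sub_add_cancel (by omega)]
  exact Nat.find_spec hx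

/-- With `x^p` and `y^q` the last nonzero powers, the `p + q + 1` monomials span. If they are
independent they form a basis. Otherwise the dimension is at most `p + q`, and dropping `y^q` leaves
`p + q` independent monomials, hence a basis. -/
theorem exists_basis_branchMonomials [Nontrivial M] [Module.Finite K M] (hx : IsNilpotent x)
    (hy : IsNilpotent y) (hxy : x * y = 0)
    (hspan : Submodule.span K (Set.range (fun j : ℕ => x ^ j) ∪ Set.range fun k : ℕ => y ^ k) = ⊤) :
    ∃ p q : ℕ, p + q + 1 = Module.finrank K M ∧
      ∃ v : Module.Basis (Fin (p + 1) ⊕ Fin q) K M, ∀ s, v s = branchMonomials p q x y s := by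
  obtain ⟨p, hxp, hxp1⟩ := exists_pow_ne_zero_of_isNilpotent hx
  obtain ⟨q, hyq, hyq1⟩ := exists_pow_ne_zero_of_isNilpotent hy
  have hx0 : ∀ j, p + 1 ≤ j → x ^ j = 0 := fun j hj => pow_eq_zero_of_le hj hxp1
  have hy0 : ∀ j, q + 1 ≤ j → y ^ j = 0 := fun j hj => pow_eq_zero_of_le hj hyq1
  have htop : ⊤ ≤ Submodule.span K (Set.range (branchMonomials p q x y)) := by
    rw [← hspan, Submodule.span_le]
    rintro _ (⟨j, rfl⟩ | ⟨k, rfl⟩)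
    · by_cases hj : j < p + 1
      · exact Submodule.subset_span ⟨Sum.inl ⟨j, hj⟩, rfl⟩
      · simp [hx0 j (by omega)]
    · by_cases hk : k < q + 1
      · rcases Nat.eq_zero_or_pos k with rfl | hpos
        · exact Submodule.subset_span ⟨Sum.inl 0, by simp [branchMonomials]⟩
        · exact Submodule.subset_span ⟨Sum.inr ⟨k - 1, by omega⟩, by
            simp [branchMonomials, Nat.sub_add_cancel hpos]⟩
      · simp [hy0 k (by omega)]
  have hle : Module.finrank K M ≤ p + q + 1 := by
    have := finrank_range_le_card (R := K) (branchMonomials p q x y)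
    rw [Set.finrank, top_le_iff.mp htop, finrank_top] at this
    simpa [add_right_comm] using this
  rcases hle.eq_or_lt with heq | hlt
  · refine ⟨p, q, heq.symm, ?_⟩
    have hli := linearIndependent_of_top_le_span_of_card_eq_finrank htop
      (by simp [heq, add_right_comm])
    exact ⟨Module.Basis.mk hli htop, fun s => Module.Basis.mk_apply hli htop s⟩
  -- For `q = 0` the `p + 1` powers of `x` are already independent, which contradicts the strict
  -- inequality.
  · rcases Nat.eq_zero_or_pos q with rfl | hq
    · have := (linearIndependent_pow_of_nilpotent (K := K) hxp hxp1).fintype_card_le_finrank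
      rw [Fintype.card_fin] at this
      omega
    · obtain ⟨r, rfl⟩ := Nat.exists_eq_succ_of_ne_zero hq.ne'
      have hli := linearIndependent_branchMonomials (K := K) hxy hxp hxp1 hyq hyq1
      have hcard := hli.fintype_card_le_finrank
      rw [Fintype.card_sum, Fintype.card_fin, Fintype.card_fin] at hcard
      have hc : Fintype.card (Fin (p + 1) ⊕ Fin r) = Module.finrank K M := by
        rw [Fintype.card_sum, Fintype.card_fin, Fintype.card_fin]; omega
      refine ⟨p, r, by omega, basisOfLinearIndependentOfCardEqFinrank hli hc, fun s => ?_⟩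
      rw [coe_basisOfLinearIndependentOfCardEqFinrank]

end FieldBasis

end NodeHilb

end

noncomputable section

namespace NodeHilb

/-! ### Base change of families -/

section FamMap

variable {A B C : Type} [CommRing A] [Algebra ℂ A] [CommRing B] [Algebra ℂ B]
  [CommRing C] [Algebra ℂ C]

/-- The base change homomorphism `A ⊗ R → B ⊗ R`. -/
abbrev famMap (φ : A →ₐ[ℂ] B) : A ⊗[ℂ] NodeRing →ₐ[ℂ] B ⊗[ℂ] NodeRing :=
  Algebra.TensorProduct.map φ (AlgHom.id ℂ NodeRing)

theorem famMap_one_tmul (φ : A →ₐ[ℂ] B) (r : NodeRing) : famMap φ (1 ⊗ₜ r) = 1 ⊗ₜ r := by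
  simp

theorem famMap_smul (φ : A →ₐ[ℂ] B) (a : A) (t : A ⊗[ℂ] NodeRing) :
    famMap φ (a • t) = φ a • famMap φ t := by
  induction t with
  | zero => simp
  | add t u ht hu => rw [smul_add, map_add, map_add, ht, hu, smul_add]
  | tmul b r => simp [TensorProduct.smul_tmul']

theorem famMap_tx (φ : A →ₐ[ℂ] B) : famMap φ (tx A) = tx B := famMap_one_tmul φ nx
theorem famMap_ty (φ : A →ₐ[ℂ] B) : famMap φ (ty A) = ty B := famMap_one_tmul φ ny

theorem famMap_comp (ψ : B →ₐ[ℂ] C) (φ : A →ₐ[ℂ] B) (t : A ⊗[ℂ] NodeRing) :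
    famMap (ψ.comp φ) t = famMap ψ (famMap φ t) := by
  induction t with
  | zero => simp
  | add t u ht hu => rw [map_add, map_add, map_add, ht, hu]
  | tmul b r => simp

theorem map_famMap_comp (ψ : B →ₐ[ℂ] C) (φ : A →ₐ[ℂ] B) (I : Ideal (A ⊗[ℂ] NodeRing)) :
    I.map (famMap (ψ.comp φ)) = (I.map (famMap φ)).map (famMap ψ) := by
  have : (famMap (ψ.comp φ) : A ⊗[ℂ] NodeRing →+* C ⊗[ℂ] NodeRing) =
      (famMap ψ : B ⊗[ℂ] NodeRing →+* C ⊗[ℂ] NodeRing).comp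
        (famMap φ : A ⊗[ℂ] NodeRing →+* B ⊗[ℂ] NodeRing) :=
    RingHom.ext fun t => famMap_comp ψ φ t
  change I.map (famMap (ψ.comp φ) : A ⊗[ℂ] NodeRing →+* C ⊗[ℂ] NodeRing) = _
  rw [this, ← Ideal.map_map]
  rfl

end FamMap

section BaseChange

variable {A : Type} [CommRing A] [Algebra ℂ A] (B : Type) [CommRing B] [Algebra ℂ B]
  [Algebra A B] [IsScalarTower ℂ A B] (I : Ideal (A ⊗[ℂ] NodeRing))

/-- The base change of an ideal. -/
abbrev baseIdeal : Ideal (B ⊗[ℂ] NodeRing) := I.map (famMap (IsScalarTower.toAlgHom ℂ A B))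

/-- The base change homomorphism, `A`-linearly. -/
def famMapₐ : A ⊗[ℂ] NodeRing →ₐ[A] B ⊗[ℂ] NodeRing :=
  { famMap (IsScalarTower.toAlgHom ℂ A B) with
    commutes' := fun a => by
      change famMap _ (a ⊗ₜ 1) = algebraMap A B a ⊗ₜ 1
      simp }

/-- The comparison of the base change of the quotient with the quotient by the base change. -/
def baseQuotHom : B ⊗[A] ((A ⊗[ℂ] NodeRing) ⧸ I) →ₐ[B] (B ⊗[ℂ] NodeRing) ⧸ baseIdeal B I :=
  Algebra.TensorProduct.lift (Algebra.ofId B _)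
    (Ideal.Quotient.liftₐ I ((Ideal.Quotient.mkₐ A (baseIdeal B I)).comp (famMapₐ B))
      (fun _ ht => Ideal.Quotient.eq_zero_iff_mem.mpr (Ideal.mem_map_of_mem _ ht)))
    (fun _ _ => Commute.all _ _)

theorem baseQuotHom_tmul (b : B) (t : A ⊗[ℂ] NodeRing) :
    baseQuotHom B I (b ⊗ₜ Ideal.Quotient.mk I t) =
      b • Ideal.Quotient.mk _ (famMap (IsScalarTower.toAlgHom ℂ A B) t) := by
  rw [baseQuotHom, Algebra.TensorProduct.lift_tmul, Algebra.ofId_apply, ← Algebra.smul_def]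
  rfl

/-- The lift of `baseQuotInv` to `B ⊗ R`. -/
def baseQuotInvAux : B ⊗[ℂ] NodeRing →ₐ[B] B ⊗[A] ((A ⊗[ℂ] NodeRing) ⧸ I) :=
  Algebra.TensorProduct.lift (Algebra.ofId B _)
    (((Algebra.TensorProduct.includeRight :
      ((A ⊗[ℂ] NodeRing) ⧸ I) →ₐ[A] B ⊗[A] ((A ⊗[ℂ] NodeRing) ⧸ I)).restrictScalars ℂ).comp
        ((Ideal.Quotient.mkₐ ℂ I).comp Algebra.TensorProduct.includeRight))
    (fun _ _ => Commute.all (S := B ⊗[A] ((A ⊗[ℂ] NodeRing) ⧸ I)) _ _)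

theorem baseQuotInvAux_tmul (b : B) (r : NodeRing) :
    baseQuotInvAux B I (b ⊗ₜ r) = b ⊗ₜ Ideal.Quotient.mk I (1 ⊗ₜ r) := by
  simp only [baseQuotInvAux, Algebra.TensorProduct.lift_tmul]
  change (b ⊗ₜ[A] 1) * (1 ⊗ₜ[A] Ideal.Quotient.mk I (1 ⊗ₜ r)) = _
  rw [Algebra.TensorProduct.tmul_mul_tmul, one_mul, mul_one]

theorem baseQuotInvAux_famMap (t : A ⊗[ℂ] NodeRing) :
    baseQuotInvAux B I (famMap (IsScalarTower.toAlgHom ℂ A B) t) =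
      1 ⊗ₜ Ideal.Quotient.mk I t := by
  induction t with
  | zero => simp
  | add t u ht hu => rw [map_add, map_add, ht, hu, map_add, TensorProduct.tmul_add]
  | tmul a r =>
    rw [Algebra.TensorProduct.map_tmul, baseQuotInvAux_tmul]
    have h1 : a ⊗ₜ[ℂ] r = a • ((1 : A) ⊗ₜ[ℂ] r) := by simp [TensorProduct.smul_tmul']
    have h2 : Ideal.Quotient.mk I (a • ((1 : A) ⊗ₜ[ℂ] r)) =
      a • Ideal.Quotient.mk I ((1 : A) ⊗ₜ[ℂ] r) := rfl
    rw [h1, h2, TensorProduct.tmul_smul, TensorProduct.smul_tmul', Algebra.smul_def, mul_one]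
    rfl

/-- The inverse of the comparison map. -/
def baseQuotInv : ((B ⊗[ℂ] NodeRing) ⧸ baseIdeal B I) →ₐ[B] B ⊗[A] ((A ⊗[ℂ] NodeRing) ⧸ I) :=
  Ideal.Quotient.liftₐ _ (baseQuotInvAux B I) (by
    have : baseIdeal B I ≤ RingHom.ker (baseQuotInvAux B I) := by
      rw [baseIdeal, Ideal.map_le_iff_le_comap]
      intro t ht
      rw [Ideal.mem_comap, RingHom.mem_ker, baseQuotInvAux_famMap,
        Ideal.Quotient.eq_zero_iff_mem.mpr ht, TensorProduct.tmul_zero]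
    exact fun a ha => this ha)

theorem baseQuotInv_mk (t : B ⊗[ℂ] NodeRing) :
    baseQuotInv B I (Ideal.Quotient.mk _ t) = baseQuotInvAux B I t := rfl

/-- The base change of the quotient is the quotient by the base change. -/
def baseQuotEquiv : B ⊗[A] ((A ⊗[ℂ] NodeRing) ⧸ I) ≃ₐ[B] (B ⊗[ℂ] NodeRing) ⧸ baseIdeal B I :=
  AlgEquiv.ofAlgHom (baseQuotHom B I) (baseQuotInv B I)
    (by
      ext t
      obtain ⟨t, rfl⟩ := Ideal.Quotient.mk_surjective t
      rw [AlgHom.comp_apply, baseQuotInv_mk, AlgHom.id_apply]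
      induction t with
      | zero => simp
      | add t u ht hu => rw [map_add, map_add, map_add, ht, hu]
      | tmul b r =>
        rw [baseQuotInvAux_tmul, baseQuotHom_tmul, famMap_one_tmul]
        change Ideal.Quotient.mk _ (b • ((1 : B) ⊗ₜ[ℂ] r)) = _
        simp [TensorProduct.smul_tmul'])
    (by
      apply AlgHom.ext
      intro s
      induction s with
      | zero => simp
      | add t u ht hu => rw [map_add, map_add, ht, hu]
      | tmul b t =>
        obtain ⟨t, rfl⟩ := Ideal.Quotient.mk_surjective t
        rw [AlgHom.comp_apply, baseQuotHom_tmul, map_smul, baseQuotInv_mk, baseQuotInvAux_famMap,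
          TensorProduct.smul_tmul', smul_eq_mul, mul_one, AlgHom.id_apply])

theorem baseQuotEquiv_tmul (b : B) (t : A ⊗[ℂ] NodeRing) :
    baseQuotEquiv B I (b ⊗ₜ Ideal.Quotient.mk I t) =
      b • Ideal.Quotient.mk _ (famMap (IsScalarTower.toAlgHom ℂ A B) t) :=
  baseQuotHom_tmul B I b t

theorem baseQuotEquiv_mulQuot (r : NodeRing) (s : B ⊗[A] ((A ⊗[ℂ] NodeRing) ⧸ I)) :
    baseQuotEquiv B I ((mulQuot A I r).baseChange B s) =
      mulQuot B (baseIdeal B I) r (baseQuotEquiv B I s) := by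
  induction s with
  | zero => simp
  | add t u ht hu => rw [map_add, map_add, ht, hu, map_add, map_add]
  | tmul b t =>
    obtain ⟨t, rfl⟩ := Ideal.Quotient.mk_surjective t
    rw [LinearMap.baseChange_tmul, mulQuot, LinearMap.mulLeft_apply, ← map_mul,
      baseQuotEquiv_tmul, baseQuotEquiv_tmul, map_mul, famMap_one_tmul, mulQuot,
      LinearMap.mulLeft_apply, map_mul, mul_smul_comm]

/-- A basis of the quotient on which the maximal ideal of `R` acts with the characteristic
polynomial `T ^ m`. -/
def HasPunctualBasis (m : ℕ) (J : Ideal (B ⊗[ℂ] NodeRing)) : Prop :=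
  ∃ b : Module.Basis (Fin m) B ((B ⊗[ℂ] NodeRing) ⧸ J),
    ∀ r ∈ IsLocalRing.maximalIdeal NodeRing,
      (LinearMap.toMatrix b b (mulQuot B J r)).charpoly = Polynomial.X ^ m

theorem exists_basis_baseChange_iff (m : ℕ) :
    (∃ b : Module.Basis (Fin m) B (B ⊗[A] ((A ⊗[ℂ] NodeRing) ⧸ I)),
      ∀ r ∈ IsLocalRing.maximalIdeal NodeRing,
        (LinearMap.toMatrix b b ((mulQuot A I r).baseChange B)).charpoly = Polynomial.X ^ m) ↔
    HasPunctualBasis B m (baseIdeal B I) := by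
  constructor
  · rintro ⟨b, hb⟩
    refine ⟨b.map (baseQuotEquiv B I).toLinearEquiv, fun r hr => ?_⟩
    rw [← hb r hr]
    congr 1
    ext i j
    rw [LinearMap.toMatrix_apply, LinearMap.toMatrix_apply, Module.Basis.map_apply,
      Module.Basis.map_repr, LinearEquiv.trans_apply, AlgEquiv.toLinearEquiv_apply,
      ← baseQuotEquiv_mulQuot]
    congr 2
    exact (baseQuotEquiv B I).symm_apply_apply _
  · rintro ⟨b, hb⟩
    refine ⟨b.map (baseQuotEquiv B I).symm.toLinearEquiv, fun r hr => ?_⟩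
    rw [← hb r hr]
    congr 1
    ext i j
    rw [LinearMap.toMatrix_apply, LinearMap.toMatrix_apply, Module.Basis.map_apply,
      Module.Basis.map_repr, LinearEquiv.trans_apply]
    congr 2
    change baseQuotEquiv B I (_) = _
    rw [baseQuotEquiv_mulQuot]
    congr 1
    exact (baseQuotEquiv B I).apply_symm_apply _

/-- The condition on the localized module is restated for the extended ideal, to which results over
the localized base apply directly. -/
theorem isPunctualFamily_iff (m : ℕ) :
    IsPunctualFamily A m I ↔ ∀ p : PrimeSpectrum A, ∃ f : A, f ∉ p.asIdeal ∧
      HasPunctualBasis (Localization.Away f) m (baseIdeal (Localization.Away f) I) := by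
  simp only [IsPunctualFamily, exists_basis_baseChange_iff]

end BaseChange

end NodeHilb

end

noncomputable section

namespace NodeHilb

/-! ### Families are locally given by the ideals of the charts -/

section LocalForm

variable {A : Type} [CommRing A] [Algebra ℂ A] (B : Type) [CommRing B] [Algebra ℂ B]
  [Algebra A B] [IsScalarTower ℂ A B] {I : Ideal (A ⊗[ℂ] NodeRing)}

theorem baseIdeal_baseIdeal (C : Type) [CommRing C] [Algebra ℂ C] [Algebra A C] [Algebra B C]
    [IsScalarTower ℂ A C] [IsScalarTower ℂ B C] [IsScalarTower A B C]
    (I : Ideal (A ⊗[ℂ] NodeRing)) : baseIdeal C (baseIdeal B I) = baseIdeal C I := by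
  rw [baseIdeal, baseIdeal, ← map_famMap_comp]
  congr 1
  rw [show (IsScalarTower.toAlgHom ℂ B C).comp (IsScalarTower.toAlgHom ℂ A B) =
    IsScalarTower.toAlgHom ℂ A C from AlgHom.ext fun a => (IsScalarTower.algebraMap_apply A B C a).symm]

/-- The base change of a basis of the quotient. -/
def baseBasis {ι : Type*} (b : Module.Basis ι A ((A ⊗[ℂ] NodeRing) ⧸ I)) :
    Module.Basis ι B ((B ⊗[ℂ] NodeRing) ⧸ baseIdeal B I) :=
  (b.baseChange B).map (baseQuotEquiv B I).toLinearEquiv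

theorem baseBasis_repr {ι : Type*} (b : Module.Basis ι A ((A ⊗[ℂ] NodeRing) ⧸ I))
    (t : A ⊗[ℂ] NodeRing) (i : ι) :
    (baseBasis B b).repr (Ideal.Quotient.mk _ (famMap (IsScalarTower.toAlgHom ℂ A B) t)) i =
      algebraMap A B (b.repr (Ideal.Quotient.mk I t) i) := by
  have h : (baseQuotEquiv B I).toLinearEquiv.symm
      (Ideal.Quotient.mk _ (famMap (IsScalarTower.toAlgHom ℂ A B) t)) =
        1 ⊗ₜ Ideal.Quotient.mk I t := by
    rw [LinearEquiv.symm_apply_eq, AlgEquiv.toLinearEquiv_apply, baseQuotEquiv_tmul, one_smul]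
  rw [baseBasis, Module.Basis.map_repr, LinearEquiv.trans_apply, h,
    Module.Basis.baseChange_repr_tmul, Algebra.smul_def, mul_one]

theorem HasPunctualBasis.baseChange {m : ℕ} (h : HasPunctualBasis A m I) :
    HasPunctualBasis B m (baseIdeal B I) := by
  rw [← exists_basis_baseChange_iff]
  obtain ⟨b, hb⟩ := h
  refine ⟨Algebra.TensorProduct.basis B b, fun r hr => ?_⟩
  rw [LinearMap.toMatrix_baseChange, Matrix.charpoly_map, hb r hr, Polynomial.map_pow,
    Polynomial.map_X]

theorem HasPunctualBasis.charpoly {m : ℕ} {J : Ideal (A ⊗[ℂ] NodeRing)}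
    (h : HasPunctualBasis A m J) {r : NodeRing} (hr : r ∈ IsLocalRing.maximalIdeal NodeRing)
    {ι : Type*} [Fintype ι] [DecidableEq ι] (v : Module.Basis ι A ((A ⊗[ℂ] NodeRing) ⧸ J)) :
    (LinearMap.toMatrix v v (mulQuot A J r)).charpoly = Polynomial.X ^ m := by
  obtain ⟨b, hb⟩ := h
  have := Module.Free.of_basis b
  have := Module.Finite.of_basis b
  rw [LinearMap.charpoly_toMatrix, ← hb r hr, LinearMap.charpoly_toMatrix]

/-- Cayley–Hamilton for multiplication by `r`, evaluated at `1`. -/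
theorem HasPunctualBasis.pow_mem {m : ℕ} {J : Ideal (A ⊗[ℂ] NodeRing)}
    (h : HasPunctualBasis A m J) {r : NodeRing} (hr : r ∈ IsLocalRing.maximalIdeal NodeRing) :
    ((1 : A) ⊗ₜ[ℂ] r) ^ m ∈ J := by
  obtain ⟨b, hb⟩ := h
  have h1 := Matrix.aeval_self_charpoly (LinearMap.toMatrix b b (mulQuot A J r))
  rw [hb r hr, Polynomial.aeval_X_pow] at h1
  have h2 : LinearMap.toMatrixAlgEquiv b (mulQuot A J r ^ m) = 0 := by
    rw [map_pow]; exact h1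
  rw [map_eq_zero_iff _ (LinearMap.toMatrixAlgEquiv b).injective] at h2
  have h3 := LinearMap.congr_fun h2 1
  rw [mulQuot, LinearMap.pow_mulLeft, LinearMap.mulLeft_apply, mul_one, LinearMap.zero_apply,
    ← map_pow] at h3
  exact Ideal.Quotient.eq_zero_iff_mem.mp h3

theorem nx_mem_maximalIdeal : nx ∈ IsLocalRing.maximalIdeal NodeRing := by
  rw [maximalIdeal_eq]; exact Ideal.subset_span (Or.inl rfl)

theorem ny_mem_maximalIdeal : ny ∈ IsLocalRing.maximalIdeal NodeRing := by
  rw [maximalIdeal_eq]; exact Ideal.subset_span (Or.inr rfl)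

/-- Modulo `J` every element equals its Taylor truncation. -/
theorem span_powers_eq_top {J : Ideal (A ⊗[ℂ] NodeRing)} {N : ℕ} (hx : tx A ^ N ∈ J)
    (hy : ty A ^ N ∈ J) :
    Submodule.span A (Set.range (fun j : ℕ => Ideal.Quotient.mk J (tx A) ^ j) ∪
      Set.range fun k : ℕ => Ideal.Quotient.mk J (ty A) ^ k) = ⊤ := by
  rw [eq_top_iff]
  rintro s -
  obtain ⟨t, rfl⟩ := Ideal.Quotient.mk_surjective s
  have h := sub_famTaylor_mem N N t
  have hle : Ideal.span {tx A ^ (N + 1), ty A ^ (N + 1)} ≤ J := by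
    rw [Ideal.span_le]
    rintro z (rfl | rfl)
    exacts [Ideal.pow_mem_of_pow_mem J hx N.le_succ, Ideal.pow_mem_of_pow_mem J hy N.le_succ]
  rw [Ideal.Quotient.eq.mpr (hle h), map_add, map_sum, map_sum]
  refine add_mem (Submodule.sum_mem _ fun j _ => ?_) (Submodule.sum_mem _ fun k _ => ?_)
  · have : Ideal.Quotient.mk J (famX A j t • tx A ^ j) =
      famX A j t • Ideal.Quotient.mk J (tx A) ^ j := by rw [← map_pow]; rfl
    rw [this]
    exact Submodule.smul_mem _ _ (Submodule.subset_span (Or.inl ⟨j, rfl⟩))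
  · have : Ideal.Quotient.mk J (famY A (k + 1) t • ty A ^ (k + 1)) =
      famY A (k + 1) t • Ideal.Quotient.mk J (ty A) ^ (k + 1) := by rw [← map_pow]; rfl
    rw [this]
    exact Submodule.smul_mem _ _ (Submodule.subset_span (Or.inr ⟨k + 1, rfl⟩))

/-- The two indexings of the monomial basis. -/
def monomialIndex {m p q : ℕ} (h : m = p + q + 1) : Fin (p + 1) ⊕ Fin q ≃ Fin m :=
  finSumFinEquiv.trans (finCongr (by omega))

theorem mk_monomialSeq {J : Ideal (A ⊗[ℂ] NodeRing)} {m p q : ℕ} (h : m = p + q + 1)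
    (s : Fin (p + 1) ⊕ Fin q) :
    Ideal.Quotient.mk J (1 ⊗ₜ monomialSeq p (monomialIndex h s)) =
      branchMonomials p q (Ideal.Quotient.mk J (tx A)) (Ideal.Quotient.mk J (ty A)) s := by
  rcases s with j | k
  · have : ((monomialIndex h (Sum.inl j) : Fin m) : ℕ) = j := by simp [monomialIndex]
    rw [this, monomialSeq, if_pos (by omega), ← tx_pow, map_pow, branchMonomials, Sum.elim_inl]
  · have : ((monomialIndex h (Sum.inr k) : Fin m) : ℕ) = p + 1 + k := by simp [monomialIndex]
    rw [this, monomialSeq, if_neg (by omega), ← ty_pow, map_pow, branchMonomials, Sum.elim_inr]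
    congr 1
    omega

/-- An ideal for which the monomials form a basis of the quotient, and which satisfies the condition
on the characteristic polynomials, is the ideal of a chart. -/
theorem HasPunctualBasis.exists_eq_chartIdeal {m p q : ℕ} {J : Ideal (A ⊗[ℂ] NodeRing)}
    (h : HasPunctualBasis A m J) (hm : m = p + q + 1)
    (v : Module.Basis (Fin (p + 1) ⊕ Fin q) A ((A ⊗[ℂ] NodeRing) ⧸ J))
    (hv : ∀ s, v s = branchMonomials p q (Ideal.Quotient.mk J (tx A))
      (Ideal.Quotient.mk J (ty A)) s) :
    ∃ d c : A, IsChart p q d c ∧ J = chartIdeal p q d c := by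
  obtain ⟨d, c, hdc, hd, hc, h1, h2⟩ := exists_chart_equations v hv
    (by rw [← map_mul, tx_mul_ty, map_zero])
    (by rw [← hm]; exact h.charpoly nx_mem_maximalIdeal v)
    (by rw [← hm]; exact h.charpoly ny_mem_maximalIdeal v)
  have hchart : IsChart p q d c := ⟨hdc, hd, hc⟩
  have hle : chartIdeal p q d c ≤ J := by
    rw [chartIdeal, Ideal.span_le]
    rintro z (rfl | rfl)
    · exact Ideal.Quotient.eq_zero_iff_mem.mp h1
    · exact Ideal.Quotient.eq_zero_iff_mem.mp h2
  -- Reduced modulo the chart ideal, an element of `J` becomes a combination of the monomials that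
  -- still lies in `J`; as these are independent modulo `J`, all its chart coordinates vanish.
  refine ⟨d, c, hchart, le_antisymm (fun t ht => ?_) hle⟩
  rw [hchart.mem_iff_chartCoord hm]
  set f := chartCoord m p q d c t
  have ht' : t - ∑ j, f j • (1 ⊗ₜ monomialSeq p j) ∈ J := by
    apply hle
    rw [hchart.mem_iff_chartCoord hm, map_sub, map_sum, sub_eq_zero]
    simp only [map_smul, chartCoord_monomialSeq hm]
    ext k
    simp [f, Pi.single_apply]
  have hsum := (Submodule.sub_mem_iff_right _ ht).mp ht'
  rw [← Ideal.Quotient.eq_zero_iff_mem, map_sum, ← (monomialIndex hm).sum_comp] at hsum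
  have hli := Fintype.linearIndependent_iff.mp v.linearIndependent
    (fun s => f (monomialIndex hm s)) (by
      rw [← hsum]
      refine Finset.sum_congr rfl fun s _ => ?_
      rw [hv, ← mk_monomialSeq hm]
      rfl)
  ext k
  simpa using hli ((monomialIndex hm).symm k)

/-- The residue field selects a monomial basis. The function `g` is the determinant of those
monomials in a basis of the quotient over `A`; it is nonzero at the point, and the monomials are a
basis wherever it is invertible. -/
theorem HasPunctualBasis.exists_chart {m : ℕ} (hm : 1 ≤ m) {J : Ideal (A ⊗[ℂ] NodeRing)}
    (h : HasPunctualBasis A m J) (P : PrimeSpectrum A) :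
    ∃ p q : ℕ, m = p + q + 1 ∧ ∃ g : A, g ∉ P.asIdeal ∧
      ∀ (B : Type) [CommRing B] [Algebra ℂ B] [Algebra A B] [IsScalarTower ℂ A B],
        IsUnit (algebraMap A B g) →
          ∃ d c : B, IsChart p q d c ∧ baseIdeal B J = chartIdeal p q d c := by
  set K := P.asIdeal.ResidueField
  have hK := h.baseChange K
  obtain ⟨bK, -⟩ := id hK
  have hfin := Module.Finite.of_basis bK
  have hrank : Module.finrank K ((K ⊗[ℂ] NodeRing) ⧸ baseIdeal K J) = m := by
    rw [Module.finrank_eq_card_basis bK, Fintype.card_fin]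
  have hnt : Nontrivial ((K ⊗[ℂ] NodeRing) ⧸ baseIdeal K J) :=
    Module.nontrivial_of_finrank_pos (R := K) (by omega)
  have hx : tx K ^ m ∈ baseIdeal K J := hK.pow_mem nx_mem_maximalIdeal
  have hy : ty K ^ m ∈ baseIdeal K J := hK.pow_mem ny_mem_maximalIdeal
  obtain ⟨p, q, hpq, v, hv⟩ := exists_basis_branchMonomials (K := K)
    (x := Ideal.Quotient.mk (baseIdeal K J) (tx K)) (y := Ideal.Quotient.mk (baseIdeal K J) (ty K))
    ⟨m, by rw [← map_pow]; exact Ideal.Quotient.eq_zero_iff_mem.mpr hx⟩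
    ⟨m, by rw [← map_pow]; exact Ideal.Quotient.eq_zero_iff_mem.mpr hy⟩
    (by rw [← map_mul, tx_mul_ty, map_zero]) (span_powers_eq_top hx hy)
  rw [hrank] at hpq
  have hpq' := hpq.symm
  obtain ⟨b, hb⟩ := id h
  set e := b.reindex (monomialIndex hpq').symm
  set w : Fin (p + 1) ⊕ Fin q → (A ⊗[ℂ] NodeRing) ⧸ J :=
    branchMonomials p q (Ideal.Quotient.mk J (tx A)) (Ideal.Quotient.mk J (ty A))
  -- The determinant commutes with base change; this is used for the residue field and for the rings
  -- where it becomes a unit.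
  have hdet : ∀ (B : Type) [CommRing B] [Algebra ℂ B] [Algebra A B] [IsScalarTower ℂ A B],
      (baseBasis B e).det (branchMonomials p q (Ideal.Quotient.mk (baseIdeal B J) (tx B))
        (Ideal.Quotient.mk (baseIdeal B J) (ty B))) = algebraMap A B (e.det w) := by
    intro B _ _ _ _
    rw [Module.Basis.det_apply, Module.Basis.det_apply, RingHom.map_det]
    congr 1
    ext i s
    rw [Module.Basis.toMatrix_apply, RingHom.mapMatrix_apply, Matrix.map_apply,
      Module.Basis.toMatrix_apply, ← mk_monomialSeq hpq',
      ← famMap_one_tmul (IsScalarTower.toAlgHom ℂ A B), baseBasis_repr, mk_monomialSeq hpq']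
  refine ⟨p, q, hpq', e.det w, fun hmem => ?_, fun B _ _ _ _ hu => ?_⟩
  · have h1 := hdet K
    rw [Ideal.algebraMap_residueField_eq_zero.mpr hmem] at h1
    have h2 := (baseBasis K e).isUnit_det v
    rw [show (v : Fin (p + 1) ⊕ Fin q → _) = _ from funext hv, h1] at h2
    exact not_isUnit_zero h2
  · rw [← hdet B, ← Module.Basis.is_basis_iff_det] at hu
    exact (h.baseChange B).exists_eq_chartIdeal hpq' (Module.Basis.mk hu.1 hu.2.ge)
      (fun s => Module.Basis.mk_apply _ _ s)

/-- A neighbourhood inside `D(f)` is given by some `g` in `A_f`. Replacing `g` by its numerator `a`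
yields a principal open subset `D(fa)` of `Spec A` on which `g` is invertible. -/
theorem IsPunctualFamily.exists_chart {m : ℕ} (hm : 1 ≤ m) (h : IsPunctualFamily A m I)
    (P : PrimeSpectrum A) :
    ∃ f : A, f ∉ P.asIdeal ∧ ∃ p q : ℕ, m = p + q + 1 ∧ ∃ d c : Localization.Away f,
      IsChart p q d c ∧ baseIdeal (Localization.Away f) I = chartIdeal p q d c := by
  rw [isPunctualFamily_iff] at h
  obtain ⟨f, hf, hb⟩ := h P
  have hdisj : Disjoint (Submonoid.powers f : Set A) P.asIdeal := by
    rw [Set.disjoint_left]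
    rintro _ ⟨n, rfl⟩ hn
    exact hf (P.2.mem_of_pow_mem n hn)
  have hprime := IsLocalization.isPrime_of_isPrime_disjoint (Submonoid.powers f)
    (Localization.Away f) P.asIdeal P.2 hdisj
  obtain ⟨p, q, hpq, g, hg, H⟩ := hb.exists_chart hm ⟨_, hprime⟩
  obtain ⟨⟨a, s⟩, has⟩ := IsLocalization.surj (Submonoid.powers f) g
  have ha : a ∉ P.asIdeal := fun ha => by
    have h1 : g * algebraMap A (Localization.Away f) s ∈
        P.asIdeal.map (algebraMap A (Localization.Away f)) := by
      rw [has]; exact Ideal.mem_map_of_mem _ ha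
    rcases hprime.mem_or_mem h1 with h2 | h2
    · exact hg h2
    · exact hprime.ne_top (Ideal.eq_top_of_isUnit_mem _ h2 (IsLocalization.map_units _ s))
  refine ⟨f * a, fun hfa => (P.2.mem_or_mem hfa).elim hf ha, p, q, hpq, ?_⟩
  set B := Localization.Away (f * a)
  have hfa : IsUnit (algebraMap A B (f * a)) := IsLocalization.Away.algebraMap_isUnit _
  rw [map_mul] at hfa
  let ψ : Localization.Away f →+* B :=
    IsLocalization.Away.lift f (isUnit_of_mul_isUnit_left hfa)
  have hψ : ∀ x, ψ (algebraMap A _ x) = algebraMap A B x := fun x =>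
    IsLocalization.Away.lift_eq f _ x
  let _ : Algebra (Localization.Away f) B := ψ.toAlgebra
  have : IsScalarTower A (Localization.Away f) B :=
    IsScalarTower.of_algebraMap_eq fun x => (hψ x).symm
  have : IsScalarTower ℂ (Localization.Away f) B :=
    IsScalarTower.of_algebraMap_eq fun x => by
      rw [IsScalarTower.algebraMap_apply ℂ A B, IsScalarTower.algebraMap_apply ℂ A
        (Localization.Away f)]
      exact (hψ _).symm
  have hgu : IsUnit (algebraMap (Localization.Away f) B g) := by
    have h1 := congrArg (algebraMap (Localization.Away f) B) has
    rw [map_mul, ← IsScalarTower.algebraMap_apply, ← IsScalarTower.algebraMap_apply] at h1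
    exact isUnit_of_mul_isUnit_left (h1 ▸ isUnit_of_mul_isUnit_right hfa)
  obtain ⟨d, c, hdc, hI⟩ := H B hgu
  exact ⟨d, c, hdc, by rw [← hI, baseIdeal_baseIdeal]⟩

end LocalForm

end NodeHilb

end

noncomputable section

namespace NodeHilb

/-! ### Homogeneous coordinates on the chain -/

section Chain

variable {A : Type} [CommRing A]

/-- The equations of the chain of projective lines in homogeneous coordinates `z 1, …, z m`. -/
structure IsChain (m : ℕ) (z : ℕ → A) : Prop where
  mul_eq_zero : ∀ j k, j + 2 ≤ k → z j * z k = 0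
  zero : z 0 = 0
  large : ∀ k, m < k → z k = 0

/-- Homogeneous coordinates normalized to `1` at `i`. -/
def chartTuple (i : ℕ) (d c : A) (k : ℕ) : A :=
  if k = i then 1 else if k + 1 = i then d else if k = i + 1 then c else 0

@[simp] theorem chartTuple_self (i : ℕ) (d c : A) : chartTuple i d c i = 1 := if_pos rfl

@[simp] theorem chartTuple_succ (i : ℕ) (d c : A) : chartTuple i d c (i + 1) = c := by
  rw [chartTuple, if_neg (by omega), if_neg (by omega), if_pos rfl]

theorem chartTuple_pred {i : ℕ} (hi : 1 ≤ i) (d c : A) : chartTuple i d c (i - 1) = d := by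
  rw [chartTuple, if_neg (by omega), if_pos (by omega)]

theorem chartTuple_of_ne {i k : ℕ} (d c : A) (h1 : k ≠ i) (h2 : k + 1 ≠ i) (h3 : k ≠ i + 1) :
    chartTuple i d c k = 0 := by
  rw [chartTuple, if_neg h1, if_neg h2, if_neg h3]

/-- The coordinate equal to `1` sits at index `q + 1`. For `q = 0` the entry `d` falls on index `0`,
for `p = 0` the entry `c` falls on index `m + 1`; the chart conditions make them vanish. -/
theorem isChain_chartTuple {p q : ℕ} {d c : A} (h : IsChart p q d c) :
    IsChain (p + q + 1) (chartTuple (q + 1) d c) where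
  mul_eq_zero j k hjk := by
    simp only [chartTuple]
    split_ifs <;> first | omega | simp [h.mul_eq_zero]
  zero := by
    rcases eq_or_ne q 0 with hq | hq
    · rw [chartTuple, if_neg (by omega), if_pos (by omega), h.left hq]
    · rw [chartTuple, if_neg (by omega), if_neg (by omega), if_neg (by omega)]
  large k hk := by
    rcases eq_or_ne p 0 with hp | hp
    · simp only [chartTuple, h.right hp]
      split_ifs <;> first | omega | rfl
    · exact chartTuple_of_ne _ _ (by omega) (by omega) (by omega)

variable {m i : ℕ} {z : ℕ → A}

/-- A coordinate equal to `1` annihilates every coordinate that is not adjacent to it. -/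
theorem IsChain.eq_chartTuple (h : IsChain m z) (hi : z i = 1) :
    z = chartTuple i (z (i - 1)) (z (i + 1)) := by
  ext k
  simp only [chartTuple]
  split_ifs with h1 h2 h3
  · rw [h1, hi]
  · rw [← h2, Nat.add_sub_cancel]
  · rw [h3]
  · rcases lt_or_gt_of_ne h1 with hlt | hgt
    · simpa [hi] using h.mul_eq_zero k i (by omega)
    · simpa [hi] using h.mul_eq_zero i k (by omega)

theorem IsChain.isChart (h : IsChain m z) (hi : z i = 1) :
    IsChart (m - i) (i - 1) (z (i - 1)) (z (i + 1)) where
  mul_eq_zero := by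
    rcases Nat.eq_zero_or_pos i with rfl | h0
    · rw [show 0 - 1 = 0 from rfl, h.zero, zero_mul]
    · exact h.mul_eq_zero _ _ (by omega)
  left hq := by rw [hq, h.zero]
  right hp := h.large _ (by omega)

variable [Algebra ℂ A]

/-- The ideal with homogeneous coordinates `z`. -/
def chainIdeal (m : ℕ) (z : ℕ → A) : Ideal (A ⊗[ℂ] NodeRing) :=
  Ideal.span {t | ∃ k ≤ m, t = z k • ty A ^ k + z (k + 1) • tx A ^ (m - k)}

theorem map_chartTuple {B : Type} [CommRing B] [Algebra ℂ B] (φ : A →ₐ[ℂ] B) (i : ℕ) (d c : A) :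
    φ ∘ chartTuple i d c = chartTuple i (φ d) (φ c) := by
  ext k
  simp only [Function.comp_apply, chartTuple]
  split_ifs <;> simp

theorem IsChain.map {B : Type} [CommRing B] [Algebra ℂ B] (h : IsChain m z) (φ : A →ₐ[ℂ] B) :
    IsChain m (φ ∘ z) where
  mul_eq_zero j k hjk := by
    rw [Function.comp_apply, Function.comp_apply, ← map_mul, h.mul_eq_zero j k hjk, map_zero]
  zero := by rw [Function.comp_apply, h.zero, map_zero]
  large k hk := by rw [Function.comp_apply, h.large k hk, map_zero]

theorem chainIdeal_le_smul {u v : A} (huv : u * v = 1) :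
    chainIdeal m z ≤ chainIdeal m (fun k => u * z k) := by
  rw [chainIdeal, Ideal.span_le]
  rintro t ⟨k, hk, rfl⟩
  have h1 : (u * z k) • ty A ^ k + (u * z (k + 1)) • tx A ^ (m - k) ∈
      chainIdeal m (fun k => u * z k) := Ideal.subset_span ⟨k, hk, rfl⟩
  have h2 := Submodule.smul_of_tower_mem _ v h1
  rw [smul_add, smul_smul, smul_smul, ← mul_assoc, ← mul_assoc, mul_comm v, huv, one_mul,
    one_mul] at h2
  exact h2

theorem smul_chainIdeal_le (u : A) : chainIdeal m (fun k => u * z k) ≤ chainIdeal m z := by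
  rw [chainIdeal, Ideal.span_le]
  rintro t ⟨k, hk, rfl⟩
  have h1 : z k • ty A ^ k + z (k + 1) • tx A ^ (m - k) ∈ chainIdeal m z :=
    Ideal.subset_span ⟨k, hk, rfl⟩
  have h2 := Submodule.smul_of_tower_mem _ u h1
  rw [smul_add, smul_smul, smul_smul] at h2
  exact h2

theorem chainIdeal_smul {u v : A} (huv : u * v = 1) :
    chainIdeal m (fun k => u * z k) = chainIdeal m z :=
  le_antisymm (smul_chainIdeal_le u) (chainIdeal_le_smul huv)

theorem map_chainIdeal {B : Type} [CommRing B] [Algebra ℂ B] (φ : A →ₐ[ℂ] B) :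
    (chainIdeal m z).map (famMap φ) = chainIdeal m (φ ∘ z) := by
  rw [chainIdeal, Ideal.map_span, chainIdeal]
  congr 1
  ext t
  constructor
  · rintro ⟨_, ⟨k, hk, rfl⟩, rfl⟩
    exact ⟨k, hk, by simp only [map_add, famMap_smul, map_pow, famMap_tx, famMap_ty,
      Function.comp_apply]⟩
  · rintro ⟨k, hk, rfl⟩
    exact ⟨_, ⟨k, hk, rfl⟩, by simp only [map_add, famMap_smul, map_pow, famMap_tx, famMap_ty,
      Function.comp_apply]⟩

/-- The generators with index `i` and `i - 1` are those of the chart. The others reduce to multiples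
of `x^n` with `n ≥ p + 2` or `y^n` with `n ≥ q + 2`, where `p = m - i` and `q = i - 1`; these lie in
the chart ideal. -/
theorem IsChain.chainIdeal_eq (h : IsChain m z) (h1 : 1 ≤ i) (h2 : i ≤ m) (hi : z i = 1) :
    chainIdeal m z = chartIdeal (m - i) (i - 1) (z (i - 1)) (z (i + 1)) := by
  have hchart := h.isChart hi
  have e1 : i - 1 + 1 = i := by omega
  apply le_antisymm
  · rw [chainIdeal, Ideal.span_le]
    rintro t ⟨k, hk, rfl⟩
    rcases lt_trichotomy k i with hlt | rfl | hgt
    · rcases eq_or_lt_of_le (show k + 1 ≤ i from hlt) with rfl | hlt'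
      · refine Ideal.subset_span (Or.inr ?_)
        rw [hi, one_smul, add_comm, Nat.add_sub_cancel, show m - (k + 1) + 1 = m - k by omega]
        rfl
      · have hk0 : z k = 0 := by simpa [hi] using h.mul_eq_zero k i (by omega)
        rw [hk0, zero_smul, zero_add]
        exact Submodule.smul_of_tower_mem _ _
          (Ideal.pow_mem_of_pow_mem _ hchart.tx_pow_mem (by omega))
    · refine Ideal.subset_span (Or.inl ?_)
      rw [e1, hi, one_smul]
    · have hk0 : z (k + 1) = 0 := by simpa [hi] using h.mul_eq_zero i (k + 1) (by omega)
      rw [hk0, zero_smul, add_zero]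
      exact Submodule.smul_of_tower_mem _ _
        (Ideal.pow_mem_of_pow_mem _ hchart.ty_pow_mem (by omega))
  · rw [chartIdeal, Ideal.span_le]
    rintro t (rfl | rfl)
    · refine Ideal.subset_span ⟨i, h2, ?_⟩
      rw [e1, hi, one_smul]
    · refine Ideal.subset_span ⟨i - 1, by omega, ?_⟩
      rw [e1, hi, one_smul, add_comm, show m - (i - 1) = m - i + 1 by omega]

/-- The ideal determines the homogeneous coordinates up to a factor. -/
theorem IsChain.chainIdeal_le_iff (h : IsChain m z) (h1 : 1 ≤ i) (h2 : i ≤ m) (hi : z i = 1)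
    {w : ℕ → A} (hw : IsChain m w) :
    chainIdeal m w ≤ chainIdeal m z ↔ ∀ k, w k = w i * z k := by
  constructor
  · intro hle k
    have hgen : ∀ k ≤ m, w k • ty A ^ k + w (k + 1) • tx A ^ (m - k) ∈
        chartIdeal (m - i) (i - 1) (z (i - 1)) (z (i + 1)) := fun k hk => by
      rw [← h.chainIdeal_eq h1 h2 hi]
      exact hle (Ideal.subset_span ⟨k, hk, rfl⟩)
    -- Each generator of the ideal of `w` satisfies the linear equations of the chart; these give
    -- the proportionality one index at a time.
    simp only [(h.isChart hi).mem_iff, map_add, map_smul, smul_eq_mul, famX_tx_pow, famX_ty_pow,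
      famY_tx_pow, famY_ty_pow] at hgen
    rcases Nat.eq_zero_or_pos k with rfl | hk0
    · rw [hw.zero, h.zero, mul_zero]
    by_cases hkm : m < k
    · rw [hw.large k hkm, h.large k hkm, mul_zero]
    rcases lt_trichotomy k i with hlt | rfl | hgt
    · rcases eq_or_lt_of_le (show k + 1 ≤ i from hlt) with rfl | hlt'
      · have := (hgen k (by omega)).2.2.2
        rw [if_pos (by omega), if_neg (by omega), if_neg (by omega), if_pos (by omega)] at this
        simpa [mul_comm] using this
      · have hz : z k = 0 := by simpa [hi] using h.mul_eq_zero k i (by omega)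
        have := (hgen k (by omega)).2.1 k (by omega)
        rw [if_pos rfl, if_neg (by omega)] at this
        rw [hz, mul_zero]
        simpa using this
    · rw [hi, mul_one]
    · rcases eq_or_lt_of_le (show i + 1 ≤ k from hgt) with rfl | hlt'
      · have := (hgen i (by omega)).2.2.1
        rw [if_neg (by omega), if_pos (by omega), if_pos (by omega), if_neg (by omega)] at this
        simpa [mul_comm] using this
      · have hz : z k = 0 := by simpa [hi] using h.mul_eq_zero i k (by omega)
        have := (hgen (k - 1) (by omega)).1 (m - (k - 1)) (by omega)
        rw [if_pos rfl, if_neg (by omega), Nat.sub_add_cancel hk0] at this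
        rw [hz, mul_zero]
        simpa using this
  · intro hk
    rw [show w = fun k => w i * z k from funext hk]
    exact smul_chainIdeal_le _

/-- An inclusion is already an equality: proportionality at the index `j`, where `w j = 1`, makes
the factor `w i` a unit. -/
theorem IsChain.chainIdeal_eq_iff (h : IsChain m z) (h1 : 1 ≤ i) (h2 : i ≤ m) (hi : z i = 1)
    {w : ℕ → A} (hw : IsChain m w) {j : ℕ} (hj : w j = 1) :
    chainIdeal m w = chainIdeal m z ↔ ∀ k, w k = w i * z k := by
  rw [← h.chainIdeal_le_iff h1 h2 hi hw]
  refine ⟨fun h => h.le, fun hle => le_antisymm hle ?_⟩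
  have hk := (h.chainIdeal_le_iff h1 h2 hi hw).mp hle
  rw [show w = fun k => w i * z k from funext hk]
  exact chainIdeal_le_smul ((hk j).symm.trans hj)

/-- Containments between ideals of consecutive colengths. -/
theorem IsChain.chainIdeal_succ_le_iff (h : IsChain m z) (h1 : 1 ≤ i) (h2 : i ≤ m) (hi : z i = 1)
    {w : ℕ → A} (hw : IsChain (m + 1) w) :
    chainIdeal (m + 1) w ≤ chainIdeal m z ↔
      (∀ k, k ≠ i → k ≠ i + 1 → w k = 0) ∧ z (i + 1) * w i = 0 ∧ z (i - 1) * w (i + 1) = 0 := by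
  have hchart := h.isChart hi
  rw [h.chainIdeal_eq h1 h2 hi]
  constructor
  · intro hle
    have hgen : ∀ k ≤ m + 1, w k • ty A ^ k + w (k + 1) • tx A ^ (m + 1 - k) ∈
        chartIdeal (m - i) (i - 1) (z (i - 1)) (z (i + 1)) := fun k hk =>
      hle (Ideal.subset_span ⟨k, hk, rfl⟩)
    simp only [hchart.mem_iff, map_add, map_smul, smul_eq_mul, famX_tx_pow, famX_ty_pow,
      famY_tx_pow, famY_ty_pow] at hgen
    refine ⟨fun k hki hki' => ?_, ?_, ?_⟩
    · rcases Nat.eq_zero_or_pos k with rfl | hk0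
      · exact hw.zero
      by_cases hkm : m + 1 < k
      · exact hw.large k hkm
      rcases lt_or_gt_of_ne hki with hlt | hgt
      · rcases eq_or_lt_of_le (show k + 1 ≤ i from hlt) with rfl | hlt'
        · have := (hgen k (by omega)).2.2.2
          rw [if_pos (by omega), if_neg (by omega), if_neg (by omega), if_neg (by omega)] at this
          simpa using this
        · have := (hgen k (by omega)).2.1 k (by omega)
          rw [if_pos rfl, if_neg (by omega)] at this
          simpa using this
      · rcases eq_or_lt_of_le (show i + 2 ≤ k by omega) with rfl | hlt'
        · have := (hgen (i + 1) (by omega)).2.2.1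
          rw [if_neg (by omega), if_pos (by omega), if_neg (by omega), if_neg (by omega)] at this
          simpa using this
        · have := (hgen (k - 1) (by omega)).1 (m + 1 - (k - 1)) (by omega)
          rw [if_pos rfl, if_neg (by omega), Nat.sub_add_cancel hk0] at this
          simpa using this
    · have := (hgen i (by omega)).2.2.1
      rw [if_neg (by omega), if_neg (by omega), if_pos (by omega), if_neg (by omega)] at this
      simpa using this.symm
    · have := (hgen i (by omega)).2.2.2
      rw [if_neg (by omega), if_neg (by omega), if_neg (by omega), if_pos (by omega)] at this
      simpa using this.symm
  · rintro ⟨hk0, hc, hd⟩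
    rw [chainIdeal, Ideal.span_le]
    rintro t ⟨k, hk, rfl⟩
    have hx : ∀ n, m - i + 2 ≤ n → ∀ a : A, a • tx A ^ n ∈
        chartIdeal (m - i) (i - 1) (z (i - 1)) (z (i + 1)) := fun n hn a =>
      Submodule.smul_of_tower_mem _ _ (Ideal.pow_mem_of_pow_mem _ hchart.tx_pow_mem hn)
    have hy : ∀ n, i - 1 + 2 ≤ n → ∀ a : A, a • ty A ^ n ∈
        chartIdeal (m - i) (i - 1) (z (i - 1)) (z (i + 1)) := fun n hn a =>
      Submodule.smul_of_tower_mem _ _ (Ideal.pow_mem_of_pow_mem _ hchart.ty_pow_mem hn)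
    rcases lt_trichotomy k i with hlt | rfl | hgt
    · rw [hk0 k (by omega) (by omega), zero_smul, zero_add]
      exact hx _ (by omega) _
    · have g1 : ty A ^ k + z (k + 1) • tx A ^ (m - k) ∈
          chartIdeal (m - k) (k - 1) (z (k - 1)) (z (k + 1)) := by
        have e : k - 1 + 1 = k := Nat.sub_add_cancel h1
        have : ty A ^ (k - 1 + 1) + z (k + 1) • tx A ^ (m - k) ∈
          chartIdeal (m - k) (k - 1) (z (k - 1)) (z (k + 1)) := Ideal.subset_span (Or.inl rfl)
        rwa [e] at this
      have g2 : tx A ^ (m + 1 - k) + z (k - 1) • ty A ^ (k - 1) ∈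
          chartIdeal (m - k) (k - 1) (z (k - 1)) (z (k + 1)) := by
        rw [show m + 1 - k = m - k + 1 by omega]
        exact Ideal.subset_span (Or.inr rfl)
      -- In this combination of the chart generators the two unwanted terms have coefficients `z (k
      -- + 1) * w k` and `z (k - 1) * w (k + 1)`, both zero.
      have h3 := add_mem (Submodule.smul_of_tower_mem _ (w k) g1)
        (Submodule.smul_of_tower_mem _ (w (k + 1)) g2)
      rw [smul_add, smul_add, smul_smul, smul_smul, mul_comm (w k), hc, mul_comm (w (k + 1)), hd,
        zero_smul, zero_smul, add_zero, add_zero] at h3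
      exact h3
    · rw [hk0 (k + 1) (by omega) (by omega), zero_smul, add_zero]
      rcases eq_or_ne k (i + 1) with rfl | hne
      · exact hy _ (by omega) _
      · rw [hk0 k (by omega) (by omega), zero_smul]
        exact zero_mem _

end Chain

end NodeHilb

end

noncomputable section

namespace NodeHilb

/-! ### Ideals of finite colength -/

theorem isChain_chartTuple_zero {A : Type} [CommRing A] {m i : ℕ} (h1 : 1 ≤ i) (h2 : i ≤ m) {c : A}
    (hc : i = m → c = 0) : IsChain m (chartTuple i 0 c) := by
  have h : IsChart (m - i) (i - 1) 0 c := ⟨zero_mul _, fun _ => rfl, fun h => hc (by omega)⟩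
  have := isChain_chartTuple h
  rwa [show m - i + (i - 1) + 1 = m by omega, Nat.sub_add_cancel h1] at this

/-- The identification of `R` with `ℂ ⊗ R`. -/
def nodeEquiv : NodeRing ≃ₐ[ℂ] ℂ ⊗[ℂ] NodeRing := (Algebra.TensorProduct.lid ℂ NodeRing).symm

theorem nodeEquiv_apply (r : NodeRing) : nodeEquiv r = 1 ⊗ₜ r := rfl

/-- The ideal of `R` corresponding to an ideal of `ℂ ⊗ R`. -/
abbrev nodeIdeal (J : Ideal (ℂ ⊗[ℂ] NodeRing)) : Ideal NodeRing :=
  J.comap (Algebra.TensorProduct.includeRight : NodeRing →ₐ[ℂ] ℂ ⊗[ℂ] NodeRing)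

theorem nodeIdeal_le_nodeIdeal {J K : Ideal (ℂ ⊗[ℂ] NodeRing)} :
    nodeIdeal J ≤ nodeIdeal K ↔ J ≤ K := by
  refine ⟨fun h t ht => ?_, fun h => Ideal.comap_mono h⟩
  obtain ⟨r, rfl⟩ := nodeEquiv.surjective t
  exact h ht

theorem nodeIdeal_injective : Function.Injective nodeIdeal := fun _ _ h =>
  le_antisymm (nodeIdeal_le_nodeIdeal.mp h.le) (nodeIdeal_le_nodeIdeal.mp h.ge)

theorem nodeIdeal_map (I : Ideal NodeRing) : nodeIdeal (I.map nodeEquiv) = I :=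
  Ideal.comap_map_of_bijective (nodeEquiv : NodeRing →ₐ[ℂ] ℂ ⊗[ℂ] NodeRing) nodeEquiv.bijective

theorem nodeIdeal_chartIdeal (p q : ℕ) (d c : ℂ) :
    nodeIdeal (chartIdeal p q d c) =
      Ideal.span {ny ^ (q + 1) + c • nx ^ p, nx ^ (p + 1) + d • ny ^ q} := by
  have : chartIdeal p q d c = (Ideal.span {ny ^ (q + 1) + c • nx ^ p,
      nx ^ (p + 1) + d • ny ^ q}).map nodeEquiv := by
    rw [Ideal.map_span, Set.image_pair, chartIdeal]
    simp only [map_add, map_smul, map_pow, nodeEquiv_apply]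
    rfl
  rw [this, nodeIdeal_map]

theorem nodeIdeal_chainIdeal_zero {m i : ℕ} (h1 : 1 ≤ i) (h2 : i ≤ m) :
    nodeIdeal (chainIdeal m (chartTuple i 0 0)) = idealQ m i := by
  rw [(isChain_chartTuple_zero h1 h2 fun _ => rfl).chainIdeal_eq h1 h2 (chartTuple_self _ _ _),
    chartTuple_pred h1, chartTuple_succ, nodeIdeal_chartIdeal, zero_smul, zero_smul, add_zero,
    add_zero, Nat.sub_add_cancel h1, idealQ, Set.pair_comm]

theorem nodeIdeal_chainIdeal {m i : ℕ} (h1 : 1 ≤ i) (h2 : i ≤ m - 1) {a : ℂ} (ha : a ≠ 0) :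
    nodeIdeal (chainIdeal m (chartTuple i 0 a)) = idealI m i a := by
  rw [(isChain_chartTuple_zero h1 (by omega) (by omega)).chainIdeal_eq h1 (by omega)
    (chartTuple_self _ _ _), chartTuple_pred h1, chartTuple_succ, nodeIdeal_chartIdeal,
    zero_smul, add_zero, Nat.sub_add_cancel h1, idealI, Algebra.smul_def]
  apply le_antisymm
  · rw [Ideal.span_le]
    rintro t (rfl | rfl)
    · exact Ideal.subset_span rfl
    · have : nx ^ (m - i + 1) = algebraMap ℂ NodeRing a⁻¹ * nx *
          (ny ^ i + algebraMap ℂ NodeRing a * nx ^ (m - i)) := by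
        have h3 : nx * ny ^ i = 0 := by
          simpa using nx_pow_mul_ny_pow (a := 1) (b := i) one_ne_zero (by omega)
        have h4 : algebraMap ℂ NodeRing a⁻¹ * algebraMap ℂ NodeRing a = 1 := by
          rw [← map_mul, inv_mul_cancel₀ ha, map_one]
        linear_combination (- algebraMap ℂ NodeRing a⁻¹) * h3 - nx ^ (m - i + 1) * h4
      rw [this]
      exact Ideal.mul_mem_left _ _ (Ideal.subset_span rfl)
  · exact Ideal.span_mono (by simp)

/-! ### Classification of the ideals of finite colength. -/

/-- Normal forms of the homogeneous coordinates of a closed point. -/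
theorem IsChain.exists_normal_form {m i : ℕ} {z : ℕ → ℂ} (h : IsChain m z) (h1 : 1 ≤ i)
    (h2 : i ≤ m) (hi : z i = 1) :
    (∃ j a, 1 ≤ j ∧ j ≤ m - 1 ∧ a ≠ 0 ∧ chainIdeal m z = chainIdeal m (chartTuple j 0 a)) ∨
      ∃ j, 1 ≤ j ∧ j ≤ m ∧ chainIdeal m z = chainIdeal m (chartTuple j 0 0) := by
  have hz := h.eq_chartTuple hi
  by_cases hd : z (i - 1) = 0
  · rw [hd] at hz
    by_cases hc : z (i + 1) = 0
    · rw [hc] at hz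
      exact Or.inr ⟨i, h1, h2, by rw [← hz]⟩
    · refine Or.inl ⟨i, z (i + 1), h1, ?_, hc, by rw [← hz]⟩
      by_contra hlt
      exact hc (h.large _ (by omega))
  · have hi1 : 1 ≤ i - 1 := by
      by_contra hlt
      rw [show i - 1 = 0 by omega] at hd
      exact hd h.zero
    have hc : z (i + 1) = 0 := by
      have := h.mul_eq_zero (i - 1) (i + 1) (by omega)
      exact (_root_.mul_eq_zero.mp this).resolve_left hd
    -- Rescaling so that the coordinate at `i - 1` becomes `1` turns the coordinate at `i` into the
    -- inverse of `z (i - 1)`.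
    refine Or.inl ⟨i - 1, (z (i - 1))⁻¹, hi1, by omega, inv_ne_zero hd, ?_⟩
    rw [← chainIdeal_smul (m := m) (z := chartTuple (i - 1) 0 (z (i - 1))⁻¹)
      (mul_inv_cancel₀ hd)]
    congr 1
    rw [hz, hc, chartTuple_pred h1]
    ext k
    simp only [chartTuple]
    split_ifs <;> first | omega | simp [hd]

/-- The finite-dimensional quotient is artinian, so its Jacobson radical is nilpotent; since `R` is
local, the radical contains the image of the maximal ideal. -/
theorem HasColength.isNilpotent {I : Ideal NodeRing} {m : ℕ} (h : HasColength I m) {r : NodeRing}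
    (hr : r ∈ IsLocalRing.maximalIdeal NodeRing) : IsNilpotent (Ideal.Quotient.mk I r) := by
  have := h.1
  have : IsArtinianRing (NodeRing ⧸ I) := IsArtinianRing.of_finite ℂ _
  have hj : Ideal.Quotient.mk I r ∈ Ideal.jacobson (⊥ : Ideal (NodeRing ⧸ I)) := by
    rw [Ideal.mem_jacobson_bot]
    intro y
    obtain ⟨y, rfl⟩ := Ideal.Quotient.mk_surjective y
    rw [← map_mul, ← map_one (Ideal.Quotient.mk I), ← map_add]
    refine IsUnit.map _ ?_
    by_contra hu
    have h1 : r * y + 1 ∈ IsLocalRing.maximalIdeal NodeRing := hu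
    have h2 := Ideal.mul_mem_right y _ hr
    exact (Ideal.ne_top_iff_one _).mp (IsLocalRing.maximalIdeal.isMaximal NodeRing).ne_top
      (by simpa using sub_mem h1 h2)
  obtain ⟨n, hn⟩ := IsArtinianRing.isNilpotent_jacobson_bot (R := NodeRing ⧸ I)
  refine ⟨n, ?_⟩
  have := Ideal.pow_mem_pow hj n
  rwa [hn] at this

theorem baseIdeal_self {A : Type} [CommRing A] [Algebra ℂ A] (J : Ideal (A ⊗[ℂ] NodeRing)) :
    baseIdeal A J = J := by
  have : famMap (IsScalarTower.toAlgHom ℂ A A) = AlgHom.id ℂ (A ⊗[ℂ] NodeRing) :=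
    Algebra.TensorProduct.map_id
  rw [baseIdeal, this]
  exact Ideal.map_id J

/-- The quotient of `R` by an ideal, computed in `ℂ ⊗ R`. -/
def nodeQuotEquiv (J : Ideal (ℂ ⊗[ℂ] NodeRing)) :
    (NodeRing ⧸ nodeIdeal J) ≃ₐ[ℂ] (ℂ ⊗[ℂ] NodeRing) ⧸ J :=
  Ideal.quotientEquivAlg _ _ nodeEquiv (by
    exact (Ideal.map_comap_of_surjective (nodeEquiv : NodeRing →ₐ[ℂ] ℂ ⊗[ℂ] NodeRing)
      nodeEquiv.surjective J).symm)

theorem hasColength_nodeIdeal {m i : ℕ} {z : ℕ → ℂ} (h : IsChain m z) (h1 : 1 ≤ i) (h2 : i ≤ m)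
    (hi : z i = 1) : HasColength (nodeIdeal (chainIdeal m z)) m := by
  have b := (chartBasis (h.isChart hi) (m := m) (by omega))
  rw [← h.chainIdeal_eq h1 h2 hi] at b
  have b' := b.map (nodeQuotEquiv (chainIdeal m z)).symm.toLinearEquiv
  refine ⟨Module.Finite.of_basis b', ?_⟩
  rw [Module.finrank_eq_card_basis b', Fintype.card_fin]

/-- Over a field the condition on characteristic polynomials is automatic: nilpotent endomorphisms
have characteristic polynomial `T^m`. -/
theorem HasColength.hasPunctualBasis {J : Ideal (ℂ ⊗[ℂ] NodeRing)} {m : ℕ}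
    (h : HasColength (nodeIdeal J) m) : HasPunctualBasis ℂ m J := by
  have := h.1
  have hfin : Module.Finite ℂ ((ℂ ⊗[ℂ] NodeRing) ⧸ J) :=
    Module.Finite.equiv (nodeQuotEquiv J).toLinearEquiv
  have hrank : Module.finrank ℂ ((ℂ ⊗[ℂ] NodeRing) ⧸ J) = m := by
    rw [← h.2]
    exact (nodeQuotEquiv J).toLinearEquiv.finrank_eq.symm
  refine ⟨Module.finBasisOfFinrankEq ℂ _ hrank, fun r hr => ?_⟩
  rw [LinearMap.charpoly_toMatrix, ← hrank]
  refine (LinearMap.isNilpotent_iff_charpoly _).mp ?_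
  obtain ⟨n, hn⟩ := h.isNilpotent hr
  refine ⟨n, ?_⟩
  have h3 : Ideal.Quotient.mk J (1 ⊗ₜ r) ^ n = 0 := by
    have := congrArg (nodeQuotEquiv J) hn
    rw [map_pow, map_zero] at this
    exact this
  rw [mulQuot, LinearMap.pow_mulLeft, h3]
  exact LinearMap.mulLeft_zero_eq_zero _ _

theorem HasColength.exists_isChain {m : ℕ} (hm : 1 ≤ m) {J : Ideal (ℂ ⊗[ℂ] NodeRing)}
    (h : HasColength (nodeIdeal J) m) :
    ∃ (i : ℕ) (z : ℕ → ℂ), 1 ≤ i ∧ i ≤ m ∧ IsChain m z ∧ z i = 1 ∧ J = chainIdeal m z := by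
  -- Over `ℂ` the neighbourhood is everything, since `g` is a nonzero number.
  obtain ⟨p, q, hpq, g, hg, hB⟩ := h.hasPunctualBasis.exists_chart hm ⊥
  obtain ⟨d, c, hdc, hJ⟩ := hB ℂ (isUnit_iff_ne_zero.mpr hg)
  have hz := isChain_chartTuple hdc
  have hi := chartTuple_self (q + 1) d c
  refine ⟨q + 1, chartTuple (q + 1) d c, by omega, by omega, hpq ▸ hz, hi, ?_⟩
  rw [baseIdeal_self] at hJ
  rw [hJ, hpq, hz.chainIdeal_eq (by omega) (by omega) hi, chartTuple_succ,
    chartTuple_pred (by omega), show p + q + 1 - (q + 1) = p by omega, Nat.add_sub_cancel]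

/-- The classification of the ideals of finite colength. -/
theorem hasColength_iff {m : ℕ} (hm : 1 ≤ m) (I : Ideal NodeRing) : HasColength I m ↔
    (∃ i : ℕ, 1 ≤ i ∧ i ≤ m - 1 ∧ ∃ a : ℂ, a ≠ 0 ∧ I = idealI m i a) ∨
      ∃ i : ℕ, 1 ≤ i ∧ i ≤ m ∧ I = idealQ m i := by
  constructor
  · intro h
    rw [← nodeIdeal_map I] at h
    obtain ⟨i, z, h1, h2, hz, hi, hJ⟩ := h.exists_isChain hm
    rw [← nodeIdeal_map I, hJ]
    rcases hz.exists_normal_form h1 h2 hi with ⟨j, a, h3, h4, ha, hj⟩ | ⟨j, h3, h4, hj⟩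
    · exact Or.inl ⟨j, h3, h4, a, ha, by rw [hj, nodeIdeal_chainIdeal h3 h4 ha]⟩
    · exact Or.inr ⟨j, h3, h4, by rw [hj, nodeIdeal_chainIdeal_zero h3 h4]⟩
  · rintro (⟨i, h1, h2, a, ha, rfl⟩ | ⟨i, h1, h2, rfl⟩)
    · rw [← nodeIdeal_chainIdeal h1 h2 ha]
      exact hasColength_nodeIdeal (isChain_chartTuple_zero h1 (by omega) (by omega)) h1 (by omega)
        (chartTuple_self _ _ _)
    · rw [← nodeIdeal_chainIdeal_zero h1 h2]
      exact hasColength_nodeIdeal (isChain_chartTuple_zero h1 h2 (by simp)) h1 h2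
        (chartTuple_self _ _ _)

/-! ### Containments between ideals of consecutive colengths. -/

theorem chainIdeal_succ_le_chartTuple_iff {n j : ℕ} (h1 : 1 ≤ j) (h2 : j ≤ n) {b : ℂ}
    (hb : j = n → b = 0) {w : ℕ → ℂ} (hw : IsChain (n + 1) w) :
    chainIdeal (n + 1) w ≤ chainIdeal n (chartTuple j 0 b) ↔
      (∀ k, k ≠ j → k ≠ j + 1 → w k = 0) ∧ b * w j = 0 := by
  rw [(isChain_chartTuple_zero h1 h2 hb).chainIdeal_succ_le_iff h1 h2 (chartTuple_self _ _ _) hw,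
    chartTuple_succ, chartTuple_pred h1]
  simp

/-- The small ideal has nonzero coordinates exactly at `i` and `i + 1`. This forces `j = i` for the
large one, and then `b * w i = 0` forces `b = 0`. -/
theorem idealI_succ_le_iff {n i : ℕ} {a : ℂ} (h1 : 1 ≤ i) (h2 : i ≤ n) (ha : a ≠ 0)
    (J : Ideal NodeRing) :
    (HasColength J n ∧ idealI (n + 1) i a ≤ J) ↔ J = idealQ n i := by
  have hw : IsChain (n + 1) (chartTuple i 0 a) := isChain_chartTuple_zero h1 (by omega) (by omega)
  have hwi : chartTuple i 0 a (i + 1) ≠ 0 := by rwa [chartTuple_succ]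
  have hwi' : chartTuple i 0 a i ≠ 0 := by rw [chartTuple_self]; exact one_ne_zero
  have heq : ∀ j, (∀ k, k ≠ j → k ≠ j + 1 → chartTuple i 0 a k = 0) → i = j := fun j h5 => by
    by_contra hne
    by_cases h6 : i = j + 1
    · exact hwi (h5 (i + 1) (by omega) (by omega))
    · exact hwi' (h5 i hne h6)
  rw [hasColength_iff (by omega), ← nodeIdeal_chainIdeal h1 (m := n + 1) h2 ha]
  constructor
  · rintro ⟨⟨j, h3, h4, b, hb, rfl⟩ | ⟨j, h3, h4, rfl⟩, hle⟩
    · rw [← nodeIdeal_chainIdeal h3 h4 hb, nodeIdeal_le_nodeIdeal,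
        chainIdeal_succ_le_chartTuple_iff h3 (by omega) (by omega) hw] at hle
      obtain rfl := heq j hle.1
      simp [hb] at hle
    · rw [← nodeIdeal_chainIdeal_zero h3 h4, nodeIdeal_le_nodeIdeal,
        chainIdeal_succ_le_chartTuple_iff h3 (by omega) (by simp) hw] at hle
      rw [heq j hle.1]
  · rintro rfl
    refine ⟨Or.inr ⟨i, h1, h2, rfl⟩, ?_⟩
    rw [← nodeIdeal_chainIdeal_zero h1 h2, nodeIdeal_le_nodeIdeal,
      chainIdeal_succ_le_chartTuple_iff h1 h2 (by simp) hw]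
    exact ⟨fun k hk hk' => by simp [chartTuple, hk, hk'], zero_mul _⟩

/-- The only nonzero coordinate of the small ideal is at `i`, so `j` is `i` or `i - 1`. For `j = i`
the second coordinate `b` must vanish; for `j = i - 1` it is arbitrary. -/
theorem idealQ_succ_le_iff {n i : ℕ} (hn : 1 ≤ n) (h1 : 1 ≤ i) (h2 : i ≤ n + 1)
    (J : Ideal NodeRing) :
    (HasColength J n ∧ idealQ (n + 1) i ≤ J) ↔
      (2 ≤ i ∧ i ≤ n ∧ ∃ a : ℂ, a ≠ 0 ∧ J = idealI n (i - 1) a) ∨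
      (i ≤ n ∧ J = idealQ n i) ∨ (2 ≤ i ∧ J = idealQ n (i - 1)) := by
  have hw : IsChain (n + 1) (chartTuple i (0 : ℂ) 0) := isChain_chartTuple_zero h1 h2 (by simp)
  have hwi : chartTuple i (0 : ℂ) 0 i ≠ 0 := by rw [chartTuple_self]; exact one_ne_zero
  have hw0 : ∀ k, k ≠ i → chartTuple i (0 : ℂ) 0 k = 0 := fun k hk => by
    simp [chartTuple, hk]
  rw [hasColength_iff hn, ← nodeIdeal_chainIdeal_zero h1 h2]
  constructor
  · rintro ⟨⟨j, h3, h4, b, hb, rfl⟩ | ⟨j, h3, h4, rfl⟩, hle⟩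
    · rw [← nodeIdeal_chainIdeal h3 h4 hb, nodeIdeal_le_nodeIdeal,
        chainIdeal_succ_le_chartTuple_iff h3 (by omega) (by omega) hw] at hle
      have hne : i ≠ j := by
        rintro rfl
        simp [hb] at hle
      have hij : i = j + 1 := by
        by_contra h6
        exact hwi (hle.1 i hne h6)
      subst hij
      exact Or.inl ⟨by omega, by omega, b, hb, rfl⟩
    · rw [← nodeIdeal_chainIdeal_zero h3 h4, nodeIdeal_le_nodeIdeal,
        chainIdeal_succ_le_chartTuple_iff h3 (by omega) (by simp) hw] at hle
      by_cases hij : i = j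
      · exact Or.inr (Or.inl ⟨by omega, by rw [hij]⟩)
      · have hij : i = j + 1 := by
          by_contra h6
          exact hwi (hle.1 i hij h6)
        subst hij
        exact Or.inr (Or.inr ⟨by omega, rfl⟩)
  · rintro (⟨h3, h4, a, ha, rfl⟩ | ⟨h3, rfl⟩ | ⟨h3, rfl⟩)
    · refine ⟨Or.inl ⟨i - 1, by omega, by omega, a, ha, rfl⟩, ?_⟩
      rw [← nodeIdeal_chainIdeal (by omega) (by omega) ha, nodeIdeal_le_nodeIdeal,
        chainIdeal_succ_le_chartTuple_iff (by omega) (by omega) (by omega) hw]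
      exact ⟨fun k hk hk' => hw0 k (by omega), by rw [hw0 _ (by omega), mul_zero]⟩
    · refine ⟨Or.inr ⟨i, by omega, by omega, rfl⟩, ?_⟩
      rw [← nodeIdeal_chainIdeal_zero (by omega) (by omega), nodeIdeal_le_nodeIdeal,
        chainIdeal_succ_le_chartTuple_iff (by omega) (by omega) (by simp) hw]
      exact ⟨fun k hk hk' => hw0 k hk, zero_mul _⟩
    · refine ⟨Or.inr ⟨i - 1, by omega, by omega, rfl⟩, ?_⟩
      rw [← nodeIdeal_chainIdeal_zero (by omega) (by omega), nodeIdeal_le_nodeIdeal,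
        chainIdeal_succ_le_chartTuple_iff (by omega) (by omega) (by simp) hw]
      exact ⟨fun k hk hk' => hw0 k (by omega), zero_mul _⟩

end NodeHilb

end

noncomputable section

namespace NodeHilb

/-! ### The homogeneous coordinate ring of the chain -/

/-- The relations of the homogeneous coordinate ring. -/
def chainRelations (m : ℕ) : Ideal (MvPolynomial ℕ ℂ) :=
  Ideal.span ({p | ∃ j k, j + 2 ≤ k ∧ p = MvPolynomial.X j * MvPolynomial.X k} ∪
    {p | ∃ k, (k = 0 ∨ m < k) ∧ p = MvPolynomial.X k})

/-- The homogeneous coordinate ring of the chain of projective lines. -/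
def ChainRing (m : ℕ) : Type := MvPolynomial ℕ ℂ ⧸ chainRelations m

instance (m : ℕ) : CommRing (ChainRing m) :=
  inferInstanceAs (CommRing (MvPolynomial ℕ ℂ ⧸ chainRelations m))

instance (m : ℕ) : Algebra ℂ (ChainRing m) :=
  inferInstanceAs (Algebra ℂ (MvPolynomial ℕ ℂ ⧸ chainRelations m))

/-- The class of a polynomial in the homogeneous coordinates. -/
def chainMk (m : ℕ) : MvPolynomial ℕ ℂ →ₐ[ℂ] ChainRing m := Ideal.Quotient.mkₐ ℂ (chainRelations m)

theorem chainMk_eq_zero {m : ℕ} {p : MvPolynomial ℕ ℂ} (hp : p ∈ chainRelations m) :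
    chainMk m p = 0 := Ideal.Quotient.eq_zero_iff_mem.mpr hp

section ChainRing

variable {m : ℕ} {D : Type} [CommRing D]

theorem IsChain.smul {z : ℕ → D} (hz : IsChain m z) (u : D) : IsChain m fun k => u * z k where
  mul_eq_zero j k hjk := by rw [mul_mul_mul_comm, hz.mul_eq_zero j k hjk, mul_zero]
  zero := by rw [hz.zero, mul_zero]
  large k hk := by rw [hz.large k hk, mul_zero]

variable [Algebra ℂ D]

/-- The homogeneous coordinates. -/
def var (m k : ℕ) : ChainRing m := chainMk m (MvPolynomial.X k)

theorem isChain_var (m : ℕ) : IsChain m (var m) where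
  mul_eq_zero j k hjk := by
    rw [var, var, ← map_mul]
    exact chainMk_eq_zero (Ideal.subset_span (Or.inl ⟨j, k, hjk, rfl⟩))
  zero := chainMk_eq_zero (Ideal.subset_span (Or.inr ⟨0, Or.inl rfl, rfl⟩))
  large k hk :=
    chainMk_eq_zero (Ideal.subset_span (Or.inr ⟨k, Or.inr hk, rfl⟩))

/-- Evaluation of polynomials in the homogeneous coordinates. -/
def evalHom {z : ℕ → D} (hz : IsChain m z) : ChainRing m →ₐ[ℂ] D :=
  Ideal.Quotient.liftₐ _ (MvPolynomial.aeval z) (by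
    have : chainRelations m ≤ RingHom.ker (MvPolynomial.aeval (R := ℂ) z) := by
      rw [chainRelations, Ideal.span_le]
      rintro p (⟨j, k, hjk, rfl⟩ | ⟨k, hk, rfl⟩)
      · rw [SetLike.mem_coe, RingHom.mem_ker, map_mul, MvPolynomial.aeval_X, MvPolynomial.aeval_X,
          hz.mul_eq_zero j k hjk]
      · rw [SetLike.mem_coe, RingHom.mem_ker, MvPolynomial.aeval_X]
        rcases hk with rfl | hk
        exacts [hz.zero, hz.large k hk]
    exact fun p hp => this hp)

@[simp] theorem evalHom_var {z : ℕ → D} (hz : IsChain m z) (k : ℕ) :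
    evalHom hz (var m k) = z k :=
  MvPolynomial.aeval_X z k

theorem chainRing_algHom_ext {f g : ChainRing m →ₐ[ℂ] D} (h : ∀ k, f (var m k) = g (var m k)) :
    f = g :=
  Ideal.Quotient.algHom_ext _ (MvPolynomial.algHom_ext h)

theorem evalHom_comp {E : Type} [CommRing E] [Algebra ℂ E] {z : ℕ → D} (hz : IsChain m z)
    (φ : D →ₐ[ℂ] E) : φ.comp (evalHom hz) = evalHom (hz.map φ) :=
  chainRing_algHom_ext fun k => by simp

/-! ### The grading, constructed from the scaling coaction. -/

theorem isChain_X_mul_C (m : ℕ) : IsChain m fun k =>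
    (Polynomial.X * Polynomial.C (var m k) : Polynomial (ChainRing m)) :=
  ((isChain_var m).map (Polynomial.CAlgHom (R := ℂ) (A := ChainRing m))).smul Polynomial.X

/-- The coaction of the multiplicative group that defines the grading. -/
def degreeHom (m : ℕ) : ChainRing m →ₐ[ℂ] Polynomial (ChainRing m) :=
  evalHom (isChain_X_mul_C m)

theorem degreeHom_var (m k : ℕ) :
    degreeHom m (var m k) = Polynomial.monomial 1 (var m k) := by
  rw [degreeHom, evalHom_var, ← Polynomial.C_mul_X_eq_monomial]
  exact Polynomial.X_mul_C _

/-- The grading of the homogeneous coordinate ring. -/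
def chainGrading (m n : ℕ) : Submodule ℂ (ChainRing m) :=
  LinearMap.eqLocus (degreeHom m).toLinearMap
    ((Polynomial.monomial (R := ChainRing m) n).restrictScalars ℂ)

theorem mem_chainGrading {n : ℕ} {s : ChainRing m} :
    s ∈ chainGrading m n ↔ degreeHom m s = Polynomial.monomial n s := Iff.rfl

theorem var_mem (m k : ℕ) : var m k ∈ chainGrading m 1 := degreeHom_var m k

instance : SetLike.GradedMonoid (chainGrading m) where
  one_mem := by
    rw [mem_chainGrading, map_one]
    rfl
  mul_mem i j s t hs ht := by
    rw [mem_chainGrading] at *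
    rw [map_mul, hs, ht, Polynomial.monomial_mul_monomial]

/-- Evaluation of homogeneous elements at multiples. -/
theorem evalHom_smul {z : ℕ → D} (hz : IsChain m z) (u : D) {n : ℕ} {s : ChainRing m}
    (hs : s ∈ chainGrading m n) : evalHom (hz.smul u) s = u ^ n * evalHom hz s := by
  have h : evalHom (hz.smul u) =
      ((Polynomial.aeval u).restrictScalars ℂ).comp
        ((Polynomial.mapAlgHom (evalHom hz)).comp (degreeHom m)) :=
    chainRing_algHom_ext fun k => by simp [degreeHom_var, mul_comm]
  rw [h]
  simp [mem_chainGrading.mp hs, mul_comm]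

/-- The variables satisfy the chain relations in the direct sum of the graded pieces too; evaluation
at them is the decomposition map. -/
theorem isChain_of : IsChain m fun k =>
    DirectSum.of (fun i => chainGrading m i) 1 ⟨var m k, var_mem m k⟩ where
  mul_eq_zero j k hjk := by
    rw [DirectSum.of_mul_of]
    have : GradedMonoid.GMul.mul (A := fun i => chainGrading m i) ⟨var m j, var_mem m j⟩
        ⟨var m k, var_mem m k⟩ = 0 := Subtype.ext ((isChain_var m).mul_eq_zero j k hjk)
    rw [this, map_zero]
  zero := by
    have : (⟨var m 0, var_mem m 0⟩ : chainGrading m 1) = 0 := Subtype.ext (isChain_var m).zero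
    rw [this, map_zero]
  large k hk := by
    have : (⟨var m k, var_mem m k⟩ : chainGrading m 1) = 0 :=
      Subtype.ext ((isChain_var m).large k hk)
    rw [this, map_zero]

/-- The polynomial with given homogeneous coefficients. -/
def sumPolynomial (m : ℕ) : (DirectSum ℕ fun i => chainGrading m i) →ₐ[ℂ]
    Polynomial (ChainRing m) :=
  DirectSum.toAlgebra ℂ (fun i => chainGrading m i)
    (fun i => ((Polynomial.monomial (R := ChainRing m) i).restrictScalars ℂ).comp
      (chainGrading m i).subtype) rfl
    (fun _ _ => (Polynomial.monomial_mul_monomial _ _ _ _).symm)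

theorem sumPolynomial_of (i : ℕ) (s : chainGrading m i) :
    sumPolynomial m (DirectSum.of (fun i => chainGrading m i) i s) =
      Polynomial.monomial i (s : ChainRing m) := by
  exact DirectSum.toAddMonoid_of (fun i =>
    (((Polynomial.monomial (R := ChainRing m) i).restrictScalars ℂ).comp
      (chainGrading m i).subtype).toAddMonoidHom) i s

theorem coeff_sumPolynomial (v : DirectSum ℕ fun i => chainGrading m i) (j : ℕ) :
    (sumPolynomial m v).coeff j = v j := by
  induction v using DirectSum.induction_on with
  | zero => simp
  | of i s =>
    rw [sumPolynomial_of, Polynomial.coeff_monomial, DirectSum.coe_of_apply]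
    split_ifs <;> rfl
  | add v w hv hw => simp [hv, hw]

/-- The decomposition map followed by `sumPolynomial` is the coaction, since both agree on
variables. On a homogeneous element the coaction is a monomial, so the decomposition has a single
component. -/
instance : GradedAlgebra (chainGrading m) :=
  GradedAlgebra.ofAlgHom _ (evalHom isChain_of)
    (chainRing_algHom_ext fun k => by simp)
    (fun i s => by
      have h : (sumPolynomial m).comp (evalHom isChain_of) = degreeHom m :=
        chainRing_algHom_ext fun k => by
          rw [AlgHom.comp_apply, evalHom_var, sumPolynomial_of, degreeHom_var]
      have h2 : sumPolynomial m (evalHom isChain_of (s : ChainRing m)) =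
          sumPolynomial m (DirectSum.of (fun i => chainGrading m i) i s) := by
        rw [sumPolynomial_of, ← mem_chainGrading.mp s.2]
        exact DFunLike.congr_fun h (s : ChainRing m)
      ext j
      rw [← coeff_sumPolynomial, ← coeff_sumPolynomial, h2])

end ChainRing

end NodeHilb

end

noncomputable section

namespace NodeHilb

/-! ### Points of projective schemes -/

section ProjPoints

open HomogeneousLocalization

variable {S : Type} [CommRing S] [Algebra ℂ S] (𝒜 : ℕ → Submodule ℂ S) [GradedAlgebra 𝒜]

/-- The structure morphism of the projective spectrum of a graded `ℂ`-algebra. -/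
def projHom : Proj 𝒜 ⟶ Spec (.of ℂ) :=
  Proj.toSpecZero 𝒜 ≫ Spec.map (CommRingCat.ofHom (algebraMap ℂ (𝒜 0)))

instance awayAlgebra (F : S) : Algebra ℂ (Away 𝒜 F) where
  algebraMap := (fromZeroRingHom 𝒜 _).comp (algebraMap ℂ (𝒜 0))
  commutes' _ _ := mul_comm _ _
  smul_def' c x := by
    apply val_injective
    rw [val_smul, val_mul, Algebra.smul_def]
    rfl

theorem val_algebraMap (F : S) (c : ℂ) :
    (algebraMap ℂ (Away 𝒜 F) c).val = algebraMap S (Localization.Away F) (algebraMap ℂ S c) := rfl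

theorem awayι_projHom {F : S} {d : ℕ} (hF : F ∈ 𝒜 d) (hd : 0 < d) :
    Proj.awayι 𝒜 F hF hd ≫ projHom 𝒜 =
      Spec.map (CommRingCat.ofHom (algebraMap ℂ (Away 𝒜 F))) := by
  rw [projHom, Proj.awayι_toSpecZero_assoc, ← Spec.map_comp]
  rfl

variable {𝒜} {D : Type} [CommRing D] [Algebra ℂ D]

/-- Evaluation of homogeneous fractions. -/
def awayEval (e : S →ₐ[ℂ] D) {F : S} (hu : IsUnit (e F)) : Away 𝒜 F →ₐ[ℂ] D where
  toRingHom := (Localization.awayLift (e : S →+* D) F hu).comp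
    (algebraMap (Away 𝒜 F) (Localization.Away F))
  commutes' c := by
    change Localization.awayLift (e : S →+* D) F hu (algebraMap ℂ (Away 𝒜 F) c).val = _
    rw [val_algebraMap]
    exact (IsLocalization.Away.lift_eq (g := (e : S →+* D)) F hu _).trans (e.commutes c)

theorem awayEval_apply (e : S →ₐ[ℂ] D) {F : S} (hu : IsUnit (e F)) (x : Away 𝒜 F) :
    awayEval e hu x = Localization.awayLift (e : S →+* D) F hu x.val := rfl

theorem awayEval_mk (e : S →ₐ[ℂ] D) {F : S} (hu : IsUnit (e F)) {d : ℕ} (hF : F ∈ 𝒜 d) (n : ℕ)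
    (x : S) (hx : x ∈ 𝒜 (n • d)) : awayEval e hu (Away.mk 𝒜 hF n x hx) * e F ^ n = e x := by
  obtain ⟨v, hv⟩ := isUnit_iff_exists_inv.mp hu
  have h : awayEval e hu (Away.mk 𝒜 hF n x hx) = e x * v ^ n := by
    rw [awayEval_apply, Away.val_mk]
    exact Localization.awayLift_mk (e : S →+* D) F x v hv n
  rw [h, mul_assoc, ← mul_pow, mul_comm v, hv, one_pow, mul_one]

theorem awayEval_unique (e : S →ₐ[ℂ] D) {F : S} (hu : IsUnit (e F)) {d : ℕ} (hF : F ∈ 𝒜 d)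
    {ψ : Away 𝒜 F →ₐ[ℂ] D}
    (h : ∀ n x (hx : x ∈ 𝒜 (n • d)), ψ (Away.mk 𝒜 hF n x hx) * e F ^ n = e x) :
    ψ = awayEval e hu := by
  ext x
  obtain ⟨n, x, hx, rfl⟩ := Away.mk_surjective 𝒜 hF x
  exact (hu.pow n).mul_right_cancel ((h n x hx).trans (awayEval_mk e hu hF n x hx).symm)

theorem comp_awayEval {E : Type} [CommRing E] [Algebra ℂ E] (φ : D →ₐ[ℂ] E) (e : S →ₐ[ℂ] D) {F : S}
    (hu : IsUnit (e F)) {d : ℕ} (hF : F ∈ 𝒜 d) :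
    φ.comp (awayEval (𝒜 := 𝒜) e hu) = awayEval (φ.comp e) (hu.map φ) := by
  refine awayEval_unique _ _ hF fun n x hx => ?_
  rw [AlgHom.comp_apply, AlgHom.comp_apply, ← map_pow, ← map_mul, awayEval_mk, AlgHom.comp_apply]

/-- The point of a projective spectrum given by a homomorphism of the graded ring. -/
def homPoint (e : S →ₐ[ℂ] D) {F : S} {d : ℕ} (hF : F ∈ 𝒜 d) (hd : 0 < d) (hu : IsUnit (e F)) :
    Points (projHom 𝒜) D :=
  ⟨Spec.map (CommRingCat.ofHom (awayEval (𝒜 := 𝒜) e hu : Away 𝒜 F →+* D)) ≫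
      Proj.awayι 𝒜 F hF hd, by
    rw [Category.assoc, awayι_projHom, ← Spec.map_comp, ← CommRingCat.ofHom_comp,
      AlgHom.comp_algebraMap]⟩

theorem homPoint_map {E : Type} [CommRing E] [Algebra ℂ E] (φ : D →ₐ[ℂ] E) (e : S →ₐ[ℂ] D)
    {F : S} {d : ℕ} (hF : F ∈ 𝒜 d) (hd : 0 < d) (hu : IsUnit (e F)) :
    (homPoint e hF hd hu).map φ = homPoint (φ.comp e) hF hd (hu.map φ) := by
  apply Subtype.ext
  simp only [Points.map, homPoint]
  rw [← Category.assoc, ← Spec.map_comp, ← CommRingCat.ofHom_comp, ← comp_awayEval φ e hu hF]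
  rfl

/-- When `F` and `FG` are both units, evaluation of fractions over `F` factors through fractions
over `FG`. So the resulting point does not depend on the chart used to define it. -/
theorem homPoint_mul (e : S →ₐ[ℂ] D) {F G : S} {d d' : ℕ} (hF : F ∈ 𝒜 d) (hd : 0 < d)
    (hG : G ∈ 𝒜 d') (hd' : 0 < d + d') (hu : IsUnit (e F)) (hv : IsUnit (e (F * G))) :
    homPoint e hF hd hu = homPoint e (SetLike.mul_mem_graded hF hG) hd' hv := by
  apply Subtype.ext
  simp only [homPoint]
  rw [← Proj.SpecMap_awayMap_awayι 𝒜 hF hd hG rfl, ← Category.assoc, ← Spec.map_comp,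
    ← CommRingCat.ofHom_comp]
  congr 4
  ext x
  obtain ⟨n, x, hx, rfl⟩ := Away.mk_surjective 𝒜 hF x
  have h1 := awayEval_mk e hu hF n x hx
  refine (hv.pow n).mul_right_cancel ?_
  rw [RingHom.comp_apply, awayMap_mk]
  refine Eq.trans ?_ (awayEval_mk e hv (SetLike.mul_mem_graded hF hG) n _ _).symm
  rw [map_mul, map_mul, mul_pow, ← mul_assoc, map_pow]
  exact congrArg (· * e G ^ n) h1

theorem homPoint_eq (e : S →ₐ[ℂ] D) {F G : S} {d d' : ℕ} (hF : F ∈ 𝒜 d) (hd : 0 < d)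
    (hG : G ∈ 𝒜 d') (hd' : 0 < d') (hu : IsUnit (e F)) (hv : IsUnit (e G)) :
    homPoint e hF hd hu = homPoint e hG hd' hv := by
  have huv : IsUnit (e (F * G)) := by rw [map_mul]; exact hu.mul hv
  have hvu : IsUnit (e (G * F)) := by rw [map_mul]; exact hv.mul hu
  rw [homPoint_mul e hF hd hG (by omega) hu huv, homPoint_mul e hG hd' hF (by omega) hv hvu]
  simp only [mul_comm F G, add_comm d d']

theorem homPoint_injective {e e' : S →ₐ[ℂ] D} {F : S} {d : ℕ} {hF : F ∈ 𝒜 d} {hd : 0 < d}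
    {hu : IsUnit (e F)} {hu' : IsUnit (e' F)}
    (h : homPoint e hF hd hu = homPoint e' hF hd hu') :
    awayEval (𝒜 := 𝒜) e hu = awayEval e' hu' := by
  have h1 := congrArg Subtype.val h
  simp only [homPoint] at h1
  rw [cancel_mono] at h1
  have h2 := Spec.map_injective h1
  ext x
  exact DFunLike.congr_fun (congrArg CommRingCat.Hom.hom h2) x

theorem homPoint_congr {e e' : S →ₐ[ℂ] D} {F : S} {d : ℕ} (hF : F ∈ 𝒜 d) (hd : 0 < d)
    (hu : IsUnit (e F)) (hu' : IsUnit (e' F))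
    (h : awayEval (𝒜 := 𝒜) e hu = awayEval e' hu') :
    homPoint e hF hd hu = homPoint e' hF hd hu' := by
  apply Subtype.ext
  simp only [homPoint, h]

theorem homPoint_mem_basicOpen (e : S →ₐ[ℂ] D) {F G : S} {d d' : ℕ} (hF : F ∈ 𝒜 d) (hd : 0 < d)
    (hu : IsUnit (e F)) (hG : G ∈ 𝒜 d') (hd' : 0 < d') (p : Spec (.of D)) :
    (homPoint e hF hd hu).1 p ∈ Proj.basicOpen 𝒜 G ↔ e G ∉ p.asIdeal := by
  have h1 : (homPoint e hF hd hu).1 p ∈ Proj.basicOpen 𝒜 G ↔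
      Spec.map (CommRingCat.ofHom (awayEval (𝒜 := 𝒜) e hu : Away 𝒜 F →+* D)) p ∈
        Proj.awayι 𝒜 F hF hd ⁻¹ᵁ Proj.basicOpen 𝒜 G := by
    simp only [homPoint, Scheme.Hom.comp_apply]
    rfl
  rw [h1, Proj.awayι_preimage_basicOpen 𝒜 hF hd hG hd']
  -- The basic open set is cut out in the chart by `G^d / F^(d')`, whose value differs from a power
  -- of `e G` by a unit.
  have h2 := awayEval_mk e hu hF d' (G ^ d) (by
    rw [smul_eq_mul, mul_comm]; exact SetLike.pow_mem_graded d hG)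
  have h3 : awayEval (𝒜 := 𝒜) e hu (Away.isLocalizationElem hF hG) ∉ p.asIdeal ↔
      e G ∉ p.asIdeal := by
    rw [not_iff_not]
    have hu' : e F ^ d' ∉ p.asIdeal := fun h => p.isPrime.ne_top
      (Ideal.eq_top_of_isUnit_mem _ h (hu.pow d'))
    constructor
    · intro h
      have := Ideal.mul_mem_right (e F ^ d') _ h
      rw [show awayEval (𝒜 := 𝒜) e hu (Away.isLocalizationElem hF hG) * e F ^ d' = e (G ^ d)
        from h2, map_pow] at this
      exact p.isPrime.mem_of_pow_mem _ this
    · intro h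
      have : e (G ^ d) ∈ p.asIdeal := by
        rw [map_pow]
        exact Ideal.pow_mem_of_mem _ h _ hd
      rw [← h2] at this
      exact (p.isPrime.mem_or_mem this).resolve_right hu'
  exact h3

/-- A point in a basic open set is given by evaluation. -/
theorem exists_algHom_of_range_le (g : Points (projHom 𝒜) D) {F : S} {d : ℕ} (hF : F ∈ 𝒜 d)
    (hd : 0 < d) (hg : ∀ p, g.1 p ∈ Proj.basicOpen 𝒜 F) :
    ∃ ψ : Away 𝒜 F →ₐ[ℂ] D,
      g.1 = Spec.map (CommRingCat.ofHom (ψ : Away 𝒜 F →+* D)) ≫ Proj.awayι 𝒜 F hF hd := by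
  have hr : Set.range g.1 ⊆ Set.range (Proj.awayι 𝒜 F hF hd) := by
    rintro _ ⟨p, rfl⟩
    have := hg p
    rw [← Proj.opensRange_awayι 𝒜 F hF hd] at this
    exact this
  obtain ⟨ψ, hψ⟩ := Spec.map_surjective (IsOpenImmersion.lift (Proj.awayι 𝒜 F hF hd) g.1 hr)
  have h1 : Spec.map ψ ≫ Proj.awayι 𝒜 F hF hd = g.1 := by
    rw [hψ, IsOpenImmersion.lift_fac]
  have h2 : CommRingCat.ofHom (algebraMap ℂ (Away 𝒜 F)) ≫ ψ =
      CommRingCat.ofHom (algebraMap ℂ D) := by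
    apply Spec.map_injective
    rw [Spec.map_comp, ← awayι_projHom 𝒜 hF hd, ← Category.assoc, h1, g.2]
  refine ⟨{ ψ.hom with commutes' := fun c => ?_ }, h1.symm⟩
  exact DFunLike.congr_fun (congrArg CommRingCat.Hom.hom h2) c

end ProjPoints

end NodeHilb

end

noncomputable section

namespace NodeHilb

/-! ### Points of the chain of projective lines -/

section ChainPoints

open HomogeneousLocalization

variable {m : ℕ} {D : Type} [CommRing D] [Algebra ℂ D]

theorem chainMk_surjective (m : ℕ) : Function.Surjective (chainMk m) :=
  Ideal.Quotient.mk_surjective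

/-- The ring of functions on a standard chart of the chain. -/
abbrev ChartRing (m i : ℕ) : Type := Away (chainGrading m) (var m i)

/-- The affine coordinates on a standard chart of the chain. -/
def ratio (m i k : ℕ) : ChartRing m i :=
  Away.mk (chainGrading m) (var_mem m i) 1 (var m k) (by rw [one_smul]; exact var_mem m k)

/-- The inclusion of the homogeneous fractions into all fractions. -/
def chartVal (m i : ℕ) : ChartRing m i →ₐ[ℂ] Localization.Away (var m i) where
  toRingHom := algebraMap _ _
  commutes' _ := rfl

theorem chartVal_apply {i : ℕ} (x : ChartRing m i) : chartVal m i x = x.val := rfl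

theorem chartVal_injective (m i : ℕ) : Function.Injective (chartVal m i) := val_injective _

theorem chartVal_mk {i n : ℕ} {x : ChainRing m} (hx : x ∈ chainGrading m (n • 1)) :
    chartVal m i (Away.mk _ (var_mem m i) n x hx) =
      IsLocalization.Away.invSelf (S := Localization.Away (var m i)) (var m i) ^ n *
        algebraMap _ _ x := by
  rw [chartVal_apply, Away.val_mk, Localization.mk_eq_mk', IsLocalization.mk'_eq_iff_eq_mul]
  have h := IsLocalization.Away.mul_invSelf (S := Localization.Away (var m i)) (var m i)
  simp only [map_pow]
  linear_combination (-(algebraMap _ (Localization.Away (var m i)) x)) *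
    (congrArg (· ^ n) h).trans (one_pow n)

theorem chartVal_ratio (m i k : ℕ) : chartVal m i (ratio m i k) =
    IsLocalization.Away.invSelf (S := Localization.Away (var m i)) (var m i) *
      algebraMap _ _ (var m k) := by
  rw [ratio, chartVal_mk, pow_one]

theorem isChain_algebraMap_var (m i : ℕ) :
    IsChain m fun k => algebraMap (ChainRing m) (Localization.Away (var m i)) (var m k) :=
  (isChain_var m).map (Algebra.algHom ℂ (ChainRing m) (Localization.Away (var m i)))

theorem isChain_ratio (m i : ℕ) : IsChain m (ratio m i) := by
  have h := (isChain_algebraMap_var m i).smul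
    (IsLocalization.Away.invSelf (S := Localization.Away (var m i)) (var m i))
  constructor
  · intro j k hjk
    apply chartVal_injective
    rw [map_mul, chartVal_ratio, chartVal_ratio, h.mul_eq_zero j k hjk, map_zero]
  · apply chartVal_injective
    rw [chartVal_ratio, h.zero, map_zero]
  · intro k hk
    apply chartVal_injective
    rw [chartVal_ratio, h.large k hk, map_zero]

theorem ratio_self (m i : ℕ) : ratio m i i = 1 := by
  apply chartVal_injective
  rw [chartVal_ratio, map_one, mul_comm, IsLocalization.Away.mul_invSelf]

/-- Dividing a form of degree `n` by the `n`-th power of a variable is substituting the ratios of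
the variables. Hence the ratios generate the chart ring. -/
theorem mk_eq_evalHom_ratio {i n : ℕ} {x : ChainRing m} (hx : x ∈ chainGrading m (n • 1)) :
    Away.mk _ (var_mem m i) n x hx = evalHom (isChain_ratio m i) x := by
  apply chartVal_injective
  have h : (chartVal m i).comp (evalHom (isChain_ratio m i)) =
      evalHom ((isChain_algebraMap_var m i).smul
        (IsLocalization.Away.invSelf (S := Localization.Away (var m i)) (var m i))) :=
    chainRing_algHom_ext fun k => by
      rw [AlgHom.comp_apply, evalHom_var, evalHom_var, chartVal_ratio]
  have h2 : evalHom (isChain_algebraMap_var m i) =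
      Algebra.algHom ℂ (ChainRing m) (Localization.Away (var m i)) :=
    chainRing_algHom_ext fun k => by rw [evalHom_var]; rfl
  rw [← AlgHom.comp_apply, h, evalHom_smul (isChain_algebraMap_var m i) _ hx, h2, chartVal_mk, smul_eq_mul, mul_one]
  rfl

theorem chartRing_algHom_ext {i : ℕ} {φ ψ : ChartRing m i →ₐ[ℂ] D}
    (h : ∀ k, φ (ratio m i k) = ψ (ratio m i k)) : φ = ψ := by
  ext x
  obtain ⟨n, x, hx, rfl⟩ := Away.mk_surjective _ (var_mem m i) x
  rw [mk_eq_evalHom_ratio, ← AlgHom.comp_apply, ← AlgHom.comp_apply]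
  congr 1
  exact chainRing_algHom_ext fun k => by simpa using h k

variable {z w : ℕ → D} {i j : ℕ}

theorem isUnit_evalHom_var (hz : IsChain m z) (hi : IsUnit (z i)) :
    IsUnit (evalHom hz (var m i)) := by
  rwa [evalHom_var]

theorem awayEval_ratio (hz : IsChain m z) (hi : IsUnit (z i)) (k : ℕ) :
    awayEval (evalHom hz) (isUnit_evalHom_var hz hi) (ratio m i k) * z i = z k := by
  have := awayEval_mk (evalHom hz) (isUnit_evalHom_var hz hi) (var_mem m i) 1 (var m k)
    (by rw [one_smul]; exact var_mem m k)
  rwa [pow_one, evalHom_var, evalHom_var] at this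

/-- The point with homogeneous coordinates `z`. -/
def chainPoint (hz : IsChain m z) (hi : IsUnit (z i)) : Points (projHom (chainGrading m)) D :=
  homPoint (evalHom hz) (var_mem m i) one_pos (isUnit_evalHom_var hz hi)

theorem chainPoint_map {E : Type} [CommRing E] [Algebra ℂ E] (hz : IsChain m z) (hi : IsUnit (z i))
    (φ : D →ₐ[ℂ] E) :
    (chainPoint hz hi).map φ = chainPoint (i := i) (hz.map φ) (hi.map φ) := by
  simp only [chainPoint, homPoint_map, evalHom_comp]

theorem chainPoint_mem_basicOpen (hz : IsChain m z) (hi : IsUnit (z i)) (k : ℕ)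
    (p : Spec (.of D)) :
    (chainPoint hz hi).1 p ∈ Proj.basicOpen (chainGrading m) (var m k) ↔ z k ∉ p.asIdeal := by
  rw [chainPoint, homPoint_mem_basicOpen _ _ _ _ (var_mem m k) one_pos, evalHom_var]

theorem chainPoint_eq_chainPoint (hz : IsChain m z) (hi : IsUnit (z i)) (hj : IsUnit (z j)) :
    chainPoint hz hi = chainPoint hz hj :=
  homPoint_eq _ _ _ _ _ _ _

theorem chainPoint_congr (hz : IsChain m z) (hi : IsUnit (z i)) (hw : IsChain m w)
    (hi' : IsUnit (w i)) (h : ∀ k, w k * z i = w i * z k) :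
    chainPoint hz hi = chainPoint hw hi' := by
  refine homPoint_congr _ _ _ _ (chartRing_algHom_ext fun k => ?_)
  refine (hi.mul hi').mul_right_cancel ?_
  rw [← mul_assoc, awayEval_ratio hz hi, mul_comm (z i), ← mul_assoc, awayEval_ratio hw hi', h,
    mul_comm]

/-- Two points agree if and only if their coordinates are proportional. -/
theorem chainPoint_eq_iff (hz : IsChain m z) (hi : z i = 1) (hw : IsChain m w) (hj : w j = 1) :
    chainPoint (i := j) hw (hj ▸ isUnit_one) = chainPoint (i := i) hz (hi ▸ isUnit_one) ↔
      ∀ k, w k = w i * z k := by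
  have hiu : IsUnit (z i) := hi ▸ isUnit_one
  have hju : IsUnit (w j) := hj ▸ isUnit_one
  constructor
  · intro h k
    have hwi : IsUnit (w i) := by
      -- Otherwise `w i` lies in a maximal ideal. At that closed point the first description puts
      -- the image outside the chart `i`, while `z i = 1` puts it inside.
      by_contra hwi
      obtain ⟨M, hM, hwM⟩ := exists_max_ideal_of_mem_nonunits hwi
      let p : Spec (.of D) := ⟨M, hM.isPrime⟩
      have h1 := (chainPoint_mem_basicOpen hz hiu i p).mpr (by
        rw [hi]; exact (Ideal.ne_top_iff_one _).mp hM.ne_top)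
      rw [← h, chainPoint_mem_basicOpen] at h1
      exact h1 hwM
    rw [chainPoint_eq_chainPoint hw hju hwi] at h
    have h1 := DFunLike.congr_fun (homPoint_injective h) (ratio m i k)
    have h2 := awayEval_ratio hw hwi k
    have h3 := awayEval_ratio hz hiu k
    rw [hi, mul_one] at h3
    rw [h1, h3] at h2
    rw [← h2, mul_comm]
  · intro h
    have hwi : IsUnit (w i) := IsUnit.of_mul_eq_one _ ((h j).symm.trans hj)
    rw [chainPoint_eq_chainPoint hw hju hwi]
    exact (chainPoint_congr hz hiu hw hwi fun k => by rw [hi, mul_one, h k]).symm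

/-- The standard charts cover the chain. -/
theorem exists_mem_basicOpen (x : Proj (chainGrading m)) :
    ∃ i, 1 ≤ i ∧ i ≤ m ∧ x ∈ Proj.basicOpen (chainGrading m) (var m i) := by
  have h : ⨆ i, Proj.basicOpen (chainGrading m) (var m i) = ⊤ := by
    refine Proj.iSup_basicOpen_eq_top' _ _ (fun i => ⟨1, var_mem m i⟩) ?_
    rw [eq_top_iff]
    rintro s -
    obtain ⟨p, rfl⟩ := chainMk_surjective m s
    induction p using MvPolynomial.induction_on with
    | C c =>
      exact Subalgebra.algebraMap_mem _ (algebraMap ℂ (chainGrading m 0) c)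
    | add p q hp hq => rw [map_add]; exact add_mem hp hq
    | mul_X p k hp =>
      rw [map_mul]
      exact mul_mem hp (Algebra.subset_adjoin ⟨k, rfl⟩)
  have hx : x ∈ ⨆ i, Proj.basicOpen (chainGrading m) (var m i) := h ▸ trivial
  obtain ⟨i, hi⟩ := TopologicalSpace.Opens.mem_iSup.mp hx
  refine ⟨i, ?_, ?_, hi⟩
  · by_contra h0
    rw [show i = 0 by omega, (isChain_var m).zero, Proj.basicOpen_zero] at hi
    exact hi
  · by_contra h0
    rw [(isChain_var m).large i (by omega), Proj.basicOpen_zero] at hi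
    exact hi

/-- A point in a standard chart is given by homogeneous coordinates. -/
theorem exists_eq_chainPoint (g : Points (projHom (chainGrading m)) D) (i : ℕ)
    (hg : ∀ p, g.1 p ∈ Proj.basicOpen (chainGrading m) (var m i)) :
    ∃ (z : ℕ → D) (hz : IsChain m z) (hi : z i = 1), g = chainPoint (i := i) hz (hi ▸ isUnit_one) := by
  obtain ⟨ψ, hψ⟩ := exists_algHom_of_range_le g (var_mem m i) one_pos hg
  have hz := (isChain_ratio m i).map ψ
  have hi : (ψ ∘ ratio m i) i = 1 := by rw [Function.comp_apply, ratio_self, map_one]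
  have hu : IsUnit ((ψ ∘ ratio m i) i) := hi ▸ isUnit_one
  refine ⟨ψ ∘ ratio m i, hz, hi, Subtype.ext ?_⟩
  have : ψ = awayEval (evalHom hz) (isUnit_evalHom_var hz hu) := chartRing_algHom_ext fun k => by
    have := awayEval_ratio hz hu k
    rw [hi, mul_one] at this
    rw [this, Function.comp_apply]
  rw [hψ]
  simp only [chainPoint, homPoint]
  rw [← this]

/-- Every point is locally given by homogeneous coordinates. -/
theorem exists_local_chainPoint (g : Points (projHom (chainGrading m)) D) (p : PrimeSpectrum D) :
    ∃ f : D, f ∉ p.asIdeal ∧ ∃ (i : ℕ) (z : ℕ → Localization.Away f) (hz : IsChain m z)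
      (hi : z i = 1), 1 ≤ i ∧ i ≤ m ∧
        g.map (IsScalarTower.toAlgHom ℂ D (Localization.Away f)) =
          chainPoint (i := i) hz (hi ▸ isUnit_one) := by
  obtain ⟨i, h1, h2, hi⟩ := exists_mem_basicOpen (g.1 p)
  have hU := (g.1 ⁻¹ᵁ Proj.basicOpen (chainGrading m) (var m i)).2
  obtain ⟨_, ⟨f, rfl⟩, hf, hle⟩ :=
    PrimeSpectrum.isTopologicalBasis_basic_opens.exists_subset_of_mem_open
      (show p ∈ g.1 ⁻¹ᵁ Proj.basicOpen (chainGrading m) (var m i) from hi) hU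
  obtain ⟨z, hz, hzi, hgz⟩ := exists_eq_chainPoint
    (g.map (IsScalarTower.toAlgHom ℂ D (Localization.Away f))) i (fun q => by
      exact hle ((PrimeSpectrum.localization_away_comap_range (Localization.Away f) f).le
        ⟨q, rfl⟩))
  exact ⟨f, hf, i, z, hz, hzi, h1, h2, hgz⟩

end ChainPoints

end NodeHilb

end

noncomputable section

namespace NodeHilb

/-! ### Localization and gluing of ideals -/

section GlueIdeal

variable {A : Type} [CommRing A]

theorem span_range_eq_top_of_forall {ι : Type*} {f : ι → A}
    (h : ∀ p : PrimeSpectrum A, ∃ k, f k ∉ p.asIdeal) : Ideal.span (Set.range f) = ⊤ := by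
  by_contra hne
  obtain ⟨M, hM, hle⟩ := Ideal.exists_le_maximal _ hne
  obtain ⟨k, hk⟩ := h ⟨M, hM.isPrime⟩
  exact hk (hle (Ideal.subset_span ⟨k, rfl⟩))

variable [Algebra ℂ A]

/-- The localization homomorphism. -/
abbrev locHom (f : A) : A →ₐ[ℂ] Localization.Away f :=
  IsScalarTower.toAlgHom ℂ A (Localization.Away f)

theorem exists_locHom_comp {B : Type} [CommRing B] [Algebra ℂ B] (φ : A →ₐ[ℂ] B) {f : A}
    (hf : IsUnit (φ f)) : ∃ χ : Localization.Away f →ₐ[ℂ] B, χ.comp (locHom f) = φ :=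
  ⟨IsLocalization.Away.liftAlgHom f hf, by
    ext a
    exact IsLocalization.Away.lift_eq (g := (φ : A →+* B)) f hf a⟩

theorem isUnit_locHom (f : A) : IsUnit (locHom f f) :=
  IsLocalization.Away.algebraMap_isUnit f

/-- The quotient by the extended ideal is the localization of the quotient, and a class that dies
there is killed by a power of `f`. -/
theorem exists_pow_smul_mem {I : Ideal (A ⊗[ℂ] NodeRing)} {f : A} {t : A ⊗[ℂ] NodeRing}
    (h : famMap (locHom f) t ∈ baseIdeal (Localization.Away f) I) : ∃ n : ℕ, f ^ n • t ∈ I := by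
  have h1 : baseQuotEquiv (Localization.Away f) I (1 ⊗ₜ Ideal.Quotient.mk I t) = 0 := by
    rw [baseQuotEquiv_tmul, one_smul]
    exact Ideal.Quotient.eq_zero_iff_mem.mpr h
  rw [EmbeddingLike.map_eq_zero_iff] at h1
  obtain ⟨⟨_, n, rfl⟩, hs⟩ := (IsLocalizedModule.eq_zero_iff (Submonoid.powers f)
    (TensorProduct.mk A (Localization.Away f) ((A ⊗[ℂ] NodeRing) ⧸ I) 1)).mp h1
  exact ⟨n, Ideal.Quotient.eq_zero_iff_mem.mp hs⟩

theorem exists_pow_smul_eq (f : A) (t : Localization.Away f ⊗[ℂ] NodeRing) :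
    ∃ (n : ℕ) (s : A ⊗[ℂ] NodeRing), (locHom f f) ^ n • t = famMap (locHom f) s := by
  induction t with
  | zero => exact ⟨0, 0, by simp⟩
  | tmul a r =>
    obtain ⟨n, b, hb⟩ := IsLocalization.Away.surj f a
    refine ⟨n, b ⊗ₜ r, ?_⟩
    rw [famMap, Algebra.TensorProduct.map_tmul, TensorProduct.smul_tmul', smul_eq_mul, mul_comm]
    exact congrArg (· ⊗ₜ r) hb
  | add t u ht hu =>
    obtain ⟨n, s, hs⟩ := ht
    obtain ⟨k, v, hv⟩ := hu
    refine ⟨n + k, f ^ k • s + f ^ n • v, ?_⟩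
    rw [map_add, famMap_smul, famMap_smul, ← hs, ← hv, map_pow, map_pow, smul_smul, smul_smul,
      smul_add, pow_add, mul_comm]

theorem ideal_le_of_local {I J : Ideal (A ⊗[ℂ] NodeRing)}
    (h : ∀ p : PrimeSpectrum A, ∃ f : A, f ∉ p.asIdeal ∧
      baseIdeal (Localization.Away f) I ≤ baseIdeal (Localization.Away f) J) : I ≤ J := by
  choose f hf hle using h
  intro t ht
  refine Submodule.mem_of_span_eq_top_of_smul_pow_mem (J.restrictScalars A) (Set.range f)
    (span_range_eq_top_of_forall fun p => ⟨p, hf p⟩) t ?_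
  rintro ⟨_, p, rfl⟩
  exact exists_pow_smul_mem (hle p (Ideal.mem_map_of_mem _ ht))

theorem ideal_eq_of_local {I J : Ideal (A ⊗[ℂ] NodeRing)}
    (h : ∀ p : PrimeSpectrum A, ∃ f : A, f ∉ p.asIdeal ∧
      baseIdeal (Localization.Away f) I = baseIdeal (Localization.Away f) J) : I = J :=
  le_antisymm
    (ideal_le_of_local fun p => (h p).imp fun _ hf => ⟨hf.1, hf.2.le⟩)
    (ideal_le_of_local fun p => (h p).imp fun _ hf => ⟨hf.1, hf.2.ge⟩)

/-- Ideals over the members of a finite cover that agree on the overlaps come from an ideal. -/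
theorem exists_glued_ideal {ι : Type} [Finite ι] (f : ι → A)
    (J : ∀ k, Ideal (Localization.Away (f k) ⊗[ℂ] NodeRing))
    (hJ : ∀ (k l : ι) (E : Type) [CommRing E] [Algebra ℂ E]
      (φ : Localization.Away (f k) →ₐ[ℂ] E) (ψ : Localization.Away (f l) →ₐ[ℂ] E),
      φ.comp (locHom (f k)) = ψ.comp (locHom (f l)) →
        (J k).map (famMap φ) = (J l).map (famMap ψ)) :
    ∃ I : Ideal (A ⊗[ℂ] NodeRing), ∀ k, baseIdeal (Localization.Away (f k)) I = J k := by
  cases nonempty_fintype ι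
  -- The glued ideal consists of the elements that lie in every given ideal locally.
  refine ⟨⨅ l, (J l).comap (famMap (locHom (f l))), fun k => le_antisymm ?_ ?_⟩
  · rw [baseIdeal, Ideal.map_le_iff_le_comap]
    exact iInf_le _ k
  · intro t ht
    obtain ⟨n, s, hs⟩ := exists_pow_smul_eq (f k) t
    have hsk : famMap (locHom (f k)) s ∈ J k := by
      rw [← hs]
      exact Submodule.smul_of_tower_mem _ _ ht
    -- On the overlap the two ideals agree, so over the `l`-th set the section lies in `J l` after
    -- multiplication by a power of `f k`. Finiteness of the cover gives a common exponent.
    have hloc : ∀ l, ∃ N : ℕ, (locHom (f l) (f k)) ^ N • famMap (locHom (f l)) s ∈ J l := by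
      intro l
      refine exists_pow_smul_mem ?_
      obtain ⟨φ, hφ⟩ := exists_locHom_comp
        ((locHom (locHom (f l) (f k))).comp (locHom (f l))) (isUnit_locHom _)
      have := hJ k l _ φ (locHom (locHom (f l) (f k))) hφ
      rw [baseIdeal, ← this, ← famMap_comp, ← hφ, famMap_comp]
      exact Ideal.mem_map_of_mem _ hsk
    choose N hN using hloc
    have hmem : (f k) ^ (∑ l, N l) • s ∈ ⨅ l, (J l).comap (famMap (locHom (f l))) := by
      rw [Ideal.mem_iInf]
      intro l
      rw [Ideal.mem_comap, famMap_smul, map_pow,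
        ← Nat.sub_add_cancel (Finset.single_le_sum (fun _ _ => Nat.zero_le _)
          (Finset.mem_univ l) : N l ≤ ∑ l, N l), pow_add, mul_smul]
      exact Submodule.smul_of_tower_mem _ _ (hN l)
    have h1 := Ideal.mem_map_of_mem (famMap (locHom (f k))) hmem
    rw [famMap_smul, map_pow, ← hs, smul_smul, ← pow_add] at h1
    obtain ⟨v, hv⟩ := ((isUnit_locHom (f k)).pow (∑ l, N l + n)).exists_left_inv
    have h2 := Submodule.smul_of_tower_mem _ v h1
    rwa [smul_smul, hv, one_smul] at h2

end GlueIdeal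

end NodeHilb

end

noncomputable section

namespace NodeHilb

/-! ### The chain represents the functor of punctual families -/

theorem Points.map_map {X : Scheme.{0}} {π : X ⟶ Spec (.of ℂ)} {A B C : Type} [CommRing A]
    [Algebra ℂ A] [CommRing B] [Algebra ℂ B] [CommRing C] [Algebra ℂ C] (g : Points π A)
    (φ : A →ₐ[ℂ] B) (ψ : B →ₐ[ℂ] C) : (g.map φ).map ψ = g.map (ψ.comp φ) := by
  apply Subtype.ext
  simp only [Points.map]
  rw [← Category.assoc, ← Spec.map_comp]
  rfl

/-! ### Gluing of points of a scheme over a cover of the base. -/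

section GluePoints

variable {X : Scheme.{0}} {π : X ⟶ Spec (.of ℂ)} {A : Type} [CommRing A] [Algebra ℂ A]

theorem Points.ext_of_local {g g' : Points π A}
    (h : ∀ p : PrimeSpectrum A, ∃ f : A, f ∉ p.asIdeal ∧
      g.map (locHom f) = g'.map (locHom f)) : g = g' := by
  choose f hf hg using h
  apply Subtype.ext
  refine (Scheme.affineOpenCoverOfSpanRangeEqTop (R := .of A) f
    (span_range_eq_top_of_forall fun p => ⟨p, hf p⟩)).openCover.hom_ext _ _ fun p => ?_
  exact congrArg Subtype.val (hg p)

/-- The fibre product of the two spectra is the spectrum of `B ⊗[A] C`, so the compatibility is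
needed for this one ring only. -/
theorem Points.overlap_eq {B C : Type} [CommRing B] [Algebra ℂ B] [Algebra A B]
    [IsScalarTower ℂ A B] [CommRing C] [Algebra ℂ C] [Algebra A C] [IsScalarTower ℂ A C]
    (g : Points π B) (h : Points π C)
    (hgh : ∀ (E : Type) [CommRing E] [Algebra ℂ E] (φ : B →ₐ[ℂ] E) (ψ : C →ₐ[ℂ] E),
      φ.comp (IsScalarTower.toAlgHom ℂ A B) = ψ.comp (IsScalarTower.toAlgHom ℂ A C) →
        g.map φ = h.map ψ) :
    Limits.pullback.fst (Spec.map (CommRingCat.ofHom (algebraMap A B)))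
        (Spec.map (CommRingCat.ofHom (algebraMap A C))) ≫ g.1 =
      Limits.pullback.snd _ _ ≫ h.1 := by
  have h1 := hgh (B ⊗[A] C) Algebra.TensorProduct.includeLeft
    (Algebra.TensorProduct.includeRight.restrictScalars ℂ) (by
      ext a
      exact ((Algebra.TensorProduct.includeLeft (R := A) (S := A) (A := B) (B := C)).commutes
        a).trans ((Algebra.TensorProduct.includeRight (R := A) (A := B) (B := C)).commutes a).symm)
  rw [← cancel_epi (pullbackSpecIso A B C).inv, ← Category.assoc, ← Category.assoc,
    pullbackSpecIso_inv_fst, pullbackSpecIso_inv_snd]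
  exact congrArg Subtype.val h1

theorem Points.exists_glued {ι : Type} (f : ι → A) (hf : Ideal.span (Set.range f) = ⊤)
    (g : ∀ k, Points π (Localization.Away (f k)))
    (hg : ∀ (k l : ι) (E : Type) [CommRing E] [Algebra ℂ E]
      (φ : Localization.Away (f k) →ₐ[ℂ] E) (ψ : Localization.Away (f l) →ₐ[ℂ] E),
      φ.comp (locHom (f k)) = ψ.comp (locHom (f l)) → (g k).map φ = (g l).map ψ) :
    ∃ g' : Points π A, ∀ k, g'.map (locHom (f k)) = g k := by
  let U := (Scheme.affineOpenCoverOfSpanRangeEqTop (R := .of A) f hf).openCover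
  let F : Spec (.of A) ⟶ X := U.glueMorphisms (fun k => (g k).1)
    fun k l => Points.overlap_eq (g k) (g l) (hg k l)
  have hF : ∀ k, U.f k ≫ F = (g k).1 := fun k => U.ι_glueMorphisms _ _ k
  refine ⟨⟨F, ?_⟩, fun k => Subtype.ext (hF k)⟩
  refine U.hom_ext _ _ fun k => ?_
  refine (Category.assoc _ _ _).symm.trans ((congrArg (· ≫ π) (hF k)).trans ((g k).2.trans ?_))
  refine Eq.trans ?_ (Spec.map_comp _ _)
  rw [← CommRingCat.ofHom_comp, ← IsScalarTower.algebraMap_eq]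

end GluePoints

/-! ### The correspondence between points and families. -/

section Represent

variable {m : ℕ} {A : Type} [CommRing A] [Algebra ℂ A]

/-- A point with coordinates `z` corresponds to the ideal with coordinates `z`. -/
def IsCoordinate (g : Points (projHom (chainGrading m)) A) (I : Ideal (A ⊗[ℂ] NodeRing)) (i : ℕ)
    (z : ℕ → A) : Prop :=
  ∃ (hz : IsChain m z) (hi : z i = 1), 1 ≤ i ∧ i ≤ m ∧
    g = chainPoint (i := i) hz (hi ▸ isUnit_one) ∧ I = chainIdeal m z

/-- The correspondence of points of the chain and punctual families. -/
def Corresponds (g : Points (projHom (chainGrading m)) A) (I : Ideal (A ⊗[ℂ] NodeRing)) : Prop :=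
  ∀ p : PrimeSpectrum A, ∃ f : A, f ∉ p.asIdeal ∧ ∃ i z,
    IsCoordinate (g.map (locHom f)) (baseIdeal (Localization.Away f) I) i z

variable {g g' : Points (projHom (chainGrading m)) A} {I I' : Ideal (A ⊗[ℂ] NodeRing)} {i i' : ℕ}
  {z z' : ℕ → A}

theorem IsCoordinate.map {B : Type} [CommRing B] [Algebra ℂ B] (h : IsCoordinate g I i z)
    (φ : A →ₐ[ℂ] B) : IsCoordinate (g.map φ) (I.map (famMap φ)) i (φ ∘ z) := by
  obtain ⟨hz, hi, h1, h2, rfl, rfl⟩ := h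
  exact ⟨hz.map φ, by rw [Function.comp_apply, hi, map_one], h1, h2, chainPoint_map _ _ _,
    map_chainIdeal φ⟩

/-- Equality of points and equality of ideals are both the same proportionality of coordinates. -/
theorem IsCoordinate.eq_iff (h : IsCoordinate g I i z) (h' : IsCoordinate g' I' i' z') :
    g = g' ↔ I = I' := by
  obtain ⟨hz, hi, h1, h2, rfl, rfl⟩ := h
  obtain ⟨hz', hi', h1', h2', rfl, rfl⟩ := h'
  rw [chainPoint_eq_iff hz' hi' hz hi, hz'.chainIdeal_eq_iff h1' h2' hi' hz hi]

theorem IsCoordinate.corresponds (h : IsCoordinate g I i z) : Corresponds g I := fun p =>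
  ⟨1, (Ideal.ne_top_iff_one _).mp p.isPrime.ne_top, i, _, h.map _⟩

theorem map_baseIdeal {B : Type} [CommRing B] [Algebra ℂ B] (f : A)
    (χ : Localization.Away f →ₐ[ℂ] B) :
    (baseIdeal (Localization.Away f) I).map (famMap χ) =
      I.map (famMap (χ.comp (locHom f))) := (map_famMap_comp _ _ _).symm

theorem Corresponds.map {B : Type} [CommRing B] [Algebra ℂ B] (h : Corresponds g I)
    (φ : A →ₐ[ℂ] B) : Corresponds (g.map φ) (I.map (famMap φ)) := by
  intro q
  obtain ⟨f, hf, i, z, hiz⟩ := h (PrimeSpectrum.comap (φ : A →+* B) q)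
  obtain ⟨χ, hχ⟩ := exists_locHom_comp ((locHom (φ f)).comp φ) (isUnit_locHom (φ f))
  refine ⟨φ f, hf, i, χ ∘ z, ?_⟩
  have := hiz.map χ
  rwa [Points.map_map, map_baseIdeal, hχ, ← Points.map_map, map_famMap_comp] at this

theorem Corresponds.exists_pair (h : Corresponds g I) (h' : Corresponds g' I')
    (p : PrimeSpectrum A) : ∃ f : A, f ∉ p.asIdeal ∧ ∃ i z i' z',
      IsCoordinate (g.map (locHom f)) (baseIdeal (Localization.Away f) I) i z ∧
      IsCoordinate (g'.map (locHom f)) (baseIdeal (Localization.Away f) I') i' z' := by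
  obtain ⟨f, hf, i, z, hz⟩ := h p
  obtain ⟨f', hf', i', z', hz'⟩ := h' p
  have hu := isUnit_locHom (f * f')
  rw [map_mul] at hu
  obtain ⟨χ, hχ⟩ := exists_locHom_comp (locHom (f * f')) (isUnit_of_mul_isUnit_left hu)
  obtain ⟨χ', hχ'⟩ := exists_locHom_comp (locHom (f * f')) (isUnit_of_mul_isUnit_right hu)
  refine ⟨f * f', fun hmem => (p.isPrime.mem_or_mem hmem).elim hf hf', i, χ ∘ z, i', χ' ∘ z',
    ?_, ?_⟩
  · have := hz.map χ
    rwa [Points.map_map, map_baseIdeal, hχ] at this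
  · have := hz'.map χ'
    rwa [Points.map_map, map_baseIdeal, hχ'] at this

/-- Both equalities can be checked locally, where coordinates exist. With stability under base
change this gives bijectivity and naturality at once. -/
theorem Corresponds.eq_iff (h : Corresponds g I) (h' : Corresponds g' I') : g = g' ↔ I = I' := by
  constructor
  · rintro rfl
    refine ideal_eq_of_local fun p => ?_
    obtain ⟨f, hf, i, z, i', z', hz, hz'⟩ := h.exists_pair h' p
    exact ⟨f, hf, (hz.eq_iff hz').mp rfl⟩
  · rintro rfl
    refine Points.ext_of_local fun p => ?_
    obtain ⟨f, hf, i, z, i', z', hz, hz'⟩ := h.exists_pair h' p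
    exact ⟨f, hf, (hz.eq_iff hz').mpr rfl⟩

theorem Corresponds.isPunctualFamily (h : Corresponds g I) : IsPunctualFamily A m I := by
  rw [isPunctualFamily_iff]
  intro p
  obtain ⟨f, hf, i, z, hz, hi, h1, h2, -, hI⟩ := h p
  refine ⟨f, hf, ?_⟩
  rw [hI, hz.chainIdeal_eq h1 h2 hi]
  exact ⟨chartBasis (hz.isChart hi) (by omega), fun r hr => charpoly_chartBasis _ _ hr⟩

/-- Every punctual family corresponds to a point. -/
theorem exists_point_corresponds (hm : 1 ≤ m) (hI : IsPunctualFamily A m I) :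
    ∃ g : Points (projHom (chainGrading m)) A, Corresponds g I := by
  have h : ∀ p : PrimeSpectrum A, ∃ f : A, f ∉ p.asIdeal ∧ ∃ g' i z,
      IsCoordinate (m := m) g' (baseIdeal (Localization.Away f) I) i z := by
    intro p
    obtain ⟨f, hf, P, Q, hPQ, d, c, hdc, hI'⟩ := hI.exists_chart hm p
    subst hPQ
    have hz := isChain_chartTuple hdc
    have hi := chartTuple_self (Q + 1) d c
    refine ⟨f, hf, _, Q + 1, chartTuple (Q + 1) d c, hz, hi, by omega, by omega, rfl, ?_⟩
    rw [hI', hz.chainIdeal_eq (by omega) (by omega) hi, chartTuple_succ,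
      chartTuple_pred (by omega), show P + Q + 1 - (Q + 1) = P by omega, Nat.add_sub_cancel]
  choose f hf g' i z hz using h
  obtain ⟨g, hg⟩ := Points.exists_glued f (span_range_eq_top_of_forall fun p => ⟨p, hf p⟩) g'
    -- On overlaps the local points correspond to the same ideal, hence coincide.
    (fun k l E _ _ φ ψ hφψ => by
      refine (((hz k).map φ).eq_iff ((hz l).map ψ)).mpr ?_
      rw [map_baseIdeal, map_baseIdeal, hφψ])
  exact ⟨g, fun p => ⟨f p, hf p, i p, z p, by rw [hg]; exact hz p⟩⟩

/-- Every point corresponds to an ideal. -/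
theorem exists_ideal_corresponds (g : Points (projHom (chainGrading m)) A) :
    ∃ I : Ideal (A ⊗[ℂ] NodeRing), Corresponds g I := by
  choose f hf i z hz hi h1 h2 hg using exists_local_chainPoint g
  -- Gluing of ideals needs a finite cover, because it takes a common exponent.
  obtain ⟨s, hs, hspan⟩ := (Ideal.span_eq_top_iff_finite _).mp
    (span_range_eq_top_of_forall fun p => ⟨p, hf p⟩)
  have hcoord : ∀ p, IsCoordinate (g.map (locHom (f p))) (chainIdeal m (z p)) (i p) (z p) :=
    fun p => ⟨hz p, hi p, h1 p, h2 p, hg p, rfl⟩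
  choose P hP using fun a : s => hs a.2
  obtain ⟨I, hI⟩ := exists_glued_ideal (fun a : s => f (P a)) (fun a => chainIdeal m (z (P a)))
    (fun k l E _ _ φ ψ hφψ => by
      refine (((hcoord _).map φ).eq_iff ((hcoord _).map ψ)).mp ?_
      rw [Points.map_map, Points.map_map, hφψ])
  refine ⟨I, fun p => ?_⟩
  have : ∃ a ∈ s, a ∉ p.asIdeal := by
    by_contra! hall
    exact p.isPrime.ne_top (top_le_iff.mp (hspan ▸ Ideal.span_le.mpr hall))
  obtain ⟨a, has, ha⟩ := this
  refine ⟨f (P ⟨a, has⟩), by rw [hP]; exact ha, i (P ⟨a, has⟩), z (P ⟨a, has⟩), ?_⟩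
  rw [hI]
  exact hcoord _

/-- The ideal that corresponds to a point. -/
def idealOfPoint (g : Points (projHom (chainGrading m)) A) : Ideal (A ⊗[ℂ] NodeRing) :=
  (exists_ideal_corresponds g).choose

theorem corresponds_idealOfPoint (g : Points (projHom (chainGrading m)) A) :
    Corresponds g (idealOfPoint g) :=
  (exists_ideal_corresponds g).choose_spec

/-- The punctual Hilbert scheme is the chain. -/
def punctualHilb (m : ℕ) (hm : 1 ≤ m) : PunctualHilb m where
  X := Proj (chainGrading m)
  π := projHom (chainGrading m)
  family A _ _ := Equiv.ofBijective
    (fun g => ⟨idealOfPoint g, (corresponds_idealOfPoint g).isPunctualFamily⟩)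
    ⟨fun g g' h => ((corresponds_idealOfPoint g).eq_iff (corresponds_idealOfPoint g')).mpr
        (congrArg Subtype.val h),
      fun I => by
        obtain ⟨g, hg⟩ := exists_point_corresponds hm I.2
        exact ⟨g, Subtype.ext (((corresponds_idealOfPoint g).eq_iff hg).mp rfl)⟩⟩
  -- Both ideals correspond to the base-changed point.
  natural A B _ _ _ _ φ g :=
    ((corresponds_idealOfPoint _).eq_iff ((corresponds_idealOfPoint g).map φ)).mp rfl

end Represent

end NodeHilb

end

noncomputable section

namespace NodeHilb

/-! ### Closed points and limits -/

/-- Points with values in a field have homogeneous coordinates. -/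
theorem exists_field_chainPoint {m : ℕ} {K : Type} [Field K] [Algebra ℂ K]
    (g : Points (projHom (chainGrading m)) K) (p : Spec (.of K)) {i : ℕ}
    (hi : g.1 p ∈ Proj.basicOpen (chainGrading m) (var m i)) :
    ∃ (z : ℕ → K) (hz : IsChain m z) (hi : z i = 1),
      g = chainPoint (i := i) hz (hi ▸ isUnit_one) := by
  refine exists_eq_chainPoint g i fun q => ?_
  have : Subsingleton (PrimeSpectrum K) := inferInstance
  rwa [show q = p from this.elim q p]

/-- Adjacent charts are related by rescaling by `d`; this is the coordinate change `a = 1/d`, which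
produces the limit at infinity. -/
theorem chainIdeal_chartTuple_inv {m i : ℕ} {d : ℂ} (hd : d ≠ 0) :
    chainIdeal m (chartTuple (i + 1) d 0) = chainIdeal m (chartTuple i 0 d⁻¹) := by
  rw [← chainIdeal_smul (m := m) (z := chartTuple i 0 d⁻¹) (mul_inv_cancel₀ hd)]
  congr 1
  ext k
  simp only [chartTuple]
  split_ifs <;> first | omega | simp [hd]

theorem isChain_chartTuple_succ {A : Type} [CommRing A] {m i : ℕ} (h1 : 1 ≤ i) (h2 : i + 1 ≤ m)
    (d : A) : IsChain m (chartTuple (i + 1) d 0) := by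
  have h : IsChart (m - (i + 1)) i d 0 := ⟨mul_zero _, fun h => by omega, fun _ => rfl⟩
  have := isChain_chartTuple h
  rwa [show m - (i + 1) + i + 1 = m by omega] at this

section ClosedPoints

variable {m : ℕ} (hm : 1 ≤ m) {i : ℕ} {z : ℕ → ℂ}

theorem idealOf_chainPoint (hz : IsChain m z) (hi : z i = 1) (h1 : 1 ≤ i) (h2 : i ≤ m) :
    (punctualHilb m hm).idealOf (chainPoint (i := i) hz (hi ▸ isUnit_one)) =
      nodeIdeal (chainIdeal m z) := by
  have h : IsCoordinate (chainPoint (i := i) hz (hi ▸ isUnit_one)) (chainIdeal m z) i z :=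
    ⟨hz, hi, h1, h2, rfl, rfl⟩
  exact congrArg nodeIdeal (((corresponds_idealOfPoint _).eq_iff h.corresponds).mp rfl)

theorem exists_closedPoint_eq (g : Points (punctualHilb m hm).π ℂ) :
    ∃ (i : ℕ) (z : ℕ → ℂ) (hz : IsChain m z) (hi : z i = 1), 1 ≤ i ∧ i ≤ m ∧
      g = chainPoint (i := i) hz (hi ▸ isUnit_one) := by
  obtain ⟨i, h1, h2, hi⟩ := exists_mem_basicOpen ((punctualHilb m hm).pt g)
  obtain ⟨z, hz, hzi, hg⟩ := exists_field_chainPoint g _ hi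
  exact ⟨i, z, hz, hzi, h1, h2, hg⟩

theorem idealOf_injective : Function.Injective (punctualHilb m hm).idealOf := fun _ _ h =>
  ((punctualHilb m hm).family ℂ).injective (Subtype.ext (nodeIdeal_injective h))

theorem bijOn_idealOf :
    Set.BijOn (punctualHilb m hm).idealOf Set.univ {I | HasColength I m} := by
  refine ⟨fun g _ => ?_, (idealOf_injective hm).injOn, fun I hI => ?_⟩
  · obtain ⟨i, z, hz, hi, h1, h2, rfl⟩ := exists_closedPoint_eq hm g
    rw [Set.mem_ofPred_eq, idealOf_chainPoint hm hz hi h1 h2]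
    exact hasColength_nodeIdeal hz h1 h2 hi
  · rw [Set.mem_ofPred_eq, ← nodeIdeal_map I] at hI
    obtain ⟨i, z, h1, h2, hz, hi, hJ⟩ := hI.exists_isChain hm
    refine ⟨chainPoint (i := i) hz (hi ▸ isUnit_one), trivial, ?_⟩
    rw [idealOf_chainPoint hm hz hi h1 h2, ← hJ, nodeIdeal_map]

theorem isUnit_chartTuple {A : Type} [CommRing A] (i : ℕ) (d c : A) :
    IsUnit (chartTuple i d c i) := by
  rw [chartTuple_self]
  exact isUnit_one

/-- The coordinate axis of a chart along the curve `C i`. -/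
def lineZero (A : Type) [CommRing A] [Algebra ℂ A] (h1 : 1 ≤ i) (h2 : i + 1 ≤ m) (a : A) :
    Points (projHom (chainGrading m)) A :=
  chainPoint (i := i) (isChain_chartTuple_zero (c := a) h1 (by omega) (by omega))
    (isUnit_chartTuple _ _ _)

/-- The coordinate axis of the next chart along the curve `C i`. -/
def lineInfinity (A : Type) [CommRing A] [Algebra ℂ A] (h1 : 1 ≤ i) (h2 : i + 1 ≤ m) (a : A) :
    Points (projHom (chainGrading m)) A :=
  chainPoint (i := i + 1) (isChain_chartTuple_succ h1 h2 a) (isUnit_chartTuple _ _ _)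

variable {A B : Type} [CommRing A] [Algebra ℂ A] [CommRing B] [Algebra ℂ B]

theorem lineZero_map (h1 : 1 ≤ i) (h2 : i + 1 ≤ m) (a : A) (φ : A →ₐ[ℂ] B) :
    (lineZero A h1 h2 a).map φ = lineZero B h1 h2 (φ a) := by
  rw [lineZero, chainPoint_map]
  simp only [map_chartTuple, map_zero]
  rfl

theorem lineInfinity_map (h1 : 1 ≤ i) (h2 : i + 1 ≤ m) (a : A) (φ : A →ₐ[ℂ] B) :
    (lineInfinity A h1 h2 a).map φ = lineInfinity B h1 h2 (φ a) := by
  rw [lineInfinity, chainPoint_map]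
  simp only [map_chartTuple, map_zero]
  rfl

theorem idealOf_lineZero (h1 : 1 ≤ i) (h2 : i + 1 ≤ m) {a : ℂ} (ha : a ≠ 0) :
    (punctualHilb m hm).idealOf (lineZero ℂ h1 h2 a) = idealI m i a := by
  rw [← nodeIdeal_chainIdeal h1 (by omega) ha]
  exact idealOf_chainPoint hm _ (chartTuple_self _ _ _) h1 (by omega)

theorem idealOf_lineZero_zero (h1 : 1 ≤ i) (h2 : i + 1 ≤ m) :
    (punctualHilb m hm).idealOf (lineZero ℂ h1 h2 0) = idealQ m i := by
  rw [← nodeIdeal_chainIdeal_zero h1 (by omega)]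
  exact idealOf_chainPoint hm _ (chartTuple_self _ _ _) h1 (by omega)

theorem idealOf_lineInfinity (h1 : 1 ≤ i) (h2 : i + 1 ≤ m) {a : ℂ} (ha : a ≠ 0) :
    (punctualHilb m hm).idealOf (lineInfinity ℂ h1 h2 a) = idealI m i a⁻¹ := by
  rw [← nodeIdeal_chainIdeal h1 (by omega) (inv_ne_zero ha), ← chainIdeal_chartTuple_inv ha]
  exact idealOf_chainPoint hm _ (chartTuple_self _ _ _) (by omega) (by omega)

theorem idealOf_lineInfinity_zero (h1 : 1 ≤ i) (h2 : i + 1 ≤ m) :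
    (punctualHilb m hm).idealOf (lineInfinity ℂ h1 h2 0) = idealQ m (i + 1) := by
  rw [← nodeIdeal_chainIdeal_zero (by omega) (by omega)]
  exact idealOf_chainPoint hm _ (chartTuple_self _ _ _) (by omega) (by omega)

theorem hasLimitAtZero (h1 : 1 ≤ i) (h2 : i + 1 ≤ m) :
    (punctualHilb m hm).HasLimitAtZero (idealI m i) (idealQ m i) := by
  refine ⟨lineZero _ h1 h2 Polynomial.X, fun a ha => ?_, ?_⟩
  · exact (congrArg _ (lineZero_map h1 h2 _ _)).trans
      (by rw [Polynomial.aeval_X, idealOf_lineZero hm h1 h2 ha])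
  · exact (congrArg _ (lineZero_map h1 h2 _ _)).trans
      (by rw [Polynomial.aeval_X, idealOf_lineZero_zero])

theorem hasLimitAtInfinity (h1 : 1 ≤ i) (h2 : i + 1 ≤ m) :
    (punctualHilb m hm).HasLimitAtInfinity (idealI m i) (idealQ m (i + 1)) := by
  refine ⟨lineInfinity _ h1 h2 Polynomial.X, fun a ha => ?_, ?_⟩
  · exact (congrArg _ (lineInfinity_map h1 h2 _ _)).trans
      (by rw [Polynomial.aeval_X, idealOf_lineInfinity hm h1 h2 ha])
  · exact (congrArg _ (lineInfinity_map h1 h2 _ _)).trans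
      (by rw [Polynomial.aeval_X, idealOf_lineInfinity_zero])

end ClosedPoints

end NodeHilb

end

noncomputable section

namespace NodeHilb

/-! ### The components of the chain -/

/-- Taking `K` to be the residue field allows arbitrary points of the scheme, generic ones included,
to be studied by coordinates in a field. -/
theorem exists_field_point {X : Scheme.{0}} (π : X ⟶ Spec (.of ℂ)) (x : X) :
    ∃ (K : Type) (_ : Field K) (_ : Algebra ℂ K) (g : Points π K) (p : Spec (.of K)),
      g.1 p = x := by
  obtain ⟨φ, hφ⟩ := Spec.map_surjective (X.fromSpecResidueField x ≫ π)
  let _ : Algebra ℂ (X.residueField x) := φ.hom.toAlgebra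
  exact ⟨X.residueField x, inferInstance, inferInstance,
    ⟨X.fromSpecResidueField x, hφ.symm⟩, IsLocalRing.closedPoint _,
    X.fromSpecResidueField_apply x _⟩

/-- The points of the chain for which only the coordinates `i` and `i + 1` can be nonzero. -/
def curveSet (m i : ℕ) : Set (Proj (chainGrading m)) :=
  {x | ∀ k, k ≠ i → k ≠ i + 1 → x ∉ Proj.basicOpen (chainGrading m) (var m k)}

theorem isClosed_curveSet (m i : ℕ) : IsClosed (curveSet m i) := by
  have : curveSet m i = ⋂ (k) (_ : k ≠ i) (_ : k ≠ i + 1),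
      ((Proj.basicOpen (chainGrading m) (var m k) : Set (Proj (chainGrading m))))ᶜ := by
    ext x
    simp [curveSet]
  rw [this]
  exact isClosed_iInter fun k => isClosed_iInter fun _ => isClosed_iInter fun _ =>
    (Proj.basicOpen (chainGrading m) (var m k)).2.isClosed_compl

section

variable {m i : ℕ} {K : Type} [Field K]

theorem notMem_asIdeal_iff (p : Spec (.of K)) (a : K) : a ∉ p.asIdeal ↔ a ≠ 0 := by
  rw [(Ideal.eq_bot_of_prime (h := p.isPrime) p.asIdeal : p.asIdeal = (⊥ : Ideal K))]
  exact Iff.rfl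

variable [Algebra ℂ K]

theorem exists_lineZero_eq {g : Points (projHom (chainGrading m)) K} {p : Spec (.of K)}
    (h1 : 1 ≤ i) (h2 : i + 1 ≤ m) (hg : g.1 p ∈ curveSet m i)
    (hi : g.1 p ∈ Proj.basicOpen (chainGrading m) (var m i)) :
    ∃ c : K, g = lineZero K h1 h2 c := by
  obtain ⟨z, hz, hzi, rfl⟩ := exists_field_chainPoint g p hi
  have h0 : z (i - 1) = 0 := by
    have := hg (i - 1) (by omega) (by omega)
    rwa [chainPoint_mem_basicOpen, notMem_asIdeal_iff, not_not] at this
  have hzt := hz.eq_chartTuple hzi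
  rw [h0] at hzt
  refine ⟨z (i + 1), ?_⟩
  unfold lineZero
  congr 1

theorem exists_lineInfinity_eq {g : Points (projHom (chainGrading m)) K} {p : Spec (.of K)}
    (h1 : 1 ≤ i) (h2 : i + 1 ≤ m) (hg : g.1 p ∈ curveSet m i)
    (hi : g.1 p ∈ Proj.basicOpen (chainGrading m) (var m (i + 1))) :
    ∃ c : K, g = lineInfinity K h1 h2 c := by
  obtain ⟨z, hz, hzi, rfl⟩ := exists_field_chainPoint g p hi
  have h0 : z (i + 1 + 1) = 0 := by
    have := hg (i + 1 + 1) (by omega) (by omega)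
    rwa [chainPoint_mem_basicOpen, notMem_asIdeal_iff, not_not] at this
  have hzt := hz.eq_chartTuple hzi
  rw [h0, Nat.add_sub_cancel] at hzt
  refine ⟨z i, ?_⟩
  unfold lineInfinity
  congr 1

end

section

variable {m i : ℕ} (h1 : 1 ≤ i) (h2 : i + 1 ≤ m)

include h1 h2 in
-- A field-valued point of the locus has coordinate `1` at `i` or at `i + 1` and one free coordinate
-- `c` next to it; it is the pullback of one of the two affine lines under evaluation at `c`.
theorem curveSet_subset : curveSet m i ⊆
    Set.range (lineZero (Polynomial ℂ) h1 h2 Polynomial.X).1 ∪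
      Set.range (lineInfinity (Polynomial ℂ) h1 h2 Polynomial.X).1 := by
  intro x hx
  obtain ⟨K, _, _, g, p, rfl⟩ := exists_field_point (projHom (chainGrading m)) x
  obtain ⟨k, -, -, hk⟩ := exists_mem_basicOpen (g.1 p)
  by_cases hki : k = i
  · subst hki
    obtain ⟨c, rfl⟩ := exists_lineZero_eq h1 h2 hx hk
    have := lineZero_map (A := Polynomial ℂ) (m := m) h1 h2 Polynomial.X (Polynomial.aeval c)
    rw [Polynomial.aeval_X] at this
    rw [← this]
    exact Or.inl ⟨_, rfl⟩
  · have hki' : k = i + 1 := by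
      by_contra hne
      exact hx k hki hne hk
    subst hki'
    obtain ⟨c, rfl⟩ := exists_lineInfinity_eq h1 h2 hx hk
    have := lineInfinity_map (A := Polynomial ℂ) (m := m) h1 h2 Polynomial.X (Polynomial.aeval c)
    rw [Polynomial.aeval_X] at this
    rw [← this]
    exact Or.inr ⟨_, rfl⟩

/-- A polynomial that vanishes at all nonzero numbers has infinitely many roots, so it is zero. -/
theorem closure_nonzero_points : closure {p : PrimeSpectrum (Polynomial ℂ) | ∃ a : ℂ, a ≠ 0 ∧
    p = PrimeSpectrum.comap (Polynomial.aeval (R := ℂ) a : Polynomial ℂ →+* ℂ)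
      (IsLocalRing.closedPoint ℂ)} = Set.univ := by
  rw [← PrimeSpectrum.zeroLocus_vanishingIdeal_eq_closure]
  have : PrimeSpectrum.vanishingIdeal {p : PrimeSpectrum (Polynomial ℂ) | ∃ a : ℂ, a ≠ 0 ∧
    p = PrimeSpectrum.comap (Polynomial.aeval (R := ℂ) a : Polynomial ℂ →+* ℂ)
      (IsLocalRing.closedPoint ℂ)} = ⊥ := by
    rw [eq_bot_iff]
    intro f hf
    rw [PrimeSpectrum.mem_vanishingIdeal] at hf
    refine Polynomial.eq_zero_of_infinite_isRoot f
      (Set.Infinite.mono (s := {0}ᶜ) (fun a ha => ?_) (Set.finite_singleton 0).infinite_compl)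
    have h := hf _ ⟨a, ha, rfl⟩
    have h3 : Polynomial.aeval a f ∈ IsLocalRing.maximalIdeal ℂ := h
    rw [IsLocalRing.maximalIdeal_eq_bot, Ideal.mem_bot] at h3
    simpa [Polynomial.aeval_def] using h3
  rw [this]
  simp

theorem range_subset_closure {X : Scheme.{0}} {π : X ⟶ Spec (.of ℂ)}
    (g : Points π (Polynomial ℂ)) {Z : Set X} (hZ : ∀ a : ℂ, a ≠ 0 →
      (g.map (Polynomial.aeval a)).1 (IsLocalRing.closedPoint ℂ) ∈ Z) :
    Set.range g.1 ⊆ closure Z := by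
  rintro _ ⟨q, rfl⟩
  have hq : q ∈ closure {p : PrimeSpectrum (Polynomial ℂ) | ∃ a : ℂ, a ≠ 0 ∧
      p = PrimeSpectrum.comap (Polynomial.aeval (R := ℂ) a : Polynomial ℂ →+* ℂ)
        (IsLocalRing.closedPoint ℂ)} := by
    rw [closure_nonzero_points]
    trivial
  refine map_mem_closure g.1.continuous hq ?_
  rintro _ ⟨a, ha, rfl⟩
  exact hZ a ha

include h1 h2 in
/-- The closed points of a component. -/
theorem pt_mem_curveSet_iff (hm : 1 ≤ m) (g : Points (punctualHilb m hm).π ℂ) :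
    (punctualHilb m hm).pt g ∈ curveSet m i ↔
      (∃ a : ℂ, a ≠ 0 ∧ (punctualHilb m hm).idealOf g = idealI m i a) ∨
        (punctualHilb m hm).idealOf g = idealQ m i ∨
        (punctualHilb m hm).idealOf g = idealQ m (i + 1) := by
  constructor
  · intro hg
    obtain ⟨k, -, -, hk⟩ := exists_mem_basicOpen ((punctualHilb m hm).pt g)
    by_cases hki : k = i
    · subst hki
      obtain ⟨c, rfl⟩ := exists_lineZero_eq h1 h2 hg hk
      rcases eq_or_ne c 0 with rfl | hc
      · exact Or.inr (Or.inl (idealOf_lineZero_zero hm h1 h2))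
      · exact Or.inl ⟨c, hc, idealOf_lineZero hm h1 h2 hc⟩
    · have hki' : k = i + 1 := by
        by_contra hne
        exact hg k hki hne hk
      subst hki'
      obtain ⟨c, rfl⟩ := exists_lineInfinity_eq h1 h2 hg hk
      rcases eq_or_ne c 0 with rfl | hc
      · exact Or.inr (Or.inr (idealOf_lineInfinity_zero hm h1 h2))
      · exact Or.inl ⟨c⁻¹, inv_ne_zero hc, idealOf_lineInfinity hm h1 h2 hc⟩
  · have key : ∀ c : ℂ, (punctualHilb m hm).pt (lineZero ℂ h1 h2 c) ∈ curveSet m i := by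
      intro c k hk hk' hmem
      refine (notMem_asIdeal_iff _ _).mp ((chainPoint_mem_basicOpen _ _ _ _).mp hmem) ?_
      simp [chartTuple, hk, hk']
    have key' : ∀ c : ℂ, (punctualHilb m hm).pt (lineInfinity ℂ h1 h2 c) ∈ curveSet m i := by
      intro c k hk hk' hmem
      refine (notMem_asIdeal_iff _ _).mp ((chainPoint_mem_basicOpen _ _ _ _).mp hmem) ?_
      simp [chartTuple, hk, hk']
    rintro (⟨a, ha, h⟩ | h | h)
    · rw [idealOf_injective hm (h.trans (idealOf_lineZero hm h1 h2 ha).symm)]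
      exact key a
    · rw [idealOf_injective hm (h.trans (idealOf_lineZero_zero hm h1 h2).symm)]
      exact key 0
    · rw [idealOf_injective hm (h.trans (idealOf_lineInfinity_zero hm h1 h2).symm)]
      exact key' 0

include h1 h2 in
-- The locus is closed and contains all `I_i(a)`. It is covered by two affine lines, and on each the
-- nonzero parameters, which give ideals `I_i(a)`, are dense.
theorem curveC_eq (hm : 1 ≤ m) : (punctualHilb m hm).curveC i = curveSet m i := by
  apply subset_antisymm
  · refine closure_minimal ?_ (isClosed_curveSet m i)
    rintro _ ⟨g, rfl, h⟩
    exact (pt_mem_curveSet_iff h1 h2 hm g).mpr (Or.inl h)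
  · refine (curveSet_subset h1 h2).trans (Set.union_subset ?_ ?_)
    · refine range_subset_closure _ fun a ha => ⟨_, rfl, a, ha, ?_⟩
      exact (congrArg _ (lineZero_map h1 h2 _ _)).trans
        (by rw [Polynomial.aeval_X, idealOf_lineZero hm h1 h2 ha])
    · refine range_subset_closure _ fun a ha => ⟨_, rfl, a⁻¹, inv_ne_zero ha, ?_⟩
      exact (congrArg _ (lineInfinity_map h1 h2 _ _)).trans
        (by rw [Polynomial.aeval_X, idealOf_lineInfinity hm h1 h2 ha])

end

/-! ### Intersections of the components -/

section Intersections

variable {m : ℕ}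

theorem notMem_basicOpen_of_mem {x : Proj (chainGrading m)} {j k : ℕ}
    (hj : x ∈ Proj.basicOpen (chainGrading m) (var m j)) (hjk : j + 2 ≤ k ∨ k + 2 ≤ j) :
    x ∉ Proj.basicOpen (chainGrading m) (var m k) := by
  intro hk
  have hx : x ∈ Proj.basicOpen (chainGrading m) (var m j * var m k) := by
    rw [Proj.basicOpen_mul]
    exact ⟨hj, hk⟩
  rcases hjk with h | h
  · rw [(isChain_var m).mul_eq_zero j k h, Proj.basicOpen_zero] at hx
    exact hx
  · rw [mul_comm, (isChain_var m).mul_eq_zero k j h, Proj.basicOpen_zero] at hx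
    exact hx

theorem le_of_mem_basicOpen {x : Proj (chainGrading m)} {k : ℕ}
    (hk : x ∈ Proj.basicOpen (chainGrading m) (var m k)) : 1 ≤ k ∧ k ≤ m := by
  constructor
  · by_contra h0
    rw [show k = 0 by omega, (isChain_var m).zero, Proj.basicOpen_zero] at hk
    exact hk
  · by_contra h0
    rw [(isChain_var m).large k (by omega), Proj.basicOpen_zero] at hk
    exact hk

/-- At any point the nonvanishing coordinates are one, or two adjacent ones. -/
theorem exists_mem_curveSet (hm : 2 ≤ m) (x : Proj (chainGrading m)) :
    ∃ i, 1 ≤ i ∧ i ≤ m - 1 ∧ x ∈ curveSet m i := by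
  obtain ⟨k, h1, h2, hk⟩ := exists_mem_basicOpen x
  by_cases hpred : x ∈ Proj.basicOpen (chainGrading m) (var m (k - 1))
  · have h3 := le_of_mem_basicOpen hpred
    refine ⟨k - 1, h3.1, by omega, fun l hl hl' hmem => ?_⟩
    rcases lt_trichotomy l k with h | h | h
    · exact notMem_basicOpen_of_mem hk (Or.inr (by omega)) hmem
    · omega
    · exact notMem_basicOpen_of_mem hpred (Or.inl (by omega)) hmem
  · by_cases hkm : k = m
    · refine ⟨m - 1, by omega, le_rfl, fun l hl hl' hmem => ?_⟩
      have h3 := le_of_mem_basicOpen hmem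
      exact notMem_basicOpen_of_mem hk (Or.inr (by omega)) hmem
    · refine ⟨k, h1, by omega, fun l hl hl' hmem => ?_⟩
      by_cases hlk : l = k - 1
      · exact hpred (hlk ▸ hmem)
      · exact notMem_basicOpen_of_mem hk (by omega) hmem

theorem curveSet_inter_eq_empty {i j : ℕ} (hij : i + 2 ≤ j) :
    curveSet m i ∩ curveSet m j = ∅ := by
  rw [Set.eq_empty_iff_forall_notMem]
  rintro x ⟨hi, hj⟩
  obtain ⟨k, -, -, hk⟩ := exists_mem_basicOpen x
  by_cases h1 : k = i ∨ k = i + 1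
  · exact hj k (by omega) (by omega) hk
  · exact hi k (by omega) (by omega) hk

/-- A point where only the `i`-th coordinate survives has normalized coordinates `0` and `1`,
defined over `ℂ`. So its residue field point is a base change of the closed point `Q_i` and has the
same image. -/
theorem mem_pointQ_iff (hm : 1 ≤ m) {i : ℕ} (h1 : 1 ≤ i) (h2 : i ≤ m)
    (x : Proj (chainGrading m)) :
    x ∈ (punctualHilb m hm).pointQ i ↔
      ∀ k, k ≠ i → x ∉ Proj.basicOpen (chainGrading m) (var m k) := by
  have hz : IsChain m (chartTuple i (0 : ℂ) 0) := isChain_chartTuple_zero h1 h2 (by simp)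
  have hQ : (punctualHilb m hm).idealOf
      (chainPoint (i := i) hz (isUnit_chartTuple _ _ _)) = idealQ m i := by
    rw [← nodeIdeal_chainIdeal_zero h1 h2]
    exact idealOf_chainPoint hm _ (chartTuple_self _ _ _) h1 h2
  constructor
  · rintro ⟨g, rfl, hg⟩ k hk hmem
    rw [idealOf_injective hm (hg.trans hQ.symm)] at hmem
    refine (notMem_asIdeal_iff _ _).mp ((chainPoint_mem_basicOpen _ _ _ _).mp hmem) ?_
    simp [chartTuple, hk]
  · intro hx
    refine ⟨_, ?_, hQ⟩
    obtain ⟨K, _, _, g, p, rfl⟩ := exists_field_point (projHom (chainGrading m)) x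
    obtain ⟨k, -, -, hk⟩ := exists_mem_basicOpen (g.1 p)
    obtain rfl : k = i := by
      by_contra hne
      exact hx k hne hk
    obtain ⟨z, hz', hzi, rfl⟩ := exists_field_chainPoint g p hk
    have h0 : ∀ l, l ≠ k → z l = 0 := fun l hl => by
      have := hx l hl
      rwa [chainPoint_mem_basicOpen, notMem_asIdeal_iff, not_not] at this
    have hzt : Algebra.ofId ℂ K ∘ chartTuple k (0 : ℂ) 0 = z := by
      rw [hz'.eq_chartTuple hzi, h0 _ (by omega), h0 _ (by omega), map_chartTuple, map_zero]
    subst hzt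
    have h3 := chainPoint_map hz (isUnit_chartTuple k (0 : ℂ) 0) (Algebra.ofId ℂ K)
    have h4 : PrimeSpectrum.comap (Algebra.ofId ℂ K : ℂ →+* K) p = IsLocalRing.closedPoint ℂ :=
      Subsingleton.elim _ _
    have h5 := congrArg (fun g => g.1 p) h3
    refine Eq.trans ?_ h5
    change _ = (chainPoint hz (isUnit_chartTuple k (0 : ℂ) 0)).1
      (PrimeSpectrum.comap (Algebra.ofId ℂ K : ℂ →+* K) p)
    rw [h4]
    rfl

theorem curveSet_inter_succ (hm : 1 ≤ m) {i : ℕ} (h1 : 1 ≤ i) (h2 : i + 1 ≤ m) :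
    curveSet m i ∩ curveSet m (i + 1) = (punctualHilb m hm).pointQ (i + 1) := by
  ext x
  refine Iff.trans ?_ (mem_pointQ_iff hm (by omega) h2 x).symm
  constructor
  · rintro ⟨hi, hj⟩ k hk
    by_cases hki : k = i
    · exact hj k hk (by omega)
    · exact hi k hki hk
  · exact fun h => ⟨fun k _ hk => h k hk, fun k hk _ => h k hk⟩

end Intersections

end NodeHilb

end

noncomputable section

namespace NodeHilb

attribute [local instance] MvPolynomial.gradedAlgebra

/-! ### Closed embeddings of projective spectra -/

section ProjMap

open HomogeneousLocalization HomogeneousIdeal Limits Graded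

variable {S T : Type} [CommRing S] [Algebra ℂ S] [CommRing T] [Algebra ℂ T]
  {𝒜 : ℕ → Submodule ℂ S} {ℬ : ℕ → Submodule ℂ T} [GradedAlgebra 𝒜] [GradedAlgebra ℬ]

theorem exists_mem_map_eq (f : 𝒜 →+*ᵍ ℬ) (hs : Function.Surjective f) {n : ℕ} {y : T}
    (hy : y ∈ ℬ n) : ∃ x ∈ 𝒜 n, f x = y := by
  obtain ⟨x, rfl⟩ := hs y
  refine ⟨DirectSum.decompose 𝒜 x n, SetLike.coe_mem _, ?_⟩
  rw [GradedRingHom.map_directSumDecompose, DirectSum.decompose_of_mem_same _ hy]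

/-- This is the condition under which the morphism of projective spectra is defined everywhere;
homogeneous elements of positive degree lift to homogeneous elements of the same degree. -/
theorem irrelevant_le_map (f : 𝒜 →+*ᵍ ℬ) (hs : Function.Surjective f) :
    ℬ₊ ≤ 𝒜₊.map f := by
  refine (irrelevant_le ℬ).mpr fun n hn y hy => ?_
  obtain ⟨x, hx, rfl⟩ := exists_mem_map_eq f hs hy
  exact Ideal.mem_map_of_mem f (mem_irrelevant_of_mem 𝒜 hn hx)

theorem awayMap_surjective (f : 𝒜 →+*ᵍ ℬ) (hs : Function.Surjective f) {d : ℕ} {s : S}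
    (hd : s ∈ 𝒜 d) : Function.Surjective (Away.map f s) := fun y => by
  obtain ⟨n, y, hy, rfl⟩ := Away.mk_surjective ℬ (map_mem f hd) y
  obtain ⟨x, hx, rfl⟩ := exists_mem_map_eq f hs hy
  exact ⟨Away.mk 𝒜 hd n x hx, Away.map_mk f _ hd n x hx⟩

theorem isPullback_map (f : 𝒜 →+*ᵍ ℬ) (hf : ℬ₊ ≤ 𝒜₊.map f) {s : S} {d : ℕ} (hs : s ∈ 𝒜 d)
    (hd : 0 < d) :
    IsPullback (Spec.map (CommRingCat.ofHom (Away.map f s)))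
      (Proj.awayι ℬ (f s) (map_mem f hs) hd) (Proj.awayι 𝒜 s hs hd) (Proj.map f hf) := by
  refine IsOpenImmersion.isPullback _ _ _ _ (Proj.awayι_comp_map f _ _ _ _) ?_
  rw [Proj.opensRange_awayι, Proj.opensRange_awayι, Proj.map_preimage_basicOpen]

/-- A surjection of graded rings induces a closed embedding of projective spectra. -/
theorem isClosedImmersion_map (f : 𝒜 →+*ᵍ ℬ) (hs : Function.Surjective f) :
    IsClosedImmersion (Proj.map f (irrelevant_le_map f hs)) := by
  have key : ∀ {d : ℕ} (hd : 0 < d) (s : S) (h : s ∈ 𝒜 d), IsClosedImmersion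
      (pullback.snd (Proj.map f (irrelevant_le_map f hs)) (Proj.awayι 𝒜 s h hd)) := by
    intro d hd s h
    have h2 : IsClosedImmersion (Spec.map (CommRingCat.ofHom (Away.map f s))) :=
      IsClosedImmersion.spec_of_surjective _ (awayMap_surjective f hs h)
    rw [← (isPullback_map f (irrelevant_le_map f hs) h hd).flip.isoPullback_inv_snd]
    infer_instance
  exact IsZariskiLocalAtTarget.of_openCover (P := @IsClosedImmersion)
    (Proj.affineOpenCover 𝒜).openCover fun s => key s.1.2 s.2 s.2.2

theorem algebraMap_eq_mk (𝒜 : ℕ → Submodule ℂ S) [GradedAlgebra 𝒜] {s : S} {d : ℕ} (hs : s ∈ 𝒜 d)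
    (c : ℂ) : algebraMap ℂ (Away 𝒜 s) c = Away.mk 𝒜 hs 0 (algebraMap ℂ S c)
      (by rw [zero_smul]; exact SetLike.algebraMap_mem_graded 𝒜 c) := by
  apply val_injective
  rw [val_algebraMap, Away.val_mk, Localization.mk_eq_mk', IsLocalization.eq_mk'_iff_mul_eq]
  simp

theorem awayι_map_projHom (f : 𝒜 →+*ᵍ ℬ) (hf : ℬ₊ ≤ 𝒜₊.map f)
    (hc : ∀ c : ℂ, f (algebraMap ℂ S c) = algebraMap ℂ T c) {s : S} {d : ℕ} (hs : s ∈ 𝒜 d)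
    (hd : 0 < d) :
    Proj.awayι ℬ (f s) (map_mem f hs) hd ≫ Proj.map f hf ≫ projHom 𝒜 =
      Proj.awayι ℬ (f s) (map_mem f hs) hd ≫ projHom ℬ := by
  rw [Proj.awayι_comp_map_assoc f hf hd _ hs, awayι_projHom, awayι_projHom,
    ← Spec.map_comp, ← CommRingCat.ofHom_comp]
  congr 2
  ext c
  rw [RingHom.comp_apply, algebraMap_eq_mk 𝒜 hs, Away.map_mk, algebraMap_eq_mk ℬ (map_mem f hs)]
  simp only [hc]

theorem map_projHom (f : 𝒜 →+*ᵍ ℬ) (hf : ℬ₊ ≤ 𝒜₊.map f)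
    (hc : ∀ c : ℂ, f (algebraMap ℂ S c) = algebraMap ℂ T c) :
    Proj.map f hf ≫ projHom 𝒜 = projHom ℬ :=
  (Proj.mapAffineOpenCover f hf).openCover.hom_ext _ _ fun s =>
    awayι_map_projHom f hf hc s.2.2 s.1.2

theorem homPoint_comp_map {D : Type} [CommRing D] [Algebra ℂ D] (f : 𝒜 →+*ᵍ ℬ)
    (hf : ℬ₊ ≤ 𝒜₊.map f) (e : T →ₐ[ℂ] D) (e' : S →ₐ[ℂ] D) (he : ∀ s, e (f s) = e' s)
    {F : S} {d : ℕ} (hF : F ∈ 𝒜 d) (hd : 0 < d) (hu : IsUnit (e (f F))) (hu' : IsUnit (e' F)) :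
    (homPoint (𝒜 := ℬ) (F := f F) e (map_mem f hF) hd hu).1 ≫ Proj.map f hf = (homPoint e' hF hd hu').1 := by
  simp only [homPoint]
  rw [Category.assoc, Proj.awayι_comp_map f hf hd _ hF, ← Category.assoc, ← Spec.map_comp,
    ← CommRingCat.ofHom_comp]
  congr 3
  ext x
  obtain ⟨n, x, hx, rfl⟩ := Away.mk_surjective 𝒜 hF x
  refine (hu'.pow n).mul_right_cancel ?_
  refine Eq.trans ?_ (awayEval_mk e' hu' hF n x hx).symm
  have h1 := awayEval_mk e hu (map_mem f hF) n (f x) (map_mem f hx)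
  rw [he, he] at h1
  rw [RingHom.comp_apply, Away.map_mk]
  exact h1

end ProjMap

/-! ### The components of the chain -/

section Lines

variable {m i : ℕ}

/-- The homogeneous coordinates of the `i`-th line. -/
def lineTuple (i k : ℕ) : MvPolynomial (Fin 2) ℂ :=
  if k = i then MvPolynomial.X 0 else if k = i + 1 then MvPolynomial.X 1 else 0

theorem isChain_lineTuple (h1 : 1 ≤ i) (h2 : i + 1 ≤ m) : IsChain m (lineTuple i) where
  mul_eq_zero j k hjk := by
    unfold lineTuple
    split_ifs <;> first | (exfalso; omega) | simp
  zero := by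
    unfold lineTuple
    split_ifs <;> first | rfl | (exfalso; omega)
  large k hk := by
    unfold lineTuple
    split_ifs <;> first | rfl | (exfalso; omega)

/-- Scaling all variables by `X` multiplies a monomial by `X` to its degree, so the coaction
separates homogeneous components. -/
theorem coeff_aeval_X_mul (p : MvPolynomial (Fin 2) ℂ) (n : ℕ) :
    (MvPolynomial.aeval (fun k => (Polynomial.X * Polynomial.C (MvPolynomial.X k) :
      Polynomial (MvPolynomial (Fin 2) ℂ))) p).coeff n = MvPolynomial.homogeneousComponent n p := by
  induction p using MvPolynomial.induction_on' with
  | monomial d c =>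
    have h : MvPolynomial.aeval (fun k => (Polynomial.X * Polynomial.C (MvPolynomial.X k) :
        Polynomial (MvPolynomial (Fin 2) ℂ))) (MvPolynomial.monomial d c) =
        Polynomial.monomial d.degree (MvPolynomial.monomial d c) := by
      rw [MvPolynomial.aeval_monomial, MvPolynomial.monomial_eq, ← Polynomial.C_mul_X_pow_eq_monomial]
      simp only [mul_pow, Finsupp.prod, Finset.prod_mul_distrib, Finset.prod_pow_eq_pow_sum,
        Polynomial.C_mul, map_prod, map_pow]
      rw [mul_assoc, mul_comm (Finset.prod _ _)]
      rfl
    rw [h, Polynomial.coeff_monomial,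
      MvPolynomial.homogeneousComponent_of_mem (MvPolynomial.isHomogeneous_monomial c rfl)]
    simp [eq_comm]
  | add p q hp hq => rw [map_add, map_add, Polynomial.coeff_add, hp, hq]

/-- The restriction to a line intertwines the two coactions, so an element of degree `n` equals its
own `n`-th homogeneous component after restriction. -/
theorem evalHom_lineTuple_mem (h : IsChain m (lineTuple i)) {n : ℕ} {s : ChainRing m}
    (hs : s ∈ chainGrading m n) :
    evalHom h s ∈ MvPolynomial.homogeneousSubmodule (Fin 2) ℂ n := by
  have h1 := evalHom_smul (h.map (Polynomial.CAlgHom (R := ℂ))) Polynomial.X hs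
  have h2 : (MvPolynomial.aeval (fun k => (Polynomial.X * Polynomial.C (MvPolynomial.X k) :
      Polynomial (MvPolynomial (Fin 2) ℂ)))).comp (evalHom h) =
        evalHom ((h.map (Polynomial.CAlgHom (R := ℂ))).smul Polynomial.X) :=
    chainRing_algHom_ext fun k => by
      rw [AlgHom.comp_apply, evalHom_var, evalHom_var, Function.comp_apply]
      unfold lineTuple
      split_ifs <;> simp
  have h3 := coeff_aeval_X_mul (evalHom h s) n
  rw [← AlgHom.comp_apply, h2, h1, ← evalHom_comp h, AlgHom.comp_apply, Polynomial.CAlgHom_apply,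
    mul_comm (Polynomial.X ^ n), Polynomial.coeff_C_mul_X_pow, if_pos rfl] at h3
  rw [h3]
  exact MvPolynomial.homogeneousComponent_isHomogeneous n _

/-- Restriction of homogeneous functions to the `i`-th line. -/
def lineHom (h : IsChain m (lineTuple i)) :
    GradedRingHom (chainGrading m) (MvPolynomial.homogeneousSubmodule (Fin 2) ℂ) where
  toRingHom := (evalHom h : ChainRing m →+* MvPolynomial (Fin 2) ℂ)
  map_mem hs := evalHom_lineTuple_mem h hs

theorem lineHom_apply (h : IsChain m (lineTuple i)) (s : ChainRing m) :
    lineHom h s = evalHom h s := rfl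

theorem lineHom_surjective (h : IsChain m (lineTuple i)) : Function.Surjective (lineHom h) := by
  have h1 : (evalHom h).comp (MvPolynomial.aeval ![var m i, var m (i + 1)]) =
      AlgHom.id ℂ (MvPolynomial (Fin 2) ℂ) := by
    refine MvPolynomial.algHom_ext fun k => ?_
    fin_cases k
    · simp [lineTuple]
    · simp [lineTuple]
  exact fun p => ⟨_, DFunLike.congr_fun h1 p⟩

open HomogeneousIdeal in
/-- The chain contains the projective lines as closed subschemes. -/
theorem isProjLineIn_curveSet (h1 : 1 ≤ i) (h2 : i + 1 ≤ m) :
    IsProjLineIn (projHom (chainGrading m)) (curveSet m i) := by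
  have h := isChain_lineTuple h1 h2
  have hf := irrelevant_le_map (lineHom h) (lineHom_surjective h)
  refine ⟨Proj.map (lineHom h) hf, isClosedImmersion_map (lineHom h) (lineHom_surjective h),
    map_projHom (lineHom h) hf (evalHom h).commutes, subset_antisymm ?_ ?_⟩
  · rintro _ ⟨p, rfl⟩ k hk hk' hmem
    have h3 : p ∈ Proj.basicOpen (MvPolynomial.homogeneousSubmodule (Fin 2) ℂ)
      (lineHom h (var m k)) := hmem
    rw [lineHom_apply, evalHom_var, lineTuple, if_neg hk, if_neg hk', Proj.basicOpen_zero] at h3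
    exact h3
  -- The two affine lines that cover the locus lift to the projective line with homogeneous
  -- coordinates `[1 : X]` and `[X : 1]`.
  · have key : ∀ (l : ℕ) (t : Fin 2 → Polynomial ℂ) (z : ℕ → Polynomial ℂ) (hz : IsChain m z)
        (hl : IsUnit (z l)) (_ : ∀ k, MvPolynomial.aeval t (lineTuple i k) = z k),
        Set.range (chainPoint hz hl).1 ⊆ Set.range (Proj.map (lineHom h) hf) := by
      rintro l t z hz hl ht _ ⟨p, rfl⟩
      have he : ∀ s, MvPolynomial.aeval t (lineHom h s) = evalHom hz s := fun s => by
        have : (MvPolynomial.aeval t).comp (evalHom h) = evalHom hz :=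
          chainRing_algHom_ext fun k => by simp [ht]
        exact DFunLike.congr_fun this s
      have h3 := homPoint_comp_map (lineHom h) hf (MvPolynomial.aeval t) (evalHom hz) he
        (var_mem m l) one_pos (by rw [he, evalHom_var]; exact hl) (isUnit_evalHom_var hz hl)
      rw [chainPoint, ← h3, Scheme.Hom.comp_apply]
      exact ⟨_, rfl⟩
    refine (curveSet_subset h1 h2).trans (Set.union_subset ?_ ?_)
    · refine key _ ![1, Polynomial.X] _ _ _ fun k => ?_
      unfold lineTuple chartTuple
      split_ifs <;> first | (exfalso; omega) | simp
    · refine key _ ![Polynomial.X, 1] _ _ _ fun k => ?_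
      unfold lineTuple chartTuple
      split_ifs <;> first | (exfalso; omega) | simp

end Lines

end NodeHilb

end

noncomputable section

namespace NodeHilb

/-! ### Smoothness and reducedness from charts -/

/-- The presentation of a polynomial ring without relations. -/
def mvPolynomialPresentation (R ι : Type) [CommRing R] :
    Algebra.SubmersivePresentation R (MvPolynomial ι R) ι PEmpty.{1} where
  toGenerators := Algebra.Generators.ofSurjective MvPolynomial.X
    fun p => ⟨p, MvPolynomial.aeval_X_left_apply p⟩
  relation := PEmpty.elim
  span_range_relation_eq_ker := by
    rw [Set.range_eq_empty, Ideal.span_empty, eq_comm, Algebra.Generators.ker_eq_ker_aeval_val,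
      eq_bot_iff]
    intro p hp
    rw [RingHom.mem_ker] at hp
    exact (MvPolynomial.aeval_X_left_apply p).symm.trans hp
  map := PEmpty.elim
  map_inj := fun x => x.elim
  jacobian_isUnit := by
    rw [Algebra.PreSubmersivePresentation.jacobian_eq_jacobiMatrix_det]
    simp

instance isStandardSmooth_polynomial (R : Type) [CommRing R] :
    Algebra.IsStandardSmoothOfRelativeDimension 1 R (Polynomial R) := by
  have : Algebra.IsStandardSmoothOfRelativeDimension 1 R (MvPolynomial Unit R) :=
    (mvPolynomialPresentation R Unit).isStandardSmoothOfRelativeDimension (by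
      simp [Algebra.Presentation.dimension])
  exact Algebra.IsStandardSmoothOfRelativeDimension.of_algEquiv 1
    (MvPolynomial.uniqueAlgEquiv R Unit)

/-- The coordinate ring of the punctured affine line. -/
abbrev PuncturedLine : Type := Localization.Away (Polynomial.X : Polynomial ℂ)

instance : Algebra.IsStandardSmoothOfRelativeDimension 1 ℂ PuncturedLine := by
  have := Algebra.IsStandardSmoothOfRelativeDimension.localization_away (S := PuncturedLine)
    (Polynomial.X : Polynomial ℂ)
  exact Algebra.IsStandardSmoothOfRelativeDimension.trans 1 0 ℂ (Polynomial ℂ) PuncturedLine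

theorem isSmoothCurveAt_of_mem_range {X : Scheme.{0}} {π : X ⟶ Spec (.of ℂ)} {D : Type}
    [CommRing D] [Algebra ℂ D] [hD : Algebra.IsStandardSmoothOfRelativeDimension 1 ℂ D]
    (g : Points π D) [IsOpenImmersion g.1] {z : X} (hz : z ∈ Set.range g.1) :
    IsSmoothCurveAt π z := by
  refine ⟨g.1.opensRange, hz, ?_⟩
  have h : g.1.opensRange.ι ≫ π =
      g.1.isoOpensRange.inv ≫ Spec.map (CommRingCat.ofHom (algebraMap ℂ D)) := by
    rw [Iso.eq_inv_comp, ← Category.assoc, Scheme.Hom.isoOpensRange_hom_ι]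
    exact g.2
  have h2 : SmoothOfRelativeDimension 1 (Spec.map (CommRingCat.ofHom (algebraMap ℂ D))) := by
    rw [HasRingHomProperty.Spec_iff (P := @SmoothOfRelativeDimension 1)]
    refine RingHom.locally_of RingHom.isStandardSmoothOfRelativeDimension_respectsIso _ ?_
    rw [CommRingCat.hom_ofHom, RingHom.IsStandardSmoothOfRelativeDimension]
    convert! hD using 1
    exact Algebra.algebra_ext _ _ fun _ => rfl
  rw [h]
  -- An isomorphism has relative dimension `0`, the structure morphism of `Spec D` has `1`, and
  -- relative dimensions add.
  exact inferInstanceAs (SmoothOfRelativeDimension (0 + 1) _)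

/-- Reducedness is tested on stalks, and an open immersion identifies these with stalks of `Spec D`.
-/
theorem isReduced_of_points {X : Scheme.{0}} {π : X ⟶ Spec (.of ℂ)}
    (h : ∀ x : X, ∃ (D : Type) (_ : CommRing D) (_ : Algebra ℂ D) (_ : _root_.IsReduced D)
      (g : Points π D), IsOpenImmersion g.1 ∧ x ∈ Set.range g.1) : IsReduced X := by
  have : ∀ x : X, _root_.IsReduced (X.presheaf.stalk x) := by
    intro x
    obtain ⟨D, _, _, _, g, _, p, rfl⟩ := h x
    have : IsReduced (Spec (.of D)) := inferInstance
    exact isReduced_of_injective (g.1.stalkMap p).hom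
      (asIso <| g.1.stalkMap p).commRingCatIsoToRingEquiv.injective
  exact isReduced_of_isReduced_stalk X

/-! ### Charts of the chain -/

section Charts

open HomogeneousLocalization

variable {m i : ℕ}

theorem exists_eq_awayι (l : ℕ) {x : Proj (chainGrading m)}
    (hx : x ∈ Proj.basicOpen (chainGrading m) (var m i))
    (hxl : x ∈ Proj.basicOpen (chainGrading m) (var m l)) :
    ∃ q : Spec (.of (Localization.Away (ratio m i l))),
      (Spec.map (CommRingCat.ofHom (algebraMap (ChartRing m i) _)) ≫
        Proj.awayι (chainGrading m) (var m i) (var_mem m i) one_pos) q = x := by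
  rw [← Proj.opensRange_awayι _ _ (var_mem m i) one_pos] at hx
  obtain ⟨q, rfl⟩ := hx
  have h1 : q ∈ Proj.awayι (chainGrading m) (var m i) (var_mem m i) one_pos ⁻¹ᵁ
    Proj.basicOpen (chainGrading m) (var m l) := hxl
  rw [Proj.awayι_preimage_basicOpen _ (var_mem m i) one_pos (var_mem m l) one_pos] at h1
  have h2 : Away.isLocalizationElem (var_mem m i) (var_mem m l) = ratio m i l := by
    simp only [Away.isLocalizationElem, pow_one]
    rfl
  rw [h2] at h1
  obtain ⟨q', hq'⟩ := (PrimeSpectrum.localization_away_comap_range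
    (Localization.Away (ratio m i l)) (ratio m i l)).ge h1
  exact ⟨q', (Scheme.Hom.comp_apply _ _ _).trans (congrArg _ hq')⟩

variable {D : Type} [CommRing D] [Algebra ℂ D] {z : ℕ → D}

/-- Recognition of charts and their principal open subsets. -/
theorem isOpenImmersion_chainPoint (hz : IsChain m z) (hi : z i = 1) {l : ℕ} (hl : IsUnit (z l))
    (θ : D →ₐ[ℂ] Localization.Away (ratio m i l))
    (hθ : ∀ k, θ (z k) = algebraMap _ _ (ratio m i k))
    (hD : ∀ f : D →ₐ[ℂ] D, (∀ k, f (z k) = z k) → f = AlgHom.id ℂ D) (hu : IsUnit (z i)) :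
    IsOpenImmersion (chainPoint hz hu).1 ∧
      ∀ x : Proj (chainGrading m), x ∈ Proj.basicOpen (chainGrading m) (var m i) →
        x ∈ Proj.basicOpen (chainGrading m) (var m l) → x ∈ Set.range (chainPoint hz hu).1 := by
  set f := awayEval (𝒜 := chainGrading m) (evalHom hz) (isUnit_evalHom_var hz hu) with hf
  have hfr : ∀ k, f (ratio m i k) = z k := fun k => by
    have := awayEval_ratio hz hu k
    rwa [hi, mul_one] at this
  let F : Localization.Away (ratio m i l) →ₐ[ℂ] D :=
    IsLocalization.liftAlgHom (M := Submonoid.powers (ratio m i l)) (f := f) (by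
      rintro ⟨_, n, rfl⟩
      rw [map_pow, hfr]
      exact hl.pow n)
  have hF : ∀ a, F (algebraMap _ _ a) = f a := fun a => IsLocalization.lift_eq _ _
  have h1 : θ.comp F = AlgHom.id ℂ _ := by
    refine IsLocalization.algHom_ext (Submonoid.powers (ratio m i l))
      (chartRing_algHom_ext fun k => ?_)
    change θ (F (algebraMap _ _ (ratio m i k))) = algebraMap _ _ (ratio m i k)
    rw [hF, hfr, hθ]
  -- The hypothesis `hD` says that an endomorphism of `D` is determined by fixing the coordinates.
  -- With `l = i` the lemma recognizes a full chart, with `l = i + 1` an overlap.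
  have h2 : F.comp θ = AlgHom.id ℂ D := hD _ fun k => by
    rw [AlgHom.comp_apply, hθ, hF, hfr]
  let e : Localization.Away (ratio m i l) ≃ₐ[ℂ] D := AlgEquiv.ofAlgHom F θ h2 h1
  have : IsIso (CommRingCat.ofHom (F : Localization.Away (ratio m i l) →+* D)) :=
    e.toRingEquiv.toCommRingCatIso.isIso_hom
  have hg : (chainPoint hz hu).1 =
      Spec.map (CommRingCat.ofHom (F : Localization.Away (ratio m i l) →+* D)) ≫
        Spec.map (CommRingCat.ofHom (algebraMap (ChartRing m i) _)) ≫
        Proj.awayι (chainGrading m) (var m i) (var_mem m i) one_pos := by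
    rw [← Category.assoc, ← Spec.map_comp, ← CommRingCat.ofHom_comp]
    simp only [chainPoint, homPoint]
    congr 3
    ext a
    exact (hF a).symm
  rw [hg]
  refine ⟨inferInstance, fun x hx hxl => ?_⟩
  obtain ⟨q, hq⟩ := exists_eq_awayι l hx hxl
  obtain ⟨p, hp⟩ := (Spec.map (CommRingCat.ofHom
    (F : Localization.Away (ratio m i l) →+* D))).homeomorph.surjective q
  refine ⟨p, ?_⟩
  rw [Scheme.Hom.comp_apply, ← hq]
  exact congrArg _ hp

theorem isChain_nodeTuple (h1 : 2 ≤ i) (h2 : i + 1 ≤ m) :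
    IsChain m (chartTuple i coordX coordY) := by
  have h : IsChart (m - i) (i - 1) coordX coordY :=
    ⟨coordX_mul_coordY, by omega, by omega⟩
  have := isChain_chartTuple h
  rwa [show m - i + (i - 1) + 1 = m by omega, show i - 1 + 1 = i by omega] at this

/-- The chart of the chain with a node. -/
def nodeChart (h1 : 2 ≤ i) (h2 : i + 1 ≤ m) : Points (projHom (chainGrading m)) NodeCoord :=
  chainPoint (i := i) (isChain_nodeTuple h1 h2) (isUnit_chartTuple _ _ _)

theorem ratio_eq_zero {k : ℕ} (h : i + 2 ≤ k ∨ k + 2 ≤ i) : ratio m i k = 0 := by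
  rcases h with h | h
  · rw [← one_mul (ratio m i k), ← ratio_self m i, (isChain_ratio m i).mul_eq_zero _ _ h]
  · rw [← mul_one (ratio m i k), ← ratio_self m i, (isChain_ratio m i).mul_eq_zero _ _ h]

/-- In an inner chart the two neighbours of the normalized coordinate are free apart from having
product zero, and all other coordinates vanish. -/
theorem nodeChart_spec (h1 : 2 ≤ i) (h2 : i + 1 ≤ m) : IsOpenImmersion (nodeChart h1 h2).1 ∧
    ∀ x : Proj (chainGrading m), x ∈ Proj.basicOpen (chainGrading m) (var m i) →
      x ∈ Set.range (nodeChart h1 h2).1 := by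
  have key := isOpenImmersion_chainPoint (isChain_nodeTuple h1 h2) (chartTuple_self _ _ _)
    (isUnit_chartTuple i coordX coordY)
    ((Algebra.algHom ℂ (ChartRing m i) (Localization.Away (ratio m i i))).comp
      (coordLift (ratio m i (i - 1)) (ratio m i (i + 1))
        ((isChain_ratio m i).mul_eq_zero _ _ (by omega)))) (fun k => by
      rw [AlgHom.comp_apply]
      change algebraMap _ _ _ = _
      congr 1
      unfold chartTuple
      split_ifs with h3 h4 h5
      · rw [map_one, h3, ratio_self]
      · rw [coordLift_coordX, ← h4, Nat.add_sub_cancel]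
      · rw [coordLift_coordY, h5]
      · rw [map_zero, ratio_eq_zero (by omega)]) (fun f hf => coord_algHom_ext (by
        have := hf (i - 1)
        rwa [chartTuple_pred (by omega)] at this) (by
        have := hf (i + 1)
        rwa [chartTuple_succ] at this)) (isUnit_chartTuple _ _ _)
  exact ⟨key.1, fun x hx => key.2 x hx hx⟩

/-- At the first index the left neighbour is `z_0 = 0`, so a single free coordinate remains. -/
theorem firstChart_spec (hm : 1 + 1 ≤ m) :
    IsOpenImmersion (lineZero (Polynomial ℂ) (le_refl 1) hm Polynomial.X).1 ∧
    ∀ x : Proj (chainGrading m), x ∈ Proj.basicOpen (chainGrading m) (var m 1) →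
      x ∈ Set.range (lineZero (Polynomial ℂ) (le_refl 1) hm Polynomial.X).1 := by
  have key := isOpenImmersion_chainPoint
    (isChain_chartTuple_zero (c := (Polynomial.X : Polynomial ℂ)) (le_refl 1) (by omega)
      (by omega)) (chartTuple_self _ _ _)
    (isUnit_chartTuple 1 0 Polynomial.X)
    (Polynomial.aeval (algebraMap _ (Localization.Away (ratio m 1 1)) (ratio m 1 2))) (fun k => by
      unfold chartTuple
      split_ifs with h3 h4 h5
      · rw [map_one, h3, ratio_self, map_one]
      · rw [map_zero, show k = 0 by omega, (isChain_ratio m 1).zero, map_zero]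
      · rw [Polynomial.aeval_X, h5]
      · rw [map_zero, ratio_eq_zero (k := k) (by omega), map_zero]) (fun f hf => Polynomial.algHom_ext (by
        have := hf (1 + 1)
        rwa [chartTuple_succ] at this)) (isUnit_chartTuple _ _ _)
  exact ⟨key.1, fun x hx => key.2 x hx hx⟩

theorem lastChart_spec (h1 : 1 ≤ i) (hm : i + 1 = m) :
    IsOpenImmersion (lineInfinity (Polynomial ℂ) h1 hm.le Polynomial.X).1 ∧
    ∀ x : Proj (chainGrading m), x ∈ Proj.basicOpen (chainGrading m) (var m m) →
      x ∈ Set.range (lineInfinity (Polynomial ℂ) h1 hm.le Polynomial.X).1 := by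
  have key := isOpenImmersion_chainPoint
    (isChain_chartTuple_succ h1 hm.le (Polynomial.X : Polynomial ℂ)) (chartTuple_self _ _ _)
    (isUnit_chartTuple (i + 1) Polynomial.X 0)
    (Polynomial.aeval (algebraMap _ (Localization.Away (ratio m (i + 1) (i + 1)))
      (ratio m (i + 1) i))) (fun k => by
      unfold chartTuple
      split_ifs with h3 h4 h5
      · rw [map_one, h3, ratio_self, map_one]
      · rw [Polynomial.aeval_X, show k = i by omega]
      · rw [map_zero, (isChain_ratio m (i + 1)).large k (by omega), map_zero]
      · rw [map_zero, ratio_eq_zero (k := k) (by omega), map_zero]) (fun f hf => Polynomial.algHom_ext (by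
        have := hf (i + 1 - 1)
        rwa [chartTuple_pred (by omega)] at this)) (isUnit_chartTuple _ _ _)
  refine ⟨key.1, fun x hx => ?_⟩
  subst hm
  exact key.2 x hx hx

/-- The coordinate of the punctured affine line. -/
def puncturedX : PuncturedLine := algebraMap (Polynomial ℂ) PuncturedLine Polynomial.X

theorem isUnit_puncturedX : IsUnit puncturedX :=
  IsLocalization.Away.algebraMap_isUnit _

/-- Where `z_(i+1)` is also invertible it annihilates `z_(i-1)`, and only one invertible coordinate
is left. -/
theorem overlap_spec (h1 : 1 ≤ i) (h2 : i + 1 ≤ m) :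
    IsOpenImmersion (lineZero PuncturedLine h1 h2 puncturedX).1 ∧
    ∀ x : Proj (chainGrading m), x ∈ Proj.basicOpen (chainGrading m) (var m i) →
      x ∈ Proj.basicOpen (chainGrading m) (var m (i + 1)) →
      x ∈ Set.range (lineZero PuncturedLine h1 h2 puncturedX).1 := by
  have hr : IsUnit (algebraMap (ChartRing m i) (Localization.Away (ratio m i (i + 1)))
    (ratio m i (i + 1))) := IsLocalization.Away.algebraMap_isUnit _
  let θ : PuncturedLine →ₐ[ℂ] Localization.Away (ratio m i (i + 1)) :=
    IsLocalization.liftAlgHom (M := Submonoid.powers (Polynomial.X : Polynomial ℂ))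
      (f := Polynomial.aeval (algebraMap _ _ (ratio m i (i + 1)))) (by
        rintro ⟨_, n, rfl⟩
        rw [map_pow, Polynomial.aeval_X]
        exact hr.pow n)
  have hθ : θ puncturedX = algebraMap _ _ (ratio m i (i + 1)) :=
    (IsLocalization.lift_eq _ _).trans (Polynomial.aeval_X _)
  refine isOpenImmersion_chainPoint
    (isChain_chartTuple_zero (c := puncturedX) h1
      (by omega) (by omega)) (chartTuple_self _ _ _)
    (by rw [chartTuple_succ]; exact isUnit_puncturedX) θ (fun k => ?_) (fun f hf => ?_)
    (isUnit_chartTuple _ _ _)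
  · unfold chartTuple
    split_ifs with h3 h4 h5
    · rw [map_one, h3, ratio_self, map_one]
    · rw [map_zero, eq_comm]
      refine hr.mul_left_cancel ?_
      rw [← map_mul, mul_comm, (isChain_ratio m i).mul_eq_zero _ _ (by omega), map_zero, mul_zero]
    · rw [hθ, h5]
    · rw [map_zero, ratio_eq_zero (k := k) (by omega), map_zero]
  · refine IsLocalization.algHom_ext (Submonoid.powers (Polynomial.X : Polynomial ℂ)) (Polynomial.algHom_ext ?_)
    have := hf (i + 1)
    rwa [chartTuple_succ] at this

theorem isReduced_chain (hm : 2 ≤ m) : IsReduced (Proj (chainGrading m)) := by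
  refine isReduced_of_points (π := projHom (chainGrading m)) fun x => ?_
  obtain ⟨k, h1, h2, hk⟩ := exists_mem_basicOpen x
  by_cases hk1 : k = 1
  · subst hk1
    exact ⟨Polynomial ℂ, _, _, inferInstance, _, (firstChart_spec hm).1,
      (firstChart_spec hm).2 x hk⟩
  by_cases hkm : k = m
  · subst hkm
    have h := lastChart_spec (i := k - 1) (m := k) (by omega) (by omega)
    exact ⟨Polynomial ℂ, _, _, inferInstance, _, h.1, h.2 x hk⟩
  · have h := nodeChart_spec (i := k) (m := m) (by omega) (by omega)
    exact ⟨NodeCoord, _, _, inferInstance, _, h.1, h.2 x hk⟩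

/-- A point of an inner chart other than its node has an adjacent nonzero coordinate, so it lies in
an overlap, which is a punctured line; the end charts are affine lines. -/
theorem isSmoothCurveAt_chain (hm : 2 ≤ m) (x : Proj (chainGrading m))
    (hx : ∀ i, 2 ≤ i → i ≤ m - 1 →
      ∃ k, k ≠ i ∧ x ∈ Proj.basicOpen (chainGrading m) (var m k)) :
    IsSmoothCurveAt (projHom (chainGrading m)) x := by
  obtain ⟨k, h1, h2, hk⟩ := exists_mem_basicOpen x
  by_cases hk1 : k = 1
  · subst hk1
    obtain ⟨h3, h4⟩ := firstChart_spec hm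
    exact isSmoothCurveAt_of_mem_range _ (h4 x hk)
  by_cases hkm : k = m
  · subst hkm
    obtain ⟨h3, h4⟩ := lastChart_spec (i := k - 1) (m := k) (by omega) (by omega)
    exact isSmoothCurveAt_of_mem_range _ (h4 x hk)
  obtain ⟨l, hlk, hl⟩ := hx k (by omega) (by omega)
  have hlk' : ¬ (k + 2 ≤ l ∨ l + 2 ≤ k) := fun h => notMem_basicOpen_of_mem hk h hl
  rcases (show l = k + 1 ∨ k = l + 1 by omega) with rfl | rfl
  · obtain ⟨h3, h4⟩ := overlap_spec (i := k) (m := m) h1 (by omega)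
    exact isSmoothCurveAt_of_mem_range _ (h4 x hk hl)
  · obtain ⟨h3, h4⟩ := overlap_spec (i := l) (m := m) (by omega) (by omega)
    exact isSmoothCurveAt_of_mem_range _ (h4 x hl hk)

theorem maximalIdeal_originIdeal : originIdeal.IsMaximal := by
  rw [originIdeal_eq_ker]
  exact RingHom.ker_isMaximal_of_surjective _ fun c => ⟨algebraMap ℂ _ c, evalOrigin_algebraMap c⟩

theorem exists_nodeChart_eq (h1 : 2 ≤ i) (h2 : i + 1 ≤ m) (x : Proj (chainGrading m))
    (hx : ∀ k, k ≠ i → x ∉ Proj.basicOpen (chainGrading m) (var m k)) :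
    (nodeChart h1 h2).1 ⟨originIdeal, originIdeal_isPrime⟩ = x := by
  obtain ⟨k, -, -, hk⟩ := exists_mem_basicOpen x
  obtain rfl : k = i := by
    by_contra h
    exact hx k h hk
  obtain ⟨p, rfl⟩ := (nodeChart_spec h1 h2).2 x hk
  have h3 : ∀ l, l ≠ k → chartTuple k coordX coordY l ∈ p.asIdeal := fun l hl => by
    by_contra h
    exact hx l hl ((chainPoint_mem_basicOpen _ _ l p).mpr h)
  have h4 : originIdeal ≤ p.asIdeal := by
    rw [originIdeal, Ideal.span_le]
    rintro _ (rfl | rfl)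
    · have := h3 (k - 1) (by omega)
      rwa [chartTuple_pred (by omega)] at this
    · have := h3 (k + 1) (by omega)
      rwa [chartTuple_succ] at this
  have h5 := maximalIdeal_originIdeal.eq_of_le p.isPrime.ne_top h4
  congr 1
  exact PrimeSpectrum.ext h5

end Charts

end NodeHilb

end

noncomputable section

namespace NodeHilb

/-! ### Power series on the two branches of a node -/

section Branches

open PowerSeries

/-- Restriction of a power series in two variables to a coordinate axis. -/
def axisHom (s : Fin 2) : MvPowerSeries (Fin 2) ℂ →+* ℂ⟦X⟧ where
  toFun F := PowerSeries.mk fun n => MvPowerSeries.coeff (Finsupp.single s n) F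
  map_one' := by
    ext n
    rw [coeff_mk, MvPowerSeries.coeff_one, PowerSeries.coeff_one]
    simp
  map_mul' F G := by
    ext n
    rw [coeff_mk, MvPowerSeries.coeff_mul, PowerSeries.coeff_mul, Finsupp.antidiagonal_single,
      Finset.sum_map]
    simp
  map_zero' := by
    ext n
    simp
  map_add' F G := by
    ext n
    simp

theorem coeff_axisHom (s : Fin 2) (F : MvPowerSeries (Fin 2) ℂ) (n : ℕ) :
    coeff n (axisHom s F) = MvPowerSeries.coeff (Finsupp.single s n) F :=
  coeff_mk n fun n => MvPowerSeries.coeff (Finsupp.single s n) F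

theorem constantCoeff_axisHom (s : Fin 2) (F : MvPowerSeries (Fin 2) ℂ) :
    constantCoeff (axisHom s F) = MvPowerSeries.constantCoeff F := by
  rw [← coeff_zero_eq_constantCoeff_apply, coeff_axisHom, Finsupp.single_zero,
    MvPowerSeries.coeff_zero_eq_constantCoeff_apply]

/-- The exponent of `X 0 * X 1`. -/
def crossExponent : Fin 2 →₀ ℕ := Finsupp.single 0 1 + Finsupp.single 1 1

theorem X_mul_X_eq : (MvPowerSeries.X 0 * MvPowerSeries.X 1 : MvPowerSeries (Fin 2) ℂ) =
    MvPowerSeries.monomial crossExponent 1 := by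
  rw [MvPowerSeries.X, MvPowerSeries.X, MvPowerSeries.monomial_mul_monomial, one_mul,
    crossExponent]

theorem crossExponent_le_iff (d : Fin 2 →₀ ℕ) : crossExponent ≤ d ↔ 1 ≤ d 0 ∧ 1 ≤ d 1 := by
  rw [Finsupp.le_def, Fin.forall_fin_two]
  simp [crossExponent]

theorem eq_single_of_not_le {d : Fin 2 →₀ ℕ} (h : ¬ crossExponent ≤ d) :
    ∃ s, d = Finsupp.single s (d s) := by
  rw [crossExponent_le_iff, not_and_or, Nat.one_le_iff_ne_zero, Nat.one_le_iff_ne_zero, not_not,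
    not_not] at h
  rcases h with h | h
  · refine ⟨1, Finsupp.ext fun k => ?_⟩
    fin_cases k <;> simp [h]
  · refine ⟨0, Finsupp.ext fun k => ?_⟩
    fin_cases k <;> simp [h]

/-- A series is divisible by `X 0 * X 1` exactly when it has no pure powers, since an exponent that
is not divisible by the cross term lies on an axis. -/
theorem mem_span_iff_axisHom (F : MvPowerSeries (Fin 2) ℂ) :
    F ∈ Ideal.span {(MvPowerSeries.X 0 * MvPowerSeries.X 1 : MvPowerSeries (Fin 2) ℂ)} ↔
      ∀ s, axisHom s F = 0 := by
  rw [X_mul_X_eq, Ideal.mem_span_singleton]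
  constructor
  · rintro ⟨G, rfl⟩ s
    ext n
    rw [coeff_axisHom, MvPowerSeries.coeff_monomial_mul, if_neg, map_zero]
    rw [crossExponent_le_iff]
    fin_cases s <;> simp
  · intro h
    let G : MvPowerSeries (Fin 2) ℂ := fun d => MvPowerSeries.coeff (d + crossExponent) F
    have hG : ∀ d, MvPowerSeries.coeff d G = MvPowerSeries.coeff (d + crossExponent) F :=
      fun _ => rfl
    refine ⟨G, ?_⟩
    ext d
    rw [MvPowerSeries.coeff_monomial_mul]
    split_ifs with hd
    · rw [one_mul, hG]
      exact congrArg (fun e => MvPowerSeries.coeff e F) (tsub_add_cancel_of_le hd).symm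
    · obtain ⟨s, hs⟩ := eq_single_of_not_le hd
      rw [hs, ← coeff_axisHom, h, map_zero]

/-- The two branches of the formal node. -/
def branchHom : (MvPowerSeries (Fin 2) ℂ ⧸
    Ideal.span {(MvPowerSeries.X 0 * MvPowerSeries.X 1 : MvPowerSeries (Fin 2) ℂ)}) →+*
      ℂ⟦X⟧ × ℂ⟦X⟧ :=
  Ideal.Quotient.lift _ ((axisHom 0).prod (axisHom 1)) fun F hF => by
    rw [mem_span_iff_axisHom] at hF
    simp [hF]

theorem branchHom_mk (F : MvPowerSeries (Fin 2) ℂ) :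
    branchHom (Ideal.Quotient.mk _ F) = (axisHom 0 F, axisHom 1 F) := rfl

theorem branchHom_injective : Function.Injective branchHom := by
  rw [injective_iff_map_eq_zero]
  intro x hx
  obtain ⟨F, rfl⟩ := Ideal.Quotient.mk_surjective x
  rw [branchHom_mk, Prod.mk_eq_zero] at hx
  rw [Ideal.Quotient.eq_zero_iff_mem, mem_span_iff_axisHom, Fin.forall_fin_two]
  exact hx

theorem branchHom_algebraMap (c : ℂ) : branchHom (algebraMap ℂ _ c) = (C c, C c) := by
  have h : ∀ s, axisHom s (algebraMap ℂ _ c) = C c := fun s => by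
    ext n
    rw [coeff_axisHom, MvPowerSeries.algebraMap_apply, Algebra.algebraMap_self, RingHom.id_apply,
      MvPowerSeries.coeff_C, PowerSeries.coeff_C]
    simp
  exact Prod.ext (h 0) (h 1)

/-- The formal node is the fibre product of its two branches over the residue field; a preimage is
assembled from the coefficients on the two axes. -/
theorem mem_range_branchHom (p : ℂ⟦X⟧ × ℂ⟦X⟧) :
    p ∈ Set.range branchHom ↔ constantCoeff p.1 = constantCoeff p.2 := by
  constructor
  · rintro ⟨x, rfl⟩
    obtain ⟨F, rfl⟩ := Ideal.Quotient.mk_surjective x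
    rw [branchHom_mk, constantCoeff_axisHom, constantCoeff_axisHom]
  · intro h
    let F : MvPowerSeries (Fin 2) ℂ := fun d => if d 1 = 0 then coeff (d 0) p.1 else coeff (d 1) p.2
    have hF : ∀ d, MvPowerSeries.coeff d F =
      if d 1 = 0 then coeff (d 0) p.1 else coeff (d 1) p.2 := fun _ => rfl
    refine ⟨Ideal.Quotient.mk _ F, Prod.ext ?_ ?_⟩
    · ext n
      rw [branchHom_mk, coeff_axisHom, hF]
      simp
    · ext n
      rw [branchHom_mk, coeff_axisHom, hF]
      rcases Nat.eq_zero_or_pos n with rfl | hn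
      · simpa using h
      · simp [hn.ne']

end Branches

/-! ### Completions from expansions -/

section Completion

open PowerSeries

variable {L : Type} [CommRing L] (I : Ideal L) (φ : L →+* ℂ⟦X⟧)

theorem pow_le_comap_span {I : Ideal L} {φ : L →+* ℂ⟦X⟧}
    (h : ∀ n, ∀ r ∈ I ^ n, X ^ n ∣ φ r) (n : ℕ) :
    I ^ n ≤ (Ideal.span {(X : ℂ⟦X⟧)} ^ n).comap φ := fun r hr => by
  rw [Ideal.mem_comap, Ideal.span_singleton_pow, Ideal.mem_span_singleton]
  exact h n r hr

variable {I φ}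

/-- The map from the completion to the truncations of an expansion. -/
def truncationHom (h : ∀ n, ∀ r ∈ I ^ n, X ^ n ∣ φ r) (n : ℕ) :
    AdicCompletion I L →+* ℂ⟦X⟧ ⧸ Ideal.span {(X : ℂ⟦X⟧)} ^ n :=
  (Ideal.quotientMap _ φ (pow_le_comap_span h n)).comp
    (AdicCompletion.evalₐ I n : AdicCompletion I L →+* L ⧸ I ^ n)

theorem truncationHom_mk (h : ∀ n, ∀ r ∈ I ^ n, X ^ n ∣ φ r) (n : ℕ) (a : AdicCompletion I L)
    (r : L) (hr : AdicCompletion.evalₐ I n a = Ideal.Quotient.mk _ r) :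
    truncationHom h n a = Ideal.Quotient.mk _ (φ r) := by
  change Ideal.quotientMap _ φ (pow_le_comap_span h n) (AdicCompletion.evalₐ I n a) = _
  rw [hr, Ideal.quotientMap_mk]

theorem factorPow_comp_truncationHom (h : ∀ n, ∀ r ∈ I ^ n, X ^ n ∣ φ r) {m n : ℕ}
    (hmn : m ≤ n) :
    (Ideal.Quotient.factorPow (Ideal.span {(X : ℂ⟦X⟧)}) hmn).comp (truncationHom h n) = truncationHom h m := by
  ext a
  obtain ⟨r, rfl⟩ := AdicCompletion.mk_surjective I L a
  rw [RingHom.comp_apply, truncationHom_mk h n _ _ (AdicCompletion.evalₐ_mk I n r),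
    truncationHom_mk h m _ _ ((AdicCompletion.evalₐ_mk I m r).trans
      (AdicCompletion.Ideal.mk_eq_mk I hmn r).symm)]
  rfl

/-- The extension of an expansion to the completion. -/
def completionHom (h : ∀ n, ∀ r ∈ I ^ n, X ^ n ∣ φ r) : AdicCompletion I L →+* ℂ⟦X⟧ :=
  IsAdicComplete.liftRingHom (Ideal.span {(X : ℂ⟦X⟧)}) (truncationHom h)
    (factorPow_comp_truncationHom h)

theorem mk_completionHom (h : ∀ n, ∀ r ∈ I ^ n, X ^ n ∣ φ r) (n : ℕ) (a : AdicCompletion I L)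
    (r : L) (hr : AdicCompletion.evalₐ I n a = Ideal.Quotient.mk _ r) :
    X ^ n ∣ completionHom h a - φ r := by
  rw [← Ideal.mem_span_singleton, ← Ideal.span_singleton_pow,
    ← Ideal.Quotient.mk_eq_mk_iff_sub_mem, ← truncationHom_mk h n a r hr]
  exact IsAdicComplete.mk_liftRingHom _ _ (factorPow_comp_truncationHom h) n a

theorem eq_of_forall_X_pow_dvd {f g : ℂ⟦X⟧} (h : ∀ n, X ^ n ∣ f - g) : f = g := by
  ext n
  have := X_pow_dvd_iff.mp (h (n + 1)) n (Nat.lt_succ_self n)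
  rwa [map_sub, sub_eq_zero] at this

theorem completionHom_algebraMap (h : ∀ n, ∀ r ∈ I ^ n, X ^ n ∣ φ r) (r : L) :
    completionHom h (algebraMap L _ r) = φ r :=
  eq_of_forall_X_pow_dvd fun n => mk_completionHom h n _ r (by
    rw [AlgHom.commutes]; rfl)

/-- A ring with compatible expansions along two branches has the completion of a node. -/
theorem exists_completion_equiv {φ ψ : L →+* ℂ⟦X⟧}
    (h : ∀ n r, r ∈ I ^ n ↔ X ^ n ∣ φ r ∧ X ^ n ∣ ψ r)
    (hc : ∀ r, constantCoeff (φ r) = constantCoeff (ψ r))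
    (hd : ∀ f g : ℂ⟦X⟧, constantCoeff f = constantCoeff g → ∀ n, ∃ r,
      X ^ n ∣ φ r - f ∧ X ^ n ∣ ψ r - g) :
    ∃ e : AdicCompletion I L ≃+* (MvPowerSeries (Fin 2) ℂ ⧸
        Ideal.span {(MvPowerSeries.X 0 * MvPowerSeries.X 1 : MvPowerSeries (Fin 2) ℂ)}),
      ∀ a, branchHom (e (algebraMap L _ a)) = (φ a, ψ a) := by
  have hφ : ∀ n, ∀ r ∈ I ^ n, X ^ n ∣ φ r := fun n r hr => ((h n r).mp hr).1
  have hψ : ∀ n, ∀ r ∈ I ^ n, X ^ n ∣ ψ r := fun n r hr => ((h n r).mp hr).2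
  let Φ : AdicCompletion I L →+* ℂ⟦X⟧ × ℂ⟦X⟧ := (completionHom hφ).prod (completionHom hψ)
  -- An element whose two expansions vanish has representatives divisible by `X^n` on both branches,
  -- hence in `I^n`, for every `n`.
  have hΦ : Function.Injective Φ := by
    rw [injective_iff_map_eq_zero]
    intro a ha
    refine AdicCompletion.ext_evalₐ fun n => ?_
    obtain ⟨r, hr⟩ := Ideal.Quotient.mk_surjective (AdicCompletion.evalₐ I n a)
    have h1 := mk_completionHom hφ n a r hr.symm
    have h2 := mk_completionHom hψ n a r hr.symm
    rw [show completionHom hφ a = 0 from congrArg Prod.fst ha, zero_sub, dvd_neg] at h1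
    rw [show completionHom hψ a = 0 from congrArg Prod.snd ha, zero_sub, dvd_neg] at h2
    rw [map_zero, ← hr, Ideal.Quotient.eq_zero_iff_mem, h]
    exact ⟨h1, h2⟩
  have hr : ∀ p, p ∈ Set.range Φ ↔ constantCoeff p.1 = constantCoeff p.2 := by
    intro p
    constructor
    · rintro ⟨a, rfl⟩
      obtain ⟨r, hr⟩ := Ideal.Quotient.mk_surjective (AdicCompletion.evalₐ I 1 a)
      have h1 := mk_completionHom hφ 1 a r hr.symm
      have h2 := mk_completionHom hψ 1 a r hr.symm
      rw [pow_one, X_dvd_iff, map_sub, sub_eq_zero] at h1 h2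
      exact h1.trans ((hc r).trans h2.symm)
    · intro hp
      -- Approximations of the pair modulo `X^n` differ by elements of `I^n`, so they form a Cauchy
      -- sequence whose limit maps to the pair.
      choose r hr1 hr2 using hd p.1 p.2 hp
      have hr3 : ∀ n, r n - r (n + 1) ∈ I ^ n := fun n => by
        rw [h, map_sub, map_sub]
        constructor
        · rw [← sub_sub_sub_cancel_right _ _ p.1]
          exact dvd_sub (hr1 n) ((pow_dvd_pow _ n.le_succ).trans (hr1 (n + 1)))
        · rw [← sub_sub_sub_cancel_right _ _ p.2]
          exact dvd_sub (hr2 n) ((pow_dvd_pow _ n.le_succ).trans (hr2 (n + 1)))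
      let a : AdicCompletion I L := AdicCompletion.mk I L
        (AdicCompletion.AdicCauchySequence.mk I L r fun n => by
          rw [SModEq.sub_mem, smul_eq_mul, Ideal.mul_top]
          exact hr3 n)
      have ha : ∀ n, AdicCompletion.evalₐ I n a = Ideal.Quotient.mk _ (r n) := fun n =>
        AdicCompletion.evalₐ_mk I n _
      refine ⟨a, Prod.ext ?_ ?_⟩
      · refine eq_of_forall_X_pow_dvd fun n => ?_
        rw [← sub_add_sub_cancel _ (φ (r n))]
        exact dvd_add (mk_completionHom hφ n a _ (ha n)) (hr1 n)
      · refine eq_of_forall_X_pow_dvd fun n => ?_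
        rw [← sub_add_sub_cancel _ (ψ (r n))]
        exact dvd_add (mk_completionHom hψ n a _ (ha n)) (hr2 n)
  -- The completion and the formal node embed in the same product with the same image, the pairs
  -- with equal constant terms.
  have hrange : Φ.range = branchHom.range := SetLike.coe_injective (Set.ext fun p =>
    (hr p).trans (mem_range_branchHom p).symm)
  let e1 := RingEquiv.ofBijective Φ.rangeRestrict
    ⟨fun a b hab => hΦ (congrArg Subtype.val hab), Φ.rangeRestrict_surjective⟩
  let e2 := RingEquiv.ofBijective branchHom.rangeRestrict
    ⟨fun a b hab => branchHom_injective (congrArg Subtype.val hab),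
      branchHom.rangeRestrict_surjective⟩
  refine ⟨(e1.trans (RingEquiv.subringCongr hrange)).trans e2.symm, fun a => ?_⟩
  have h1 : branchHom (e2.symm (RingEquiv.subringCongr hrange (e1 (algebraMap L _ a)))) =
      (e2 (e2.symm (RingEquiv.subringCongr hrange (e1 (algebraMap L _ a)))) : ℂ⟦X⟧ × ℂ⟦X⟧) := rfl
  refine h1.trans ?_
  rw [RingEquiv.apply_symm_apply]
  exact Prod.ext (completionHom_algebraMap hφ a) (completionHom_algebraMap hψ a)

end Completion

end NodeHilb

end

noncomputable section

namespace NodeHilb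

/-! ### The nodes of the chain -/

section Node

open PowerSeries

/-- If both expansions vanish to order `n`, the Taylor truncation is zero and only the remainder in
`(x^n, y^n)` is left. So the powers of the maximal ideal are the orders of vanishing on the
branches. -/
theorem mem_maximalIdeal_pow_iff (n : ℕ) (r : NodeRing) :
    r ∈ IsLocalRing.maximalIdeal NodeRing ^ n ↔ X ^ n ∣ expandX r ∧ X ^ n ∣ expandY r := by
  constructor
  · have key : ∀ φ : NodeRing →ₐ[ℂ] ℂ⟦X⟧, X ∣ φ nx → X ∣ φ ny →
        IsLocalRing.maximalIdeal NodeRing ^ n ≤ (Ideal.span {(X : ℂ⟦X⟧) ^ n}).comap φ := by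
      intro φ hx hy
      rw [← Ideal.span_singleton_pow]
      refine le_trans (Ideal.pow_right_mono ?_ n) (Ideal.le_comap_pow φ n)
      rw [maximalIdeal_eq, Ideal.span_le]
      rintro _ (rfl | rfl)
      · exact Ideal.mem_span_singleton.mpr hx
      · exact Ideal.mem_span_singleton.mpr hy
    intro hr
    exact ⟨Ideal.mem_span_singleton.mp (key expandX (by simp) (by simp) hr),
      Ideal.mem_span_singleton.mp (key expandY (by simp) (by simp) hr)⟩
  · rintro ⟨hx, hy⟩
    rcases Nat.eq_zero_or_pos n with rfl | hn
    · simp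
    obtain ⟨k, rfl⟩ : ∃ k, n = k + 1 := ⟨n - 1, by omega⟩
    have h0 : taylor (k + 1) k r = 0 := by
      rw [taylor, Finset.sum_eq_zero, Finset.sum_eq_zero, add_zero]
      · intro j hj
        rw [Finset.mem_range] at hj
        rw [coeffY_apply, X_pow_dvd_iff.mp hy (j + 1) (by omega), zero_smul]
      · intro j hj
        rw [Finset.mem_range] at hj
        rw [coeffX_apply, X_pow_dvd_iff.mp hx j hj, zero_smul]
    have h1 := sub_taylor_mem k k r
    rw [h0, sub_zero] at h1
    refine (Ideal.span_le.mpr ?_) h1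
    have hx' : nx ∈ IsLocalRing.maximalIdeal NodeRing := by
      rw [maximalIdeal_eq]
      exact Ideal.subset_span (Or.inl rfl)
    have hy' : ny ∈ IsLocalRing.maximalIdeal NodeRing := by
      rw [maximalIdeal_eq]
      exact Ideal.subset_span (Or.inr rfl)
    rintro _ (rfl | rfl)
    · exact Ideal.pow_mem_pow hx' _
    · exact Ideal.pow_mem_pow hy' _

theorem exists_expand_sub_dvd (f g : ℂ⟦X⟧) (h : constantCoeff f = constantCoeff g) (n : ℕ) :
    ∃ r, X ^ n ∣ expandX r - f ∧ X ^ n ∣ expandY r - g := by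
  rcases Nat.eq_zero_or_pos n with rfl | hn
  · exact ⟨0, by simp, by simp⟩
  have key : ∀ f : ℂ⟦X⟧, X ^ n ∣ (trunc n f : ℂ⟦X⟧) - f := fun f => by
    rw [X_pow_dvd_iff]
    intro k hk
    rw [map_sub, Polynomial.coeff_coe, coeff_trunc, if_pos hk, sub_self]
  have hX : ∀ p : Polynomial ℂ, Polynomial.aeval (X : ℂ⟦X⟧) p = p := fun p => by
    induction p using Polynomial.induction_on' with
    | add p q hp hq => rw [map_add, hp, hq, Polynomial.coe_add]
    | monomial k c =>
      rw [Polynomial.aeval_monomial, Polynomial.coe_monomial, monomial_eq_C_mul_X_pow]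
      rfl
  have h0 : ∀ f : ℂ⟦X⟧, Polynomial.aeval (0 : ℂ⟦X⟧) (trunc n f) =
      algebraMap ℂ _ (constantCoeff f) := fun f => by
    rw [← Polynomial.coeff_zero_eq_aeval_zero', coeff_trunc, if_pos hn,
      coeff_zero_eq_constantCoeff_apply]
  -- The function `f(x) + g(y) - f(0)`, with `f` and `g` truncated: on each branch the other series
  -- contributes its constant term, which is then subtracted.
  refine ⟨Polynomial.aeval nx (trunc n f) + Polynomial.aeval ny (trunc n g) -
    algebraMap ℂ _ (constantCoeff f), ?_, ?_⟩
  · rw [map_sub, map_add, ← Polynomial.aeval_algHom_apply, ← Polynomial.aeval_algHom_apply,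
      expandX_nx, expandX_ny, hX, h0, AlgHom.commutes, h, add_sub_cancel_right]
    exact key f
  · rw [map_sub, map_add, ← Polynomial.aeval_algHom_apply, ← Polynomial.aeval_algHom_apply,
      expandY_nx, expandY_ny, hX, h0, AlgHom.commutes, add_sub_cancel_left]
    exact key g

theorem map_maximalIdeal_pow {R S : Type} [CommRing R] [CommRing S] [IsLocalRing R]
    [IsLocalRing S] (e : R ≃+* S) (n : ℕ) (r : R) :
    e r ∈ IsLocalRing.maximalIdeal S ^ n ↔ r ∈ IsLocalRing.maximalIdeal R ^ n := by
  have h : (IsLocalRing.maximalIdeal R).map e = IsLocalRing.maximalIdeal S :=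
    IsLocalRing.eq_maximalIdeal (Ideal.map_isMaximal_of_equiv e)
  rw [← h, ← Ideal.map_pow, Ideal.mem_map_of_equiv]
  simp

/-- The completion of the local ring of the node. -/
theorem exists_completion_equiv_of_equiv {L : Type} [CommRing L] [IsLocalRing L]
    (e : NodeRing ≃+* L) :
    ∃ E : AdicCompletion (IsLocalRing.maximalIdeal L) L ≃+* (MvPowerSeries (Fin 2) ℂ ⧸
        Ideal.span {(MvPowerSeries.X 0 * MvPowerSeries.X 1 : MvPowerSeries (Fin 2) ℂ)}),
      ∀ r, branchHom (E (algebraMap L _ (e r))) = (expandX r, expandY r) := by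
  let φ : L →+* ℂ⟦X⟧ := (expandX : NodeRing →+* ℂ⟦X⟧).comp (e.symm : L →+* NodeRing)
  let ψ : L →+* ℂ⟦X⟧ := (expandY : NodeRing →+* ℂ⟦X⟧).comp (e.symm : L →+* NodeRing)
  have hφ : ∀ r, φ (e r) = expandX r := fun r => congrArg expandX (e.symm_apply_apply r)
  have hψ : ∀ r, ψ (e r) = expandY r := fun r => congrArg expandY (e.symm_apply_apply r)
  obtain ⟨E, hE⟩ := exists_completion_equiv (I := IsLocalRing.maximalIdeal L) (φ := φ) (ψ := ψ)
    (fun n s => by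
      obtain ⟨r, rfl⟩ := e.surjective s
      rw [map_maximalIdeal_pow, hφ, hψ, mem_maximalIdeal_pow_iff])
    (fun s => by
      obtain ⟨r, rfl⟩ := e.surjective s
      rw [hφ, hψ, constantCoeff_expandX_eq])
    (fun f g h n => by
      obtain ⟨r, hr⟩ := exists_expand_sub_dvd f g h n
      exact ⟨e r, by rwa [hφ, hψ]⟩)
  exact ⟨E, fun r => by rw [hE, hφ, hψ]⟩

/-- A point with the local ring of the node is a node. -/
theorem isNodeAt_of_equiv {Y : Scheme.{0}} {π : Y ⟶ Spec (.of ℂ)} {z : Y}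
    (e : NodeRing ≃+* Y.presheaf.stalk z)
    (he : ∀ c, e (algebraMap ℂ NodeRing c) = stalkScalars π z c) : IsNodeAt π z := by
  obtain ⟨E, hE⟩ := exists_completion_equiv_of_equiv e
  refine ⟨E, fun c => branchHom_injective ?_⟩
  rw [← he, hE, branchHom_algebraMap, AlgHom.commutes, AlgHom.commutes]
  rfl

/-- Needed so that the isomorphism of completed local rings respects scalars and not only the ring
structure. -/
theorem stalkMap_stalkScalars {D : Type} [CommRing D] [Algebra ℂ D] {Y : Scheme.{0}}
    {π : Y ⟶ Spec (.of ℂ)} (f : Spec (.of D) ⟶ Y)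
    (hf : f ≫ π = Spec.map (CommRingCat.ofHom (algebraMap ℂ D))) (p : Spec (.of D)) (c : ℂ) :
    f.stalkMap p (stalkScalars π (f p) c) = StructureSheaf.toStalk D p (algebraMap ℂ D c) := by
  have h1 : π.appTop ≫ f.appTop = (Spec.map (CommRingCat.ofHom (algebraMap ℂ D))).appTop := by
    rw [← hf, Scheme.Hom.comp_appTop]
  have h2 := Scheme.Hom.germ_stalkMap f ⊤ p trivial
  have h3 := Scheme.ΓSpecIso_inv_naturality (CommRingCat.ofHom (algebraMap ℂ D))
  have k1 := DFunLike.congr_fun (congrArg CommRingCat.Hom.hom h1)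
    ((Scheme.ΓSpecIso (.of ℂ)).inv.hom c)
  have k2 := DFunLike.congr_fun (congrArg CommRingCat.Hom.hom h2)
    (π.appTop.hom ((Scheme.ΓSpecIso (.of ℂ)).inv.hom c))
  have k3 := DFunLike.congr_fun (congrArg CommRingCat.Hom.hom h3) c
  exact k2.trans (congrArg ((Spec (.of D)).presheaf.germ ⊤ p trivial).hom (k1.trans k3.symm))

/-- An open immersion identifies stalks, and the stalk of `Spec NodeCoord` at the origin is the
localization that defines `NodeRing`. -/
theorem isNodeAt_of_isOpenImmersion {Y : Scheme.{0}} {π : Y ⟶ Spec (.of ℂ)}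
    (g : Points π NodeCoord) [IsOpenImmersion g.1] :
    IsNodeAt π (g.1 ⟨originIdeal, originIdeal_isPrime⟩) := by
  set p : Spec (.of NodeCoord) := ⟨originIdeal, originIdeal_isPrime⟩ with hp
  let e1 := (asIso (g.1.stalkMap p)).commRingCatIsoToRingEquiv
  let _ : Algebra NodeCoord ((Spec (.of NodeCoord)).presheaf.stalk p) :=
    StructureSheaf.stalkAlgebra _ p
  have : IsLocalization.AtPrime ((Spec (.of NodeCoord)).presheaf.stalk p) originIdeal :=
    StructureSheaf.IsLocalization.to_stalk _ p
  let e2 : NodeRing ≃ₐ[NodeCoord] (Spec (.of NodeCoord)).presheaf.stalk p :=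
    IsLocalization.algEquiv originIdeal.primeCompl _ _
  refine isNodeAt_of_equiv (e2.toRingEquiv.trans e1.symm) fun c => ?_
  change e1.symm (e2 (algebraMap ℂ NodeRing c)) = _
  rw [RingEquiv.symm_apply_eq]
  rw [IsScalarTower.algebraMap_apply ℂ NodeCoord NodeRing, AlgEquiv.commutes]
  exact (stalkMap_stalkScalars g.1 g.2 p c).symm

end Node

end NodeHilb

end

/-! ### Assembly of the theorem. -/

theorem proposition1p1 (m : ℕ) (hm : 1 ≤ m) :
    -- the classification of the ideals of colength `m`
    (∀ I : Ideal NodeHilb.NodeRing, NodeHilb.HasColength I m ↔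
      (∃ i : ℕ, 1 ≤ i ∧ i ≤ m - 1 ∧ ∃ a : ℂ, a ≠ 0 ∧ I = NodeHilb.idealI m i a) ∨
      (∃ i : ℕ, 1 ≤ i ∧ i ≤ m ∧ I = NodeHilb.idealQ m i)) ∧
    (2 ≤ m →
      -- the punctual Hilbert scheme, whose closed points are the ideals of colength `m`
      (∃ H : NodeHilb.PunctualHilb m,
        Set.BijOn H.idealOf Set.univ {I | NodeHilb.HasColength I m} ∧
        -- the curves `C^m_i`
        (∀ i : ℕ, 1 ≤ i → i ≤ m - 1 →
          NodeHilb.IsProjLineIn H.π (H.curveC i) ∧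
          (∀ g : NodeHilb.Points H.π ℂ, H.pt g ∈ H.curveC i ↔
            (∃ a : ℂ, a ≠ 0 ∧ H.idealOf g = NodeHilb.idealI m i a) ∨
            H.idealOf g = NodeHilb.idealQ m i ∨
            H.idealOf g = NodeHilb.idealQ m (i + 1)) ∧
          H.HasLimitAtZero (NodeHilb.idealI m i) (NodeHilb.idealQ m i) ∧
          H.HasLimitAtInfinity (NodeHilb.idealI m i) (NodeHilb.idealQ m (i + 1))) ∧
        -- the scheme is the chain of these curves
        IsReduced H.X ∧
        (∀ z : H.X, ∃ i : ℕ, 1 ≤ i ∧ i ≤ m - 1 ∧ z ∈ H.curveC i) ∧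
        (∀ i : ℕ, 1 ≤ i → i + 1 ≤ m - 1 →
          H.curveC i ∩ H.curveC (i + 1) = H.pointQ (i + 1)) ∧
        (∀ i j : ℕ, 1 ≤ i → i + 2 ≤ j → j ≤ m - 1 → H.curveC i ∩ H.curveC j = ∅) ∧
        -- the nodes and the smooth points
        (∀ i : ℕ, 2 ≤ i → i ≤ m - 1 → ∀ z ∈ H.pointQ i, NodeHilb.IsNodeAt H.π z) ∧
        (∀ z : H.X, (∀ i : ℕ, 2 ≤ i → i ≤ m - 1 → z ∉ H.pointQ i) →
          NodeHilb.IsSmoothCurveAt H.π z)) ∧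
      -- the ideals of colength `m - 1` containing a given ideal of colength `m`
      (∀ (i : ℕ) (a : ℂ), 1 ≤ i → i ≤ m - 1 → a ≠ 0 → ∀ J : Ideal NodeHilb.NodeRing,
        (NodeHilb.HasColength J (m - 1) ∧ NodeHilb.idealI m i a ≤ J) ↔
          J = NodeHilb.idealQ (m - 1) i) ∧
      (∀ i : ℕ, 1 ≤ i → i ≤ m → ∀ J : Ideal NodeHilb.NodeRing,
        (NodeHilb.HasColength J (m - 1) ∧ NodeHilb.idealQ m i ≤ J) ↔
          (2 ≤ i ∧ i ≤ m - 1 ∧ ∃ a : ℂ, a ≠ 0 ∧ J = NodeHilb.idealI (m - 1) (i - 1) a) ∨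
          (i ≤ m - 1 ∧ J = NodeHilb.idealQ (m - 1) i) ∨
          (2 ≤ i ∧ J = NodeHilb.idealQ (m - 1) (i - 1)))) := by
  refine ⟨NodeHilb.hasColength_iff hm, fun hm2 => ⟨⟨NodeHilb.punctualHilb m hm,
    NodeHilb.bijOn_idealOf hm, fun i h1 h2 => ?_, NodeHilb.isReduced_chain hm2, fun z => ?_,
    fun i h1 h2 => ?_, fun i j h1 hij h2 => ?_, fun i h1 h2 z hz => ?_, fun z hz => ?_⟩, ?_, ?_⟩⟩
  · have h2' : i + 1 ≤ m := by omega
    have hC := NodeHilb.curveC_eq h1 h2' hm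
    refine ⟨?_, fun g => ?_, NodeHilb.hasLimitAtZero hm h1 h2',
      NodeHilb.hasLimitAtInfinity hm h1 h2'⟩
    · rw [hC]
      exact NodeHilb.isProjLineIn_curveSet h1 h2'
    · rw [hC]
      exact NodeHilb.pt_mem_curveSet_iff h1 h2' hm g
  · obtain ⟨i, h1, h2, hz⟩ := NodeHilb.exists_mem_curveSet hm2 z
    refine ⟨i, h1, by omega, ?_⟩
    rw [NodeHilb.curveC_eq h1 (by omega) hm]
    exact hz
  · rw [NodeHilb.curveC_eq h1 (by omega) hm, NodeHilb.curveC_eq (by omega) (by omega) hm]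
    exact NodeHilb.curveSet_inter_succ hm h1 (by omega)
  · rw [NodeHilb.curveC_eq h1 (by omega) hm, NodeHilb.curveC_eq (by omega) (by omega) hm]
    exact NodeHilb.curveSet_inter_eq_empty hij
  · have h2' : i + 1 ≤ m := by omega
    obtain ⟨rfl⟩ := NodeHilb.exists_nodeChart_eq h1 h2' z
      ((NodeHilb.mem_pointQ_iff hm (by omega) (by omega) z).mp hz)
    have := (NodeHilb.nodeChart_spec h1 h2').1
    exact NodeHilb.isNodeAt_of_isOpenImmersion (NodeHilb.nodeChart h1 h2')
  · refine NodeHilb.isSmoothCurveAt_chain hm2 z fun i h1 h2 => ?_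
    by_contra! h
    exact hz i h1 h2 ((NodeHilb.mem_pointQ_iff hm (by omega) (by omega) z).mpr h)
  · obtain ⟨n, rfl⟩ : ∃ n, m = n + 1 := ⟨m - 1, by omega⟩
    intro i a h1 h2 ha J
    exact NodeHilb.idealI_succ_le_iff h1 h2 ha J
  · obtain ⟨n, rfl⟩ : ∃ n, m = n + 1 := ⟨m - 1, by omega⟩
    intro i h1 h2 J
    exact NodeHilb.idealQ_succ_le_iff (by omega) h1 h2 J
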